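/- **Lemma (vertical boundary homeomorphism).** *Definitions.* A *Busemann function* on a metric space $P$ is a function of the form $\beta(x)=\lim_{t\to\infty}\bigl(d(\gamma(t),x)-t\bigr)$ with $\gamma:\mathbb R\to P$ an isometric embedding; it is *based at* the point $\gamma(+\infty)$ of the boundary. The boundary $\partial P$ is the set of geodesic rays from a base point $o$, modulo being at finite Hausdorff distance, with the (quotient of the) compact-open topology, and the *parabolic boundary* is $\partial_\infty P=\partial P\setminus\{\infty\}$, where $\infty$ is the point at which $\beta$ is based, with the subspace topology. A *Heintze group* is $H=N\rtimes_\alpha\mathbb R$, where $N$ is a simply connected nilpotent Lie group and $\alpha_t\in\mathrm{Aut}(N)$ has differential $e^{tD}$, for a derivation $D$ of $\mathrm{Lie}(N)$ all of whose eigenvalues have positive real part. It carries a left-invariant Riemannian metric of negative sectional curvature, scaled so that $\beta_H(n,t)=-t$ is a Busemann function, i.e. so that $(n,t)\mapsto t$ has gradient of norm $1$. Let $T_k$ ($k\ge 1$) be the $(k+1)$-regular tree (geometric realization, edges of length $1$) with a Busemann function $\beta_T$. The *millefeuille space* is $H[k]=\{(x,v)\in H\times T_k:\beta_H(x)=\beta_T(v)\}$,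 with the length metric induced by the metric $\max(d_H,d_T)$ and the Busemann function $\beta(x,v)=\beta_H(x)$. Let $X$ and $Y$ be millefeuille spaces with Busemann functions $\beta_X,\beta_Y$, and let $\|\cdot\|$ be a norm on $\mathbb R^2$ with $\|(1,1)\|=1$ and $\|(x,y)\|\ge\frac{x+y}2$ for all $x,y$, non-decreasing in each factor on $[0,\infty)^2$. The *horocyclic product* is $X\bowtie Y=\{(x,y)\in X\times Y:\beta_X(x)=-\beta_Y(y)\}$; its distance is the infimum over paths $\gamma:[0,1]\to X\bowtie Y$ between two points of the length $\sup_{0=t_0<\dots<t_m=1}\sum_i\|(d_X(\gamma(t_i),\gamma(t_{i+1})),d_Y(\gamma(t_i),\gamma(t_{i+1})))\|$, where $d_X,d_Y$ are the distances of the $X$- and $Y$-coordinates. Its height function is $h(x,y)=-\beta_X(x)=\beta_Y(y)$. The *vertical boundary* $\mathcal V(X\bowtie Y)$ is the space of isometric embeddings $\gamma:\mathbb R\to X\bowtie Y$ with $h(\gamma(t))=t$ for all $t$ (height-parameterized vertical geodesics), with the compact-open topology. *Statement.* For all such $X$, $Y$ and $\|\cdot\|$, and all base points, $\mathcal V(X\bowtie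 Y)$ is homeomorphic to $\partial_\infty X\times\partial_\infty Y$. More precisely, there is a homeomorphism $\mathcal V(X\bowtie Y)\to\partial_\infty X\times\partial_\infty Y$ that sends $\gamma=(\gamma_X,\gamma_Y)$ to $(\gamma_X(-\infty),\gamma_Y(+\infty))$. -/

import Mathlib

open scoped Manifold ContDiff ENNReal NNReal

noncomputable section

namespace Horo

/-! ## Length metrics -/

/-- A subset `S` of a metric space `A`, to be equipped with its induced length metric. -/
@[ext] structure LengthSubspace {A : Type*} (S : Set A) where
  point : A
  mem : point ∈ S

namespace LengthSubspace

variable {A : Type*} [PseudoEMetricSpace A] {S : Set A}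

/-- The length of a path in `S` measured in `A`: the supremum over all partitions
`t₀ ≤ … ≤ tₙ` of `[0,1]` of the sums of the distances of consecutive points. -/
def pathLength {x y : S} (γ : Path x y) : ℝ≥0∞ :=
  eVariationOn (fun t => (γ t : A)) Set.univ

theorem pathLength_refl (x : S) : pathLength (Path.refl x) = 0 := by
  refine eVariationOn.constant_on ?_
  rintro _ ⟨s, -, rfl⟩ _ ⟨t, -, rfl⟩
  rfl

theorem pathLength_symm_le {x y : S} (γ : Path x y) : pathLength γ.symm ≤ pathLength γ := by
  refine eVariationOn.comp_le_of_antitoneOn (fun t => (γ t : A)) (t := Set.univ) unitInterval.symm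
    ?_ (fun _ _ => Set.mem_univ _)
  intro a _ b _ hab
  exact unitInterval.symm_le_symm.2 hab

theorem pathLength_trans_le {x y z : S} (γ : Path x y) (γ' : Path y z) :
    pathLength (γ.trans γ') ≤ pathLength γ + pathLength γ' := by
  let h : unitInterval := ⟨1 / 2, by constructor <;> norm_num⟩
  have hu : (Set.univ : Set unitInterval) = Set.Iic h ∪ Set.Ici h := Set.Iic_union_Ici.symm
  have h1 : IsGreatest (Set.Iic h) h := isGreatest_Iic
  have h2 : IsLeast (Set.Ici h) h := isLeast_Ici
  unfold pathLength
  rw [hu, eVariationOn.union _ h1 h2, ← hu]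
  gcongr
  · let φ : unitInterval → unitInterval := fun t => Set.projIcc 0 1 zero_le_one (2 * (t : ℝ))
    have e : Set.EqOn (fun t => ((γ.trans γ') t : A)) ((fun t => (γ t : A)) ∘ φ) (Set.Iic h) := by
      intro t ht
      have ht' : (t : ℝ) ≤ 1 / 2 := ht
      have hm : 2 * (t : ℝ) ∈ unitInterval := ⟨by linarith [t.2.1], by linarith⟩
      simp only [Path.trans_apply, ht', dif_pos, Function.comp, φ, Set.projIcc_of_mem _ hm]
    rw [eVariationOn.congr e]
    refine eVariationOn.comp_le_of_monotoneOn _ φ ?_ (fun _ _ => Set.mem_univ _)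
    intro a _ b _ hab
    exact Set.monotone_projIcc _ (by have : (a : ℝ) ≤ b := hab; linarith)
  · let φ : unitInterval → unitInterval := fun t => Set.projIcc 0 1 zero_le_one (2 * (t : ℝ) - 1)
    have e : Set.EqOn (fun t => ((γ.trans γ') t : A)) ((fun t => (γ' t : A)) ∘ φ) (Set.Ici h) := by
      intro t ht
      have ht' : 1 / 2 ≤ (t : ℝ) := ht
      have hm : 2 * (t : ℝ) - 1 ∈ unitInterval := ⟨by linarith, by linarith [t.2.2]⟩
      rcases ht'.eq_or_lt with h0 | h0
      · have : (t : ℝ) ≤ 1 / 2 := h0.symm.le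
        have e1 : (2 * (t : ℝ)) = 1 := by linarith
        have e2 : (2 * (t : ℝ) - 1) = 0 := by linarith
        simp only [Path.trans_apply, this, dif_pos, Function.comp, φ, e1, sub_self]
        have a1 : (⟨1, by simp⟩ : unitInterval) = 1 := rfl
        have a0 : Set.projIcc (0 : ℝ) 1 zero_le_one 0 = (0 : unitInterval) := Set.projIcc_left _
        rw [a0, γ'.source]
        simp
      · simp only [Path.trans_apply, not_le.2 h0, dif_neg, Function.comp, φ,
          Set.projIcc_of_mem _ hm, not_false_eq_true]
    rw [eVariationOn.congr e]
    refine eVariationOn.comp_le_of_monotoneOn _ φ ?_ (fun _ _ => Set.mem_univ _)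
    intro a _ b _ hab
    exact Set.monotone_projIcc _ (by have : (a : ℝ) ≤ b := hab; linarith)

/-- The induced length metric: the infimum of the lengths of the continuous paths in `S`. -/
instance : PseudoEMetricSpace (LengthSubspace S) where
  edist x y := ⨅ γ : Path (⟨x.point, x.mem⟩ : S) ⟨y.point, y.mem⟩, pathLength γ
  edist_self x := le_antisymm ((iInf_le _ (Path.refl _)).trans (pathLength_refl _).le) bot_le
  edist_comm x y := le_antisymm
    (le_iInf fun γ => (iInf_le _ γ.symm).trans (pathLength_symm_le γ))
    (le_iInf fun γ => (iInf_le _ γ.symm).trans (pathLength_symm_le γ))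
  edist_triangle x y z := ENNReal.le_iInf_add_iInf fun γ γ' =>
    (iInf_le _ (γ.trans γ')).trans (pathLength_trans_le γ γ')

end LengthSubspace

/-! ## Busemann functions and parabolic boundaries -/

section Boundary

variable {P : Type*} [PseudoEMetricSpace P]

/-- `β` is the Busemann function of the geodesic line `γ`. -/
def IsBusemannFunction (β : P → ℝ) (γ : ℝ → P) : Prop :=
  Isometry γ ∧
    ∀ x, Filter.Tendsto (fun t => (edist (γ t) x).toReal - t) Filter.atTop (nhds (β x))

/-- Geodesic rays starting at `o`, with the compact-open topology. -/
abbrev GeodesicRay (o : P) : Type _ := {r : C(ℝ≥0, P) // Isometry r ∧ r 0 = o}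

/-- Two parametrized curves are asymptotic if their images are at finite Hausdorff distance. -/
def Asymptotic (c c' : ℝ≥0 → P) : Prop :=
  Metric.hausdorffEDist (Set.range c) (Set.range c') ≠ ⊤

instance raySetoid (o : P) : Setoid (GeodesicRay o) where
  r c c' := Asymptotic c.1 c'.1
  iseqv :=
    { refl := fun c => by simp [Asymptotic, Metric.hausdorffEDist_self]
      symm := fun {c c'} h => by
        unfold Asymptotic at *
        rwa [Metric.hausdorffEDist_comm]
      trans := fun {c c' c''} h h' => by
        unfold Asymptotic at *
        exact ne_top_of_le_ne_top (ENNReal.add_ne_top.2 ⟨h, h'⟩) Metric.hausdorffEDist_triangle }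

/-- The geodesic boundary of `P` based at `o`, with the quotient of the compact-open topology. -/
abbrev GeodesicBoundary (o : P) : Type _ := Quotient (raySetoid o)

/-- The curve `c` converges to the boundary point `ξ`: it is at finite Hausdorff distance from
the rays in the class `ξ`. -/
def EndsAt {o : P} (c : ℝ≥0 → P) (ξ : GeodesicBoundary o) : Prop :=
  ∃ r : GeodesicRay o, (⟦r⟧ : GeodesicBoundary o) = ξ ∧ Asymptotic r.1 c

/-- `ξ` is the point at infinity at which the Busemann function `β` is based. -/
def IsBasedAt (β : P → ℝ) {o : P} (ξ : GeodesicBoundary o) : Prop :=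
  ∃ γ : ℝ → P, IsBusemannFunction β γ ∧ EndsAt (fun t : ℝ≥0 => γ t) ξ

/-- The parabolic boundary `∂_∞ P = ∂P \ {∞}`, where `∞` is the point at which the Busemann
function `β` is based; it carries the subspace topology. -/
abbrev ParabolicBoundary (β : P → ℝ) (o : P) : Type _ :=
  {ξ : GeodesicBoundary o // ¬ IsBasedAt β ξ}

end Boundary

/-! ## Heintze groups -/

section Heintze

variable (E N : Type*) [NormedAddCommGroup E] [NormedSpace ℝ E] [FiniteDimensional ℝ E]
  [TopologicalSpace N] [ChartedSpace E N] [Group N] [LieGroup 𝓘(ℝ, E) ∞ N]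

/-- The bracket of the Lie algebra of `N`, the tangent space at `1`, whose underlying vector
space is `E`. -/
def lieBracket (v w : E) : E :=
  @Bracket.bracket (GroupLieAlgebra 𝓘(ℝ, E) N) (GroupLieAlgebra 𝓘(ℝ, E) N) _ v w

/-- The bracket of the Lie algebra `Lie(N) ⋊_D ℝ` of `N ⋊ ℝ`. -/
def semidirectBracket (D : E →L[ℝ] E) (x y : E × ℝ) : E × ℝ :=
  (lieBracket E N x.1 y.1 + x.2 • D y.1 - y.2 • D x.1, 0)

/-- The left-invariant metric defined by the inner product `Q` on `Lie(N) ⋊_D ℝ` has negative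
sectional curvature. On left-invariant vector fields the Levi-Civita connection `nabla` is the
bilinear map determined by the Koszul formula, and the sectional curvature of the plane spanned
by `x` and `y` has the sign of `⟨R(x,y)y,x⟩`. -/
def NegativelyCurved (D : E →L[ℝ] E) (Q : LinearMap.BilinForm ℝ (E × ℝ)) : Prop :=
  ∃ nabla : E × ℝ → E × ℝ → E × ℝ,
    (∀ x y z, 2 * Q (nabla x y) z =
      Q (semidirectBracket E N D x y) z - Q (semidirectBracket E N D y z) x
        + Q (semidirectBracket E N D z x) y) ∧
    ∀ x y, LinearIndependent ℝ ![x, y] →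
      Q (nabla x (nabla y y) - nabla y (nabla x y)
        - nabla (semidirectBracket E N D x y) y) x < 0

/-- A Heintze group `N ⋊_α ℝ` with a left-invariant Riemannian metric of negative curvature for
which `(n, t) ↦ -t` is a Busemann function. -/
structure HeintzeGroup where
  nilpotent : Group.IsNilpotent N
  simplyConnected : SimplyConnectedSpace N
  /-- The derivation of `Lie(N)`. -/
  D : E →L[ℝ] E
  derivation : ∀ v w, D (lieBracket E N v w) = lieBracket E N (D v) w + lieBracket E N v (D w)
  /-- The (complex) eigenvalues of `D` have positive real part. -/
  eigenvalues : ∀ z : ℂ,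
    ((D : E →ₗ[ℝ] E).charpoly.map (algebraMap ℝ ℂ)).IsRoot z → 0 < z.re
  /-- The one-parameter group of automorphisms of `N` with differential `exp (t D)`. -/
  α : Multiplicative ℝ →* MulAut N
  α_smooth : ∀ t, ContMDiff 𝓘(ℝ, E) 𝓘(ℝ, E) ∞ (α t)
  α_deriv : ∀ (t : ℝ) (v : E),
    (mfderiv 𝓘(ℝ, E) 𝓘(ℝ, E) (α (Multiplicative.ofAdd t)) (1 : N) v : E)
      = NormedSpace.exp (t • D) v
  /-- The inner product on the Lie algebra `Lie(N) × ℝ` that defines the metric. -/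
  Q : LinearMap.BilinForm ℝ (E × ℝ)
  symm : ∀ x y, Q x y = Q y x
  pos : ∀ x, x ≠ 0 → 0 < Q x x
  negativelyCurved : NegativelyCurved E N D Q
  /-- The scale of the metric: the vector of the form `(v, 1)` that is orthogonal to `Lie(N)` has
  length one. So `(n, t) ↦ t` has a gradient of length one, and `(n, t) ↦ -t` is a Busemann
  function (for a general left-invariant metric this holds up to a constant factor). -/
  normalized : ∃ v : E, (∀ w : E, Q (v, 1) (w, 0) = 0) ∧ Q (v, 1) (v, 1) = 1

variable {E N}

namespace HeintzeGroup

variable (H : HeintzeGroup E N)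

/-- The points of the group `N ⋊_α ℝ`, as the product manifold `N × ℝ`. -/
def toGroup : N × ℝ ≃ N ⋊[H.α] Multiplicative ℝ where
  toFun p := ⟨p.1, Multiplicative.ofAdd p.2⟩
  invFun g := (g.left, Multiplicative.toAdd g.right)
  left_inv _ := rfl
  right_inv _ := rfl

/-- Left translation by `p⁻¹` in the group `N ⋊_α ℝ`. -/
def leftInv (p q : N × ℝ) : N × ℝ :=
  H.toGroup.symm ((H.toGroup p)⁻¹ * H.toGroup q)

/-- A tangent vector at `p`, translated to the identity. -/
def toLieAlgebra (p : N × ℝ) (w : TangentSpace (𝓘(ℝ, E).prod 𝓘(ℝ, ℝ)) p) : E × ℝ :=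
  mfderiv (𝓘(ℝ, E).prod 𝓘(ℝ, ℝ)) (𝓘(ℝ, E).prod 𝓘(ℝ, ℝ)) (H.leftInv p) p w

theorem toLieAlgebra_smul (p : N × ℝ) (c : ℝ) (w : TangentSpace (𝓘(ℝ, E).prod 𝓘(ℝ, ℝ)) p) :
    H.toLieAlgebra p (c • w) = c • H.toLieAlgebra p w :=
  (mfderiv (𝓘(ℝ, E).prod 𝓘(ℝ, ℝ)) (𝓘(ℝ, E).prod 𝓘(ℝ, ℝ)) (H.leftInv p) p).map_smul c w

/-- The left-invariant Riemannian metric: the norm of a tangent vector at `p` is the norm of its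
translate to the identity. -/
abbrev tangentNorm (p : N × ℝ) : ENorm (TangentSpace (𝓘(ℝ, E).prod 𝓘(ℝ, ℝ)) p) where
  enorm w := ENNReal.ofReal (Real.sqrt (H.Q (H.toLieAlgebra p w) (H.toLieAlgebra p w)))

theorem tangentNorm_smul (p : N × ℝ) :
    letI := H.tangentNorm p
    ENormSMulClass ℝ (TangentSpace (𝓘(ℝ, E).prod 𝓘(ℝ, ℝ)) p) := by
  let _ := H.tangentNorm p
  constructor
  intro c w
  change ENNReal.ofReal (Real.sqrt _) = ‖c‖ₑ * ENNReal.ofReal (Real.sqrt _)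
  rw [toLieAlgebra_smul, map_smul, map_smul, LinearMap.smul_apply, smul_eq_mul, smul_eq_mul,
    ← mul_assoc, Real.sqrt_mul (mul_self_nonneg c), Real.sqrt_mul_self_eq_abs,
    ENNReal.ofReal_mul (abs_nonneg c), ← Real.norm_eq_abs, ofReal_norm]

/-- The Heintze group as a metric space. -/
@[ext] structure Space (H : HeintzeGroup E N) where
  point : N × ℝ

/-- The Riemannian distance: the infimum of the lengths of `C¹` paths. -/
instance : PseudoEMetricSpace H.Space where
  edist x y :=
    letI := H.tangentNorm
    Manifold.riemannianEDist (𝓘(ℝ, E).prod 𝓘(ℝ, ℝ)) x.point y.point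
  edist_self x :=
    letI := H.tangentNorm
    haveI := H.tangentNorm_smul
    Manifold.riemannianEDist_self
  edist_comm x y :=
    letI := H.tangentNorm
    haveI := H.tangentNorm_smul
    Manifold.riemannianEDist_comm
  edist_triangle x y z :=
    letI := H.tangentNorm
    haveI := H.tangentNorm_smul
    Manifold.riemannianEDist_triangle

/-- The Busemann function `β(n, t) = -t`. -/
def busemann (x : H.Space) : ℝ := -x.point.2

end HeintzeGroup

end Heintze

/-! ## Regular trees -/

/-- The points of the geometric realization of a graph (without isolated vertices), in
barycentric coordinates. -/
@[ext] structure Realization {V : Type*} (G : SimpleGraph V) where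
  coord : V → ℝ
  nonneg : ∀ v, 0 ≤ coord v
  mem_edge : ∃ u v, G.Adj u v ∧ coord u + coord v = 1 ∧ ∀ w, w ≠ u → w ≠ v → coord w = 0

namespace Realization

variable {V : Type*} {G : SimpleGraph V}

/-- `x` lies on the closed edge between `u` and `v`. -/
def OnEdge (x : Realization G) (u v : V) : Prop :=
  G.Adj u v ∧ x.coord u + x.coord v = 1 ∧ ∀ w, w ≠ u → w ≠ v → x.coord w = 0

/-- There is a piecewise linear path of length `l` from one point to another: a finite sequence
of points, consecutive ones lying on a common edge, edges being isometric to `[0,1]`. -/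
inductive PLPath : Realization G → Realization G → ℝ≥0∞ → Prop
  | nil (x : Realization G) : PLPath x x 0
  | cons {x y z : Realization G} {u v : V} {l : ℝ≥0∞} (hx : x.OnEdge u v) (hy : y.OnEdge u v)
      (h : PLPath y z l) : PLPath x z (ENNReal.ofReal |x.coord u - y.coord u| + l)

theorem PLPath.append {x y z : Realization G} {l l' : ℝ≥0∞} (h : PLPath x y l)
    (h' : PLPath y z l') : PLPath x z (l + l') := by
  induction h with
  | nil x => simpa using h'
  | cons hx hy _ ih => rw [add_assoc]; exact .cons hx hy (ih h')

theorem PLPath.symm {x y : Realization G} {l : ℝ≥0∞} (h : PLPath x y l) : PLPath y x l := by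
  induction h with
  | nil x => exact .nil x
  | cons hx hy _ ih =>
    have := ih.append (.cons hy hx (.nil _))
    rwa [add_zero, add_comm, abs_sub_comm] at this

/-- The path metric of the geometric realization. -/
instance : PseudoEMetricSpace (Realization G) where
  edist x y := ⨅ (l : ℝ≥0∞) (_ : PLPath x y l), l
  edist_self x := le_antisymm (iInf₂_le 0 (.nil x)) bot_le
  edist_comm x y := le_antisymm
    (le_iInf₂ fun l h => iInf₂_le l h.symm) (le_iInf₂ fun l h => iInf₂_le l h.symm)
  edist_triangle x y z := by
    simp only [ENNReal.iInf_add, ENNReal.add_iInf, le_iInf_iff]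
    intro l' h' l h
    exact iInf₂_le _ (h.append h')

end Realization

/-- The `(k+1)`-regular tree with a Busemann function on its geometric realization. -/
structure RegularTree (V : Type*) where
  G : SimpleGraph V
  isTree : G.IsTree
  k : ℕ
  regular : ∀ v, (G.neighborSet v).ncard = k + 1
  busemann : Realization G → ℝ
  isBusemann : ∃ γ : ℝ → Realization G, IsBusemannFunction busemann γ

/-! ## Millefeuille spaces -/

section Millefeuille

variable {E N V : Type*} [NormedAddCommGroup E] [NormedSpace ℝ E] [FiniteDimensional ℝ E]
  [TopologicalSpace N] [ChartedSpace E N] [Group N] [LieGroup 𝓘(ℝ, E) ∞ N]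

/-- The millefeuille space `X[k] = {(x, v) ∈ X × T_k | β_X(x) = β_T(v)}` with its length metric,
induced by the supremum metric on `X × T_k`. As `β_X` is `1`-Lipschitz, all the leaves
`X[k] ∩ (X × ℓ)`, with `ℓ` a geodesic line in `T_k` on which `β_T` is an isometry to `ℝ`, are
isometric copies of `X`. -/
abbrev Millefeuille (H : HeintzeGroup E N) (T : RegularTree V) : Type _ :=
  LengthSubspace {p : H.Space × Realization T.G | H.busemann p.1 = T.busemann p.2}

/-- The Busemann function of a millefeuille space, the common value of `β_X` and `β_T`. -/
def Millefeuille.busemann {H : HeintzeGroup E N} {T : RegularTree V} (p : Millefeuille H T) : ℝ :=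
  H.busemann p.point.1

end Millefeuille

/-! ## Horocyclic products -/

/-- An admissible monotone norm on `ℝ²`. -/
structure AdmissibleNorm where
  N : Seminorm ℝ (ℝ × ℝ)
  eq_zero : ∀ p, N p = 0 → p = 0
  one_one : N (1, 1) = 1
  average_le : ∀ x y : ℝ, (x + y) / 2 ≤ N (x, y)
  monotone : ∀ x y x' y' : ℝ, 0 ≤ x → x ≤ x' → 0 ≤ y → y ≤ y' → N (x, y) ≤ N (x', y')

/-- The product of two spaces with the metric `N(d_P, d_R)`. -/
@[ext] structure NormProd (n : AdmissibleNorm) (P R : Type*) where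
  fst : P
  snd : R

namespace NormProd

variable {n : AdmissibleNorm} {P R : Type*} [PseudoEMetricSpace P] [PseudoEMetricSpace R]

open Classical in
/-- The metric `N(d_P, d_R)`, infinite if one of the two distances is infinite. -/
instance : PseudoEMetricSpace (NormProd n P R) where
  edist x y := if edist x.fst y.fst = ⊤ ∨ edist x.snd y.snd = ⊤ then ⊤ else
    ENNReal.ofReal (n.N ((edist x.fst y.fst).toReal, (edist x.snd y.snd).toReal))
  edist_self x := by
    have : n.N ((0 : ℝ), (0 : ℝ)) = 0 := map_zero n.N
    simp [this]
  edist_comm x y := by simp only [edist_comm x.fst, edist_comm x.snd]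
  edist_triangle x y z := by
    by_cases h1 : edist x.fst y.fst = ⊤ ∨ edist x.snd y.snd = ⊤
    · simp [h1]
    by_cases h2 : edist y.fst z.fst = ⊤ ∨ edist y.snd z.snd = ⊤
    · simp [h2]
    push Not at h1 h2
    have a1 := ENNReal.add_ne_top.2 ⟨h1.1, h2.1⟩
    have a2 := ENNReal.add_ne_top.2 ⟨h1.2, h2.2⟩
    have b1 := edist_triangle x.fst y.fst z.fst
    have b2 := edist_triangle x.snd y.snd z.snd
    have c1 := ne_top_of_le_ne_top a1 b1
    have c2 := ne_top_of_le_ne_top a2 b2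
    simp only [h1, h2, c1, c2, or_self, if_false]
    rw [← ENNReal.ofReal_add (apply_nonneg _ _) (apply_nonneg _ _)]
    refine ENNReal.ofReal_le_ofReal (le_trans ?_ (map_add_le_add n.N _ _))
    refine n.monotone _ _ _ _ ENNReal.toReal_nonneg ?_ ENNReal.toReal_nonneg ?_
    · rw [← ENNReal.toReal_add h1.1 h2.1]; exact ENNReal.toReal_mono a1 b1
    · rw [← ENNReal.toReal_add h1.2 h2.2]; exact ENNReal.toReal_mono a2 b2

end NormProd

section Horocyclic

variable {P R : Type*} [PseudoEMetricSpace P] [PseudoEMetricSpace R]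

/-- The horocyclic product `{(x, y) | β_P(x) = -β_R(y)}` with the length metric induced by
`N(d_P, d_R)`. -/
abbrev HorocyclicProduct (n : AdmissibleNorm) (βP : P → ℝ) (βR : R → ℝ) : Type _ :=
  LengthSubspace {p : NormProd n P R | βP p.fst = -βR p.snd}

variable {n : AdmissibleNorm} {βP : P → ℝ} {βR : R → ℝ}

/-- The height function `h(x, y) = -β_P(x) = β_R(y)` of a horocyclic product. -/
def HorocyclicProduct.height (p : HorocyclicProduct n βP βR) : ℝ := -βP p.point.fst

variable (n βP βR) in
/-- The vertical boundary: height-parameterized vertical geodesics, with the compact-open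
topology. -/
abbrev VerticalBoundary : Type _ :=
  {γ : C(ℝ, HorocyclicProduct n βP βR) //
    Isometry γ ∧ ∀ t, HorocyclicProduct.height (γ t) = t}

end Horocyclic

end Horo

end

open scoped Manifold ContDiff ENNReal NNReal

noncomputable section

namespace Horo

open Filter Topology Set

/-! ## Limits of Lipschitz maps -/

section Limits

/-! The argument is axiomatic. A height space is a metric space with a 1-Lipschitz height `h` such
that a vertical line (an isometric line parametrized by height) passes through every point, points
vertically above a given point are determined by their height, and points at distance at most one
that move up vertically to a common height approach each other exponentially fast. Write `proj M x`
for the point at height `M` above `x`.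

Contraction has two consequences. A path of length `ℓ` below height `R` has endpoints whose
projections to height `M` are `O(e^{-r(M-R)}(ℓ+1))` apart, and a path descending at a definite speed
has projections a bounded distance apart, however long it is. Hence a geodesic descends at unit
speed, up to a constant, on either side of its highest point. A ray therefore either ascends
forever, following a vertical line to the centre of the Busemann function `-h`, or ends up
descending along a vertical line. Two vertical lines that stay at bounded distance downwards are
equal, by projecting from far below. So in a proper geodesic height space the vertical lines
correspond to the parabolic boundary through their lower ends. All constants are uniform, so limits
of 1-Lipschitz maps along ultrafilters give continuity in both directions
(`exists_homeomorph_parabolicBoundary`).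

In a horocyclic product, a height-parametrized geodesic satisfies `d_X + d_Y ≤ 2|s-t|`, because the
norm dominates the average, while each term is at least `|s-t|`, because heights are 1-Lipschitz.
Both are equal to `|s-t|`, so the geodesic is a pair of vertical lines, one of them traversed
backwards (`exists_homeomorph_verticalLines`).

It remains to see that a millefeuille space is a proper geodesic height space. It is a fibre product
of a Heintze group and a tree. In the tree nearby points acquire the same ancestor after a bounded
ascent, after which both points of the fibre product lie in one leaf, a copy of the group. In the
group the unit field orthogonal to `Lie(N)` integrates to a one-parameter subgroup; projection along
its left translates to a height `a` above has differential `e^{-aD}` between fixed linear maps, and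
this decays because the eigenvalues of `D` have positive real part. -/

/-- 1-Lipschitz maps are equicontinuous, and on an equicontinuous family pointwise convergence is
uniform on compact sets. -/
theorem tendsto_continuousMap_of_pointwise {X Y ι : Type*} [PseudoEMetricSpace X]
    [PseudoEMetricSpace Y] {F : ι → C(Y, X)} (hF : ∀ i, LipschitzWith 1 (F i))
    {f : C(Y, X)} {l : Filter ι} (h : ∀ y, Tendsto (fun i => F i y) l (𝓝 (f y))) :
    Tendsto F l (𝓝 f) := by
  rw [ContinuousMap.isUniformEmbedding_toUniformOnFunIsCompact.isInducing.tendsto_nhds_iff]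
  have hE : ∀ K ∈ {K : Set Y | IsCompact K}, EquicontinuousOn (fun i => (F i : Y → X)) K :=
    fun K _ => ((LipschitzWith.uniformEquicontinuous _ 1 hF).equicontinuous).equicontinuousOn K
  refine (EquicontinuousOn.tendsto_uniformOnFun_iff_pi (𝔖 := {K : Set Y | IsCompact K})
    (fun K hK => hK) (eq_univ_iff_forall.2 fun y => mem_sUnion_of_mem (mem_singleton y)
      isCompact_singleton) hE l f).2 ?_
  exact tendsto_pi_nhds.2 h

variable {X Y ι : Type*} [MetricSpace X] [PseudoMetricSpace Y]

/-- Arzelà–Ascoli along an ultrafilter: the values at each point lie in a compact ball, so they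
converge, and the pointwise limit is again 1-Lipschitz. No subsequences are needed, which also suits
continuity proofs on spaces not known to be metrizable. -/
theorem exists_tendsto_ultrafilter [ProperSpace X] (u : Ultrafilter ι) {F : ι → C(Y, X)}
    (hF : ∀ i, LipschitzWith 1 (F i)) (y₀ : Y) (p : X) (R : ℝ)
    (hb : ∀ᶠ i in (u : Filter ι), dist (F i y₀) p ≤ R) :
    ∃ f : C(Y, X), Tendsto F u (𝓝 f) := by
  have key : ∀ y, ∃ x, Tendsto (fun i => F i y) u (𝓝 x) := by
    intro y
    have h1 : ∀ᶠ i in (u : Filter ι), F i y ∈ Metric.closedBall p (R + dist y y₀) := by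
      filter_upwards [hb] with i hi
      have := (hF i).dist_le_mul y y₀
      simp only [NNReal.coe_one, one_mul] at this
      rw [Metric.mem_closedBall]
      linarith [dist_triangle (F i y) (F i y₀) p]
    have hc := isCompact_closedBall p (R + dist y y₀)
    obtain ⟨x, -, hx⟩ := hc.ultrafilter_le_nhds (u.map fun i => F i y) (le_principal_iff.2 h1)
    exact ⟨x, hx⟩
  choose f hf using key
  have hL : LipschitzWith 1 f := by
    refine LipschitzWith.of_dist_le_mul fun a b => ?_
    refine le_of_tendsto ((hf a).dist (hf b)) (Eventually.of_forall fun i => ?_)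
    exact (hF i).dist_le_mul a b
  exact ⟨⟨f, hL.continuous⟩, tendsto_continuousMap_of_pointwise hF hf⟩

end Limits

/-! ## Spaces with a height function and contracting vertical lines -/

section Height

variable {X : Type*} [MetricSpace X]

/-- A vertical line: an isometric line parametrized by height. -/
def IsVertical (h : X → ℝ) (γ : ℝ → X) : Prop :=
  Isometry γ ∧ ∀ t, h (γ t) = t

/-- Geodesic segments exist between all pairs of points. -/
def IsGeodesicSpace (X : Type*) [MetricSpace X] : Prop :=
  ∀ x y : X, ∃ c : ℝ → X, c 0 = x ∧ c (dist x y) = y ∧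
    ∀ s ∈ Icc 0 (dist x y), ∀ t ∈ Icc 0 (dist x y), dist (c s) (c t) = |s - t|

/-- A metric space with a height function whose gradient lines exist and are unique in the upward
direction. -/
structure LineSpace (X : Type*) [MetricSpace X] (h : X → ℝ) : Prop where
  lip : ∀ x y, h y - h x ≤ dist x y
  line : ∀ x, ∃ γ : ℝ → X, IsVertical h γ ∧ γ (h x) = x
  unique : ∀ x y z, dist x y = h y - h x → dist x z = h z - h x → h y = h z → y = z

/-- A metric space with a height function whose gradient lines exist, are unique in the upward
direction, and converge exponentially in the upward direction. -/
structure HeightSpace (X : Type*) [MetricSpace X] (h : X → ℝ) : Prop extends LineSpace X h where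
  contr : ∃ C r : ℝ, 0 < r ∧ ∀ x y x' y', dist x y ≤ 1 → dist x x' = h x' - h x →
    dist y y' = h y' - h y → h x' = h y' → dist x' y' ≤ C * Real.exp (-r * (h x' - h x))

namespace LineSpace

variable {h : X → ℝ} (hs : LineSpace X h)
include hs

theorem abs_lip (x y : X) : |h x - h y| ≤ dist x y := by
  rw [abs_le]
  constructor <;> linarith [hs.lip x y, hs.lip y x, dist_comm x y]

theorem continuous : Continuous h := by
  have : LipschitzWith 1 h := LipschitzWith.of_dist_le_mul fun x y => by
    simpa [Real.dist_eq] using hs.abs_lip x y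
  exact this.continuous

/-- The point at height `M` on a chosen vertical line through `x`. -/
def proj (M : ℝ) (x : X) : X := (hs.line x).choose M

theorem height_proj (M : ℝ) (x : X) : h (hs.proj M x) = M := (hs.line x).choose_spec.1.2 M

theorem proj_self (x : X) : hs.proj (h x) x = x := (hs.line x).choose_spec.2

theorem dist_proj (M : ℝ) (x : X) : dist x (hs.proj M x) = |M - h x| := by
  have h1 := (hs.line x).choose_spec.1.1.dist_eq (h x) M
  rw [(hs.line x).choose_spec.2, Real.dist_eq, abs_sub_comm] at h1
  exact h1

theorem dist_proj_of_le {M : ℝ} {x : X} (hM : h x ≤ M) : dist x (hs.proj M x) = M - h x := by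
  rw [hs.dist_proj, abs_of_nonneg (sub_nonneg.2 hM)]

theorem proj_eq {x y : X} (hxy : dist x y = h y - h x) : hs.proj (h y) x = y := by
  have hle : h x ≤ h y := by linarith [dist_nonneg (x := x) (y := y)]
  refine hs.unique x _ _ ?_ hxy (hs.height_proj _ _)
  rw [hs.dist_proj_of_le hle, hs.height_proj]

theorem proj_vertical {γ : ℝ → X} (hγ : IsVertical h γ) {s t : ℝ} (hst : s ≤ t) :
    hs.proj t (γ s) = γ t := by
  have := hs.proj_eq (x := γ s) (y := γ t) (by
    rw [hγ.1.dist_eq, Real.dist_eq, hγ.2, hγ.2, abs_sub_comm, abs_of_nonneg (sub_nonneg.2 hst)])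
  rwa [hγ.2] at this

end LineSpace

namespace HeightSpace

variable {h : X → ℝ} (hs : HeightSpace X h)
include hs

/-- The contraction property in terms of projections. -/
theorem exists_contr : ∃ C r : ℝ, 0 < C ∧ 0 < r ∧ ∀ x y M, dist x y ≤ 1 → h x ≤ M → h y ≤ M →
    dist (hs.proj M x) (hs.proj M y) ≤ C * Real.exp (-r * (M - h x)) := by
  obtain ⟨C, r, hr, H⟩ := hs.contr
  refine ⟨|C| + 1, r, by positivity, hr, fun x y M hxy hx hy => ?_⟩
  refine (H x y _ _ hxy ?_ ?_ ?_).trans ?_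
  · rw [hs.dist_proj_of_le hx, hs.height_proj]
  · rw [hs.dist_proj_of_le hy, hs.height_proj]
  · rw [hs.height_proj, hs.height_proj]
  · rw [hs.height_proj]
    gcongr
    linarith [le_abs_self C]

/-- Projections of a path whose height decreases at least at speed `κ`. -/
theorem dist_proj_path_le {C r : ℝ} (hC : 0 < C) (hr : 0 < r)
    (H : ∀ x y M, dist x y ≤ 1 → h x ≤ M → h y ≤ M →
      dist (hs.proj M x) (hs.proj M y) ≤ C * Real.exp (-r * (M - h x)))
    {c : ℝ → X} {κ M : ℝ} (n : ℕ) : ∀ {a b R : ℝ}, a ≤ b → b - a ≤ n →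
    (∀ s ∈ Icc a b, ∀ t ∈ Icc a b, dist (c s) (c t) ≤ |s - t|) →
    (∀ s ∈ Icc a b, h (c s) ≤ M) → (∀ s ∈ Icc a b, h (c s) ≤ R - κ * (s - a)) →
    dist (hs.proj M (c a)) (hs.proj M (c b)) ≤
      C * Real.exp (-r * (M - R)) * ∑ i ∈ Finset.range n, Real.exp (-r * κ) ^ i := by
  induction n with
  | zero =>
    intro a b R hab hn _ _ _
    have : a = b := le_antisymm hab (by simpa using hn)
    simp [this]
  | succ n ih =>
    intro a b R hab hn hL hM hR
    have ha : a ∈ Icc a b := ⟨le_rfl, hab⟩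
    have hb : b ∈ Icc a b := ⟨hab, le_rfl⟩
    -- Over a stretch of length at most one the contraction applies directly, from a starting height
    -- at most `R`.
    have step : ∀ t ∈ Icc a b, t ≤ a + 1 →
        dist (hs.proj M (c a)) (hs.proj M (c t)) ≤ C * Real.exp (-r * (M - R)) := by
      intro t ht h1
      refine (H _ _ M ((hL a ha t ht).trans ?_) (hM a ha) (hM t ht)).trans ?_
      · rw [abs_le]; constructor <;> linarith [ht.1]
      · have := hR a ha
        gcongr C * ?_
        apply Real.exp_le_exp.2
        rw [neg_mul, neg_mul, neg_le_neg_iff]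
        gcongr
        linarith
    have hpos : 0 < C * Real.exp (-r * (M - R)) := by positivity
    rw [Finset.sum_range_succ', pow_zero]
    have hsum : 0 ≤ ∑ i ∈ Finset.range n, Real.exp (-r * κ) ^ (i + 1) :=
      Finset.sum_nonneg fun i _ => by positivity
    rcases le_or_gt b (a + 1) with h1 | h1
    · refine (step b hb h1).trans ?_
      nlinarith
    · have hsub : ∀ s ∈ Icc (a + 1) b, s ∈ Icc a b := fun s hs => ⟨by linarith [hs.1], hs.2⟩
      -- After one unit of time the height bound `R` has dropped by `κ`, which gives the remaining
      -- sum an extra factor `e^{-rκ}`.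
      have h2 := ih (a := a + 1) (b := b) (R := R - κ) h1.le (by push_cast at hn; linarith)
        (fun s hs t ht => hL s (hsub s hs) t (hsub t ht)) (fun s hs => hM s (hsub s hs))
        (fun s hs => (hR s (hsub s hs)).trans (by linarith))
      have h3 := step (a + 1) ⟨by linarith, h1.le⟩ le_rfl
      have e : C * Real.exp (-r * (M - (R - κ))) * ∑ i ∈ Finset.range n, Real.exp (-r * κ) ^ i
          = C * Real.exp (-r * (M - R)) * ∑ i ∈ Finset.range n, Real.exp (-r * κ) ^ (i + 1) := by
        have : Real.exp (-r * (M - (R - κ))) = Real.exp (-r * (M - R)) * Real.exp (-r * κ) := by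
          rw [← Real.exp_add]; ring_nf
        simp only [pow_succ', ← Finset.mul_sum, this]
        ring
      rw [e] at h2
      linarith [dist_triangle (hs.proj M (c a)) (hs.proj M (c (a + 1))) (hs.proj M (c b))]

/-- The case `κ = 0`: a path is cut into at most `b - a + 1` unit pieces, each contributing the same
amount. Passing to a high level thus shortens a path exponentially. -/
theorem exists_dist_proj_le_of_height_le : ∃ C r : ℝ, 0 < C ∧ 0 < r ∧
    ∀ (c : ℝ → X) (a b R M : ℝ), a ≤ b →
    (∀ s ∈ Icc a b, ∀ t ∈ Icc a b, dist (c s) (c t) ≤ |s - t|) →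
    (∀ s ∈ Icc a b, h (c s) ≤ R) → R ≤ M →
    dist (hs.proj M (c a)) (hs.proj M (c b)) ≤ C * Real.exp (-r * (M - R)) * (b - a + 1) := by
  obtain ⟨C, r, hC, hr, H⟩ := hs.exists_contr
  refine ⟨C, r, hC, hr, fun c a b R M hab hL hR hRM => ?_⟩
  refine (hs.dist_proj_path_le hC hr H (κ := 0) ⌈b - a⌉₊ hab (Nat.le_ceil _) hL
    (fun s hs => (hR s hs).trans hRM) (fun s hs => by simpa using hR s hs)).trans ?_
  have := Nat.ceil_lt_add_one (sub_nonneg.2 hab)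
  simp only [mul_zero, Real.exp_zero, one_pow, Finset.sum_const, Finset.card_range, nsmul_eq_mul,
    mul_one]
  gcongr

/-- For `κ > 0` the contributions of the unit pieces form a convergent geometric series, so the
bound does not depend on the length of the path. -/
theorem exists_dist_proj_le_of_height_le_sub {κ : ℝ} (hκ : 0 < κ) (D : ℝ) : ∃ C : ℝ, 0 < C ∧
    ∀ (c : ℝ → X) (a b M : ℝ), a ≤ b →
    (∀ s ∈ Icc a b, ∀ t ∈ Icc a b, dist (c s) (c t) ≤ |s - t|) →
    (∀ s ∈ Icc a b, h (c s) ≤ M) → (∀ s ∈ Icc a b, h (c s) ≤ M + D - κ * (s - a)) →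
    dist (hs.proj M (c a)) (hs.proj M (c b)) ≤ C := by
  obtain ⟨C, r, hC, hr, H⟩ := hs.exists_contr
  have hq : Real.exp (-r * κ) < 1 := by
    rw [← Real.exp_zero]
    exact Real.exp_lt_exp.2 (by nlinarith)
  refine ⟨C * Real.exp (r * D) * (1 - Real.exp (-r * κ))⁻¹, ?_, fun c a b M hab hL hM hR => ?_⟩
  · have := sub_pos.2 hq
    positivity
  refine (hs.dist_proj_path_le hC hr H (κ := κ) ⌈b - a⌉₊ hab (Nat.le_ceil _) hL hM hR).trans ?_
  have e : -r * (M - (M + D)) = r * D := by ring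
  rw [e, ← tsum_geometric_of_lt_one (Real.exp_pos _).le hq]
  gcongr
  exact (summable_geometric_of_lt_one (Real.exp_pos _).le hq).sum_le_tsum _
    (fun i _ => by positivity)

/-- A geodesic descends at unit speed, up to an additive constant, after its highest point. -/
theorem exists_geodesic_descent : ∃ C : ℝ, 0 < C ∧ ∀ (c : ℝ → X) (a b : ℝ), a ≤ b →
    (∀ s ∈ Icc a b, ∀ t ∈ Icc a b, dist (c s) (c t) = |s - t|) →
    (∀ s ∈ Icc a b, h (c s) ≤ h (c a)) → b - a ≤ h (c a) - h (c b) + C := by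
  obtain ⟨C, r, hC, hr, H⟩ := hs.exists_dist_proj_le_of_height_le
  -- At height `A` above the highest point, projecting costs at most half of the length of the path.
  obtain ⟨A, hA0, hA⟩ : ∃ A : ℝ, 0 ≤ A ∧ C * Real.exp (-r * A) ≤ 1 / 2 := by
    have h1 : Tendsto (fun A : ℝ => C * Real.exp (-r * A)) atTop (𝓝 (C * 0)) := by
      refine Tendsto.const_mul C (Real.tendsto_exp_atBot.comp ?_)
      exact tendsto_id.const_mul_atTop_of_neg (by linarith)
    rw [mul_zero] at h1
    obtain ⟨A, h2, h3⟩ := ((h1.eventually (ge_mem_nhds (by norm_num : (0:ℝ) < 1 / 2))).and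
      (eventually_ge_atTop 0)).exists
    exact ⟨A, h3, h2⟩
  -- A first, weak estimate: going up to level `h (c a) + A`, across and down again gives `u - a ≤
  -- 2A + h (c a) - h (c u) + (u - a + 1)/2`, hence descent at speed at least `1/2` with the defect
  -- `2A + 1/2`.
  obtain ⟨C₁, hC₁, H₁⟩ := hs.exists_dist_proj_le_of_height_le_sub (κ := 1 / 2) (by norm_num)
    (2 * A + 1 / 2)
  refine ⟨C₁, hC₁, fun c a b hab hg hmax => ?_⟩
  have ha : a ∈ Icc a b := ⟨le_rfl, hab⟩
  have hb : b ∈ Icc a b := ⟨hab, le_rfl⟩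
  have h1 := H₁ c a b (h (c a)) hab (fun s hs t ht => (hg s hs t ht).le) hmax (fun u hu => by
    have hsub : ∀ s ∈ Icc a u, s ∈ Icc a b := fun s hs => ⟨hs.1, hs.2.trans hu.2⟩
    have h2 := H c a u (h (c a)) (h (c a) + A) hu.1
      (fun s hs t ht => (hg s (hsub s hs) t (hsub t ht)).le) (fun s hs => hmax s (hsub s hs))
      (by linarith)
    rw [add_sub_cancel_left] at h2
    have h3 := hg a ha u hu
    rw [abs_sub_comm, abs_of_nonneg (by linarith [hu.1])] at h3
    have h4 := hs.dist_proj_of_le (x := c a) (M := h (c a) + A) (by linarith)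
    have h5 := hs.dist_proj_of_le (x := c u) (M := h (c a) + A) (by linarith [hmax u hu])
    have h6 := dist_triangle4 (c a) (hs.proj (h (c a) + A) (c a)) (hs.proj (h (c a) + A) (c u))
      (c u)
    rw [dist_comm (hs.proj _ (c u)) (c u)] at h6
    have h7 : C * Real.exp (-r * A) * (u - a + 1) ≤ 1 / 2 * (u - a + 1) := by
      gcongr
      linarith [hu.1]
    linarith [dist_comm (c u) (c a)])
  -- Descent at half speed makes the geometric series available: the projection of `c b` to the
  -- level of `c a` is within `C₁` of `c a`, so the whole length beyond `C₁` is vertical descent.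
  have h2 := hg a ha b hb
  rw [abs_sub_comm, abs_of_nonneg (by linarith)] at h2
  rw [hs.proj_self] at h1
  have h3 := hs.dist_proj_of_le (x := c b) (M := h (c a)) (hmax b hb)
  rw [dist_comm] at h3
  linarith [dist_triangle (c a) (hs.proj (h (c a)) (c b)) (c b)]

end HeightSpace
end Height

/-! ### Curves at finite Hausdorff distance -/

section Asymptotics

variable {X : Type*} [MetricSpace X]

theorem asymptotic_of_dist_le {c c' : ℝ≥0 → X} {D : ℝ} (H : ∀ u, ∃ v, dist (c u) (c' v) ≤ D)
    (H' : ∀ u, ∃ v, dist (c' u) (c v) ≤ D) : Asymptotic c c' := by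
  have : Metric.hausdorffEDist (range c) (range c') ≤ ENNReal.ofReal D := by
    refine Metric.hausdorffEDist_le_of_mem_edist ?_ ?_
    · rintro _ ⟨u, rfl⟩
      obtain ⟨v, hv⟩ := H u
      exact ⟨_, ⟨v, rfl⟩, by rw [edist_dist]; exact ENNReal.ofReal_le_ofReal hv⟩
    · rintro _ ⟨u, rfl⟩
      obtain ⟨v, hv⟩ := H' u
      exact ⟨_, ⟨v, rfl⟩, by rw [edist_dist]; exact ENNReal.ofReal_le_ofReal hv⟩
  exact ne_top_of_le_ne_top ENNReal.ofReal_ne_top this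

theorem asymptotic_of_forall_dist_le {c c' : ℝ≥0 → X} {D : ℝ} (H : ∀ u, dist (c u) (c' u) ≤ D) :
    Asymptotic c c' :=
  asymptotic_of_dist_le (fun u => ⟨u, H u⟩) fun u => ⟨u, by rw [dist_comm]; exact H u⟩

theorem Asymptotic.exists_dist_le {c c' : ℝ≥0 → X} (H : Asymptotic c c') :
    ∃ D : ℝ, ∀ u, ∃ v, dist (c u) (c' v) ≤ D := by
  refine ⟨(Metric.hausdorffEDist (range c) (range c')).toReal + 1, fun u => ?_⟩
  have h1 : Metric.hausdorffEDist (range c) (range c') <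
      ENNReal.ofReal ((Metric.hausdorffEDist (range c) (range c')).toReal + 1) := by
    rw [ENNReal.lt_ofReal_iff_toReal_lt H]
    linarith
  obtain ⟨_, ⟨v, rfl⟩, hv⟩ := Metric.exists_edist_lt_of_hausdorffEDist_lt (mem_range_self u) h1
  refine ⟨v, ?_⟩
  rw [edist_dist] at hv
  exact (ENNReal.ofReal_lt_ofReal_iff_of_nonneg dist_nonneg).1 hv |>.le

theorem Asymptotic.symm {c c' : ℝ≥0 → X} (H : Asymptotic c c') : Asymptotic c' c := by
  unfold Asymptotic at *
  rwa [Metric.hausdorffEDist_comm]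

theorem Asymptotic.trans {c c' c'' : ℝ≥0 → X} (H : Asymptotic c c') (H' : Asymptotic c' c'') :
    Asymptotic c c'' :=
  ne_top_of_le_ne_top (ENNReal.add_ne_top.2 ⟨H, H'⟩) Metric.hausdorffEDist_triangle

theorem endsAt_mk {o : X} {c : ℝ≥0 → X} {r : GeodesicRay o} :
    EndsAt c (⟦r⟧ : GeodesicBoundary o) ↔ Asymptotic r.1 c := by
  constructor
  · rintro ⟨r', h, h'⟩
    exact (Asymptotic.symm (Quotient.exact h)).trans h'
  · exact fun h => ⟨r, rfl, h⟩

end Asymptotics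

/-! ### Busemann functions and geodesic rays of height spaces -/

namespace HeightSpace

variable {X : Type*} [MetricSpace X] {h : X → ℝ} (hs : HeightSpace X h)
include hs

/-- A geodesic from `x` to `y` never rises above `h x + dist x y`, so the path estimate applies to
it. -/
theorem exists_dist_proj_le (hg : IsGeodesicSpace X) : ∃ C r : ℝ, 0 < C ∧ 0 < r ∧
    ∀ (x y : X) (M : ℝ), h x + dist x y ≤ M →
    dist (hs.proj M x) (hs.proj M y) ≤
      C * Real.exp (-r * (M - (h x + dist x y))) * (dist x y + 1) := by
  obtain ⟨C, r, hC, hr, H⟩ := hs.exists_dist_proj_le_of_height_le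
  refine ⟨C, r, hC, hr, fun x y M hM => ?_⟩
  obtain ⟨c, hx, hy, hc⟩ := hg x y
  have := H c 0 (dist x y) (h x + dist x y) M dist_nonneg (fun s hs t ht => (hc s hs t ht).le)
    (fun s h' => by
      have h1 := hc 0 ⟨le_rfl, dist_nonneg⟩ s h'
      rw [zero_sub, abs_neg, abs_of_nonneg h'.1] at h1
      have h2 := hs.lip (c 0) (c s)
      rw [hx] at h1 h2
      linarith [h'.2]) hM
  rwa [hx, hy, sub_zero] at this

/-- All vertical lines converge upwards, so that they share one upper end. -/
theorem tendsto_dist_proj (hg : IsGeodesicSpace X) (x y : X) :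
    Tendsto (fun M => dist (hs.proj M x) (hs.proj M y)) atTop (𝓝 0) := by
  obtain ⟨C, r, hC, hr, H⟩ := hs.exists_dist_proj_le hg
  have h1 : Tendsto (fun M : ℝ => C * Real.exp (-r * (M - (h x + dist x y))) * (dist x y + 1))
      atTop (𝓝 (C * 0 * (dist x y + 1))) := by
    refine ((Real.tendsto_exp_atBot.comp ?_).const_mul C).mul_const _
    exact (tendsto_atTop_add_const_right _ _ tendsto_id).const_mul_atTop_of_neg (by linarith)
  rw [mul_zero, zero_mul] at h1
  refine squeeze_zero' (Eventually.of_forall fun _ => dist_nonneg) ?_ h1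
  filter_upwards [eventually_ge_atTop (h x + dist x y)] with M hM using H x y M hM

/-- Two lines that stay close downwards are projected from height `-s` to a fixed height `t`; the
error is of order `e^{-rs}` and `s` is arbitrary. -/
theorem vertical_eq_of_asymptotic (hg : IsGeodesicSpace X) {γ γ' : ℝ → X} (hγ : IsVertical h γ)
    (hγ' : IsVertical h γ') (H : Asymptotic (fun t : ℝ≥0 => γ (-t)) (fun t : ℝ≥0 => γ' (-t))) :
    γ = γ' := by
  obtain ⟨D, hD⟩ := H.exists_dist_le
  -- The height bounds the difference of parameters of two close points by `D`, so points with equal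
  -- parameters are at distance at most `2D`.
  have hD' : ∀ s : ℝ≥0, dist (γ (-s)) (γ' (-s)) ≤ 2 * D := by
    intro s
    obtain ⟨v, hv⟩ := hD s
    have h1 := hs.abs_lip (γ (-s)) (γ' (-v))
    rw [hγ.2, hγ'.2] at h1
    have h2 := hγ'.1.dist_eq (-v) (-s)
    rw [Real.dist_eq, abs_sub_comm] at h2
    linarith [dist_triangle (γ (-s)) (γ' (-v)) (γ' (-s))]
  have hD0 : 0 ≤ 2 * D := dist_nonneg.trans (hD' 0)
  obtain ⟨C, r, hC, hr, H⟩ := hs.exists_dist_proj_le hg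
  funext t
  have h1 : Tendsto (fun s : ℝ≥0 => C * Real.exp (-r * (t - (-s + 2 * D))) * (2 * D + 1))
      atTop (𝓝 (C * 0 * (2 * D + 1))) := by
    refine ((Real.tendsto_exp_atBot.comp ?_).const_mul C).mul_const _
    refine Tendsto.const_mul_atTop_of_neg (by linarith) ?_
    have : (fun s : ℝ≥0 => t - (-(s : ℝ) + 2 * D)) = fun s : ℝ≥0 => (s : ℝ) + (t - 2 * D) := by
      ext s; ring
    rw [this]
    exact tendsto_atTop_add_const_right _ _ (NNReal.tendsto_coe_atTop.2 tendsto_id)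
  rw [mul_zero, zero_mul] at h1
  have h2 : dist (γ t) (γ' t) ≤ 0 := by
    refine ge_of_tendsto h1 ?_
    filter_upwards [eventually_ge_atTop (Real.toNNReal (2 * D - t))] with s hs'
    have h3 : 2 * D - t ≤ s := Real.toNNReal_le_iff_le_coe.1 hs'
    have h4 := hD' s
    have h5 := H (γ (-s)) (γ' (-s)) t (by rw [hγ.2]; linarith)
    rw [hs.proj_vertical hγ (by linarith), hs.proj_vertical hγ' (by linarith), hγ.2] at h5
    refine h5.trans ?_
    gcongr C * ?_ * ?_
    · apply Real.exp_le_exp.2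
      rw [neg_mul, neg_mul, neg_le_neg_iff]
      gcongr
    · linarith
  exact dist_le_zero.1 h2

/-- A Busemann function `-h` comes exactly from the vertical lines. -/
theorem isBusemannFunction_iff (hg : IsGeodesicSpace X) {β : X → ℝ} (hβ : ∀ x, β x = -h x)
    {γ : ℝ → X} : IsBusemannFunction β γ ↔ IsVertical h γ := by
  constructor
  · rintro ⟨h1, h2⟩
    refine ⟨h1, fun s => ?_⟩
    have h3 : Tendsto (fun t => (edist (γ t) (γ s)).toReal - t) atTop (𝓝 (-s)) := by
      refine tendsto_const_nhds.congr' ?_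
      filter_upwards [eventually_ge_atTop s] with t ht
      rw [h1.edist_eq, edist_dist, ENNReal.toReal_ofReal dist_nonneg, Real.dist_eq,
        abs_of_nonneg (sub_nonneg.2 ht)]
      ring
    have := tendsto_nhds_unique h3 (h2 (γ s))
    rw [hβ] at this
    linarith
  · intro hγ
    refine ⟨hγ.1, fun x => ?_⟩
    rw [hβ]
    -- The lower bound on `dist (γ t) x - t` is the Lipschitz property of the height. The upper
    -- bound goes from `x` vertically up to height `t` and then across to `γ t`, a distance that
    -- tends to zero.
    have h1 := hs.tendsto_dist_proj hg x (γ (h x))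
    have h2 : Tendsto (fun t => -h x + dist (hs.proj t x) (hs.proj t (γ (h x)))) atTop
        (𝓝 (-h x)) := by simpa using h1.const_add (-h x)
    refine tendsto_of_tendsto_of_tendsto_of_le_of_le' tendsto_const_nhds h2 ?_ ?_
    · filter_upwards with t
      have := hs.lip x (γ t)
      rw [hγ.2] at this
      rw [edist_dist, ENNReal.toReal_ofReal dist_nonneg, dist_comm]
      linarith
    · filter_upwards [eventually_ge_atTop (h x)] with t ht
      rw [edist_dist, ENNReal.toReal_ofReal dist_nonneg, hs.proj_vertical hγ ht, dist_comm]
      linarith [dist_triangle x (hs.proj t x) (γ t), hs.dist_proj_of_le ht]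

section Rays

/-- A ray which does not ascend at unit speed descends at unit speed. -/
theorem exists_ray_descent : ∃ C : ℝ, 0 < C ∧ ∀ (r : ℝ≥0 → X), Isometry r → ∀ U : ℝ≥0,
    h (r U) < h (r 0) + U - C → ∀ T : ℝ≥0, h (r T) ≤ h (r 0) + 2 * U + C - T := by
  obtain ⟨C, hC, H⟩ := hs.exists_geodesic_descent
  refine ⟨C, hC, fun r hr U hU T => ?_⟩
  have hlip : ∀ s t : ℝ≥0, |h (r s) - h (r t)| ≤ |(s : ℝ) - t| := fun s t => by
    have := hs.abs_lip (r s) (r t)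
    rwa [hr.dist_eq, NNReal.dist_eq] at this
  rcases le_or_gt T U with hTU | hTU
  · have h1 := (abs_le.1 (hlip T 0)).2
    have h2 : (T : ℝ) ≤ U := hTU
    simp only [NNReal.coe_zero, sub_zero, abs_of_nonneg T.coe_nonneg] at h1
    linarith
  -- The ray is cut at its highest point `m` on `[0, T]`. Both the piece after `m` and the reversed
  -- piece before it start at their highest point and descend at unit speed up to `C`.
  obtain ⟨m, hm, hmax⟩ := isCompact_Icc.exists_isMaxOn (s := Icc (0 : ℝ≥0) T) ⟨0, by simp⟩
    ((hs.continuous.comp hr.continuous).continuousOn)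
  let c : ℝ → X := fun u => r u.toNNReal
  have hc : ∀ s t : ℝ, 0 ≤ s → 0 ≤ t → dist (c s) (c t) = |s - t| := fun s t h1 h2 => by
    rw [hr.dist_eq, NNReal.dist_eq, Real.coe_toNNReal _ h1, Real.coe_toNNReal _ h2]
  have hcm : ∀ s : ℝ≥0, c s = r s := fun s => by simp [c]
  have hmax' : ∀ s : ℝ, s ≤ T → h (c s) ≤ h (c m) := fun s h1 => by
    rw [hcm]
    exact hmax ⟨by simp, Real.toNNReal_le_iff_le_coe.2 h1⟩
  have hmT : (m : ℝ) ≤ T := hm.2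
  have e0 : c 0 = r 0 := by simp [c]
  have h1 := H c m T hmT (fun s h1 t h2 => hc s t (m.2.trans h1.1) (m.2.trans h2.1))
    (fun s h1 => hmax' s h1.2)
  have h2 := H (fun u => c (m - u)) 0 m m.2
    (fun s h1 t h2 => by
      rw [hc _ _ (by linarith [h1.2]) (by linarith [h2.2]), abs_sub_comm]
      ring_nf)
    (fun s h1 => by
      rw [sub_zero]
      exact hmax' _ (by linarith [h1.1]))
  simp only [sub_self, sub_zero, e0, hcm] at h1 h2
  -- If the highest point came after `U`, the ray would ascend at unit speed up to `C` until then,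
  -- and in particular at time `U`.
  have h3 : m ≤ U := by
    by_contra! hlt
    have h4 := (abs_le.1 (hlip m U)).2
    have h5 : (U : ℝ) < m := hlt
    rw [abs_of_pos (by linarith)] at h4
    linarith
  have h4 := (abs_le.1 (hlip m 0)).2
  simp only [NNReal.coe_zero, sub_zero, abs_of_nonneg m.coe_nonneg] at h4
  have h5 : (m : ℝ) ≤ U := h3
  linarith

/-- Read backwards, the ray descends at unit speed from its point at time `u`, so `r u` and `r 0`
have nearby projections to height `h (r 0) + u`. The projection of `r 0` is on `γ`, and that of `r
u` is at most `D` above it. -/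
theorem exists_ascending_close (D : ℝ) : ∃ C : ℝ, ∀ (r : ℝ≥0 → X) (γ : ℝ → X), Isometry r →
    IsVertical h γ → γ (h (r 0)) = r 0 → (∀ u, h (r 0) + u - D ≤ h (r u)) →
    ∀ u, dist (r u) (γ (h (r 0) + u)) ≤ C := by
  obtain ⟨C, hC, H⟩ := hs.exists_dist_proj_le_of_height_le_sub one_pos 0
  refine ⟨D + C, fun r γ hr hγ h0 hup u => ?_⟩
  have hle : ∀ v : ℝ≥0, h (r v) ≤ h (r 0) + v := fun v => by
    have := hs.lip (r 0) (r v)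
    rw [hr.dist_eq, NNReal.dist_eq, NNReal.coe_zero, zero_sub, abs_neg, abs_of_nonneg v.coe_nonneg] at this
    linarith
  have h1 := H (fun v => r (u - v).toNNReal) 0 u (h (r 0) + u) u.2
    (fun s h1 t h2 => by
      rw [hr.dist_eq, NNReal.dist_eq, Real.coe_toNNReal _ (by linarith [h1.2]),
        Real.coe_toNNReal _ (by linarith [h2.2]), abs_sub_comm]
      ring_nf; rfl)
    (fun s h1 => by
      have := hle (u - s : ℝ).toNNReal
      rw [Real.coe_toNNReal _ (by linarith [h1.2])] at this
      linarith [h1.1])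
    (fun s h1 => by
      have := hle (u - s : ℝ).toNNReal
      rw [Real.coe_toNNReal _ (by linarith [h1.2])] at this
      linarith [h1.1])
  simp only [sub_zero, Real.toNNReal_coe, sub_self, Real.toNNReal_zero] at h1
  rw [← h0, hs.proj_vertical hγ (by rw [h0]; linarith [u.2]), h0] at h1
  have h2 := hs.dist_proj_of_le (hle u)
  linarith [dist_triangle (r u) (hs.proj (h (r 0) + u) (r u)) (γ (h (r 0) + u)), hup u]

/-- Descending geodesic segments follow the vertical lines through their endpoints. -/
theorem exists_descending_close (R m : ℝ) : ∃ C : ℝ, ∀ (c γ : ℝ → X) (L : ℝ),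
    IsVertical h γ → γ (h (c L)) = c L → m ≤ h (c 0) →
    (∀ s ∈ Icc 0 L, ∀ t ∈ Icc 0 L, dist (c s) (c t) = |s - t|) →
    (∀ s ∈ Icc 0 L, h (c s) ≤ R - s) → ∀ u ∈ Icc 0 L, dist (c u) (γ (-u)) ≤ C := by
  obtain ⟨C, hC, H⟩ := hs.exists_dist_proj_le_of_height_le_sub one_pos 0
  -- At time `u` the path is at height between `m - u` and `R - u`, so moving up to `R - u` costs `R
  -- - m`; the projections of `c u` and `c L` differ by `C`; sliding along `γ` from height `R - u`
  -- to `-u` costs `|R|`.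
  refine ⟨(R - m) + C + |R|, fun c γ L hγ hL hm hc hdes u hu => ?_⟩
  have hL0 : 0 ≤ L := hu.1.trans hu.2
  have hsub : ∀ s ∈ Icc u L, s ∈ Icc 0 L := fun s h' => ⟨hu.1.trans h'.1, h'.2⟩
  have h1 := H c u L (R - u) hu.2 (fun s h1 t h2 => (hc s (hsub s h1) t (hsub t h2)).le)
    (fun s h1 => by linarith [hdes s (hsub s h1), h1.1])
    (fun s h1 => by linarith [hdes s (hsub s h1), h1.1])
  rw [← hL, hs.proj_vertical hγ (by linarith [hdes L ⟨hL0, le_rfl⟩, hu.2])] at h1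
  have h2 := hs.dist_proj_of_le (x := c u) (M := R - u) (hdes u hu)
  have h3 := hs.lip (c u) (c 0)
  rw [hc u hu 0 ⟨le_rfl, hL0⟩, sub_zero, abs_of_nonneg hu.1] at h3
  have h4 := hγ.1.dist_eq (R - u) (-u)
  rw [Real.dist_eq] at h4
  have h5 : R - u - -u = R := by ring
  rw [h5] at h4
  linarith [dist_triangle4 (c u) (hs.proj (R - u) (c u)) (γ (R - u)) (γ (-u))]

end Rays

end HeightSpace

/-- The space of vertical lines, with the compact-open topology. -/
abbrev VerticalLines {X : Type*} [MetricSpace X] (h : X → ℝ) : Type _ :=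
  {γ : C(ℝ, X) // IsVertical h γ}

/-! ### Vertical lines and the parabolic boundary -/

namespace HeightSpace

variable {X : Type*} [MetricSpace X] {h : X → ℝ} (hs : HeightSpace X h)
include hs

theorem tendsto_isVertical {ι : Type*} {l : Filter ι} [l.NeBot] {F : ι → C(ℝ, X)} {f : C(ℝ, X)}
    (hF : ∀ i, IsVertical h (F i)) (hf : Tendsto F l (𝓝 f)) : IsVertical h f := by
  have hp : ∀ t, Tendsto (fun i => F i t) l (𝓝 (f t)) := fun t =>
    ((continuous_eval_const t).tendsto f).comp hf
  refine ⟨Isometry.of_dist_eq fun s t => ?_, fun t => ?_⟩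
  · refine tendsto_nhds_unique ((hp s).dist (hp t)) (tendsto_const_nhds.congr fun i => ?_)
    exact ((hF i).1.dist_eq s t).symm
  · refine tendsto_nhds_unique ((hs.continuous.tendsto _).comp (hp t))
      (tendsto_const_nhds.congr fun i => ((hF i).2 t).symm)

/-- The vertical line through `r j` follows the ray on `[0, j]` with a constant independent of `j`.
A limit of these lines follows the whole ray. -/
theorem exists_line_of_descending [ProperSpace X] (o : X) (R : ℝ) : ∃ C : ℝ,
    ∀ r : GeodesicRay o, (∀ T : ℝ≥0, h (r.1 T) ≤ R - T) →
    ∃ γ : VerticalLines h, ∀ u : ℝ≥0, dist (r.1 u) (γ.1 (-u)) ≤ C := by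
  obtain ⟨C, H⟩ := hs.exists_descending_close R (h o)
  refine ⟨C, fun r hr => ?_⟩
  choose g hg hg' using fun j : ℕ => hs.line (r.1 j)
  have hclose : ∀ (j : ℕ) (u : ℝ≥0), (u : ℝ) ≤ j → dist (r.1 u) (g j (-u)) ≤ C := by
    intro j u hu
    have := H (fun s => r.1 s.toNNReal) (g j) j (hg j) (by simpa using hg' j)
      (by simp [r.2.2])
      (fun s h1 t h2 => by
        rw [r.2.1.dist_eq, NNReal.dist_eq, Real.coe_toNNReal _ h1.1, Real.coe_toNNReal _ h2.1])
      (fun s h1 => by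
        have := hr s.toNNReal
        rwa [Real.coe_toNNReal _ h1.1] at this) u ⟨u.2, hu⟩
    simpa using this
  let F : ℕ → C(ℝ, X) := fun j => ⟨g j, (hg j).1.continuous⟩
  obtain ⟨f, hf⟩ := exists_tendsto_ultrafilter (hyperfilter ℕ) (F := F)
    (fun j => (hg j).1.lipschitz) 0 o C (Eventually.of_forall fun j => by
      have := hclose j 0 (by simp)
      rw [r.2.2, dist_comm, NNReal.coe_zero, neg_zero] at this
      exact this)
  refine ⟨⟨f, hs.tendsto_isVertical hg hf⟩, fun u => ?_⟩
  have hp : Tendsto (fun i => F i (-u)) (hyperfilter ℕ) (𝓝 (f (-u))) :=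
    ((continuous_eval_const (-u : ℝ)).tendsto f).comp hf
  refine le_of_tendsto (tendsto_const_nhds.dist hp) ?_
  have h1 : ∀ᶠ j : ℕ in hyperfilter ℕ, (u : ℝ) ≤ j :=
    (tendsto_natCast_atTop_atTop.eventually_ge_atTop (u : ℝ)).filter_mono
      Nat.hyperfilter_le_atTop
  filter_upwards [h1] with j hj using hclose j u hj

/-- Geodesic segments from `o` to `γ (-j)` descend at unit speed and therefore follow `γ` with a
uniform constant. A limit of them is the required ray. -/
theorem exists_ray_of_line [ProperSpace X] (hg : IsGeodesicSpace X) (o : X) (C : ℝ) : ∃ C' : ℝ,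
    ∀ γ : VerticalLines h, dist o (γ.1 0) ≤ C →
    ∃ r : GeodesicRay o, ∀ u : ℝ≥0, dist (r.1 u) (γ.1 (-u)) ≤ C' := by
  obtain ⟨C', H⟩ := hs.exists_descending_close C (h o)
  refine ⟨C', fun γ hγ => ?_⟩
  choose c hc0 hc1 hc using fun j : ℕ => hg o (γ.1 (-j))
  let L : ℕ → ℝ := fun j => dist o (γ.1 (-j))
  have hd0 : ∀ j : ℕ, dist (γ.1 0) (γ.1 (-j)) = j := fun j => by
    rw [γ.2.1.dist_eq, Real.dist_eq]
    simp
  have hL1 : ∀ j, L j ≤ C + j := fun j => by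
    linarith [dist_triangle o (γ.1 0) (γ.1 (-j)), hd0 j]
  have hL2 : ∀ j, j - C ≤ L j := fun j => by
    linarith [dist_triangle (γ.1 0) o (γ.1 (-j)), hd0 j, dist_comm o (γ.1 0)]
  have hL0 : ∀ j, 0 ≤ L j := fun j => dist_nonneg
  have hclose : ∀ (j : ℕ) (u : ℝ≥0), (u : ℝ) ≤ L j → dist (c j u) (γ.1 (-u)) ≤ C' := by
    intro j u hu
    refine H (c j) γ.1 (L j) γ.2 ?_ (by rw [hc0]) (hc j) (fun s h1 => ?_) u ⟨u.2, hu⟩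
    · rw [hc1, γ.2.2]
    -- The segment ends at height `-j` and has `L j - s ≤ C + j - s` left to go, so its height at
    -- time `s` is at most `C - s`.
    · have h2 := hc j s h1 (L j) ⟨hL0 j, le_rfl⟩
      rw [abs_sub_comm, abs_of_nonneg (by linarith [h1.2])] at h2
      have h3 := hs.lip (c j (L j)) (c j s)
      rw [hc1, γ.2.2, dist_comm] at h3
      rw [hc1] at h2
      linarith [hL1 j]
  have hmem : ∀ (j : ℕ) (u : ℝ≥0), min (u : ℝ) (L j) ∈ Icc 0 (L j) := fun j u =>
    ⟨le_min u.2 (hL0 j), min_le_right _ _⟩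
  -- Each segment is frozen at its endpoint, which yields 1-Lipschitz maps on the whole half-line;
  -- as `L j` tends to infinity, the limit is still isometric.
  have hlip : ∀ j, LipschitzWith 1 (fun u : ℝ≥0 => c j (min (u : ℝ) (L j))) := fun j =>
    LipschitzWith.of_dist_le_mul fun u v => by
      rw [hc j _ (hmem j u) _ (hmem j v), NNReal.dist_eq, NNReal.coe_one, one_mul]
      exact (abs_min_sub_min_le_max _ _ _ _).trans (by simp)
  let F : ℕ → C(ℝ≥0, X) := fun j => ⟨_, (hlip j).continuous⟩
  have hF0 : ∀ j, F j 0 = o := fun j => by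
    change c j (min ((0 : ℝ≥0) : ℝ) (L j)) = o
    rw [NNReal.coe_zero, min_eq_left (hL0 j), hc0]
  obtain ⟨f, hf⟩ := exists_tendsto_ultrafilter (hyperfilter ℕ) (F := F) hlip 0 o 0
    (Eventually.of_forall fun j => by rw [hF0, dist_self])
  have hp : ∀ u, Tendsto (fun i => F i u) (hyperfilter ℕ) (𝓝 (f u)) := fun u =>
    ((continuous_eval_const u).tendsto f).comp hf
  have hev : ∀ u : ℝ≥0, ∀ᶠ j : ℕ in hyperfilter ℕ, (u : ℝ) ≤ L j := fun u => by
    have : ∀ᶠ j : ℕ in hyperfilter ℕ, (u : ℝ) + C ≤ j :=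
      (tendsto_natCast_atTop_atTop.eventually_ge_atTop ((u : ℝ) + C)).filter_mono
        Nat.hyperfilter_le_atTop
    filter_upwards [this] with j hj
    linarith [hL2 j]
  have hFu : ∀ (u : ℝ≥0) (j : ℕ), (u : ℝ) ≤ L j → F j u = c j u := fun u j hj => by
    change c j (min (u : ℝ) (L j)) = _
    rw [min_eq_left hj]
  refine ⟨⟨f, Isometry.of_dist_eq fun s t => ?_, ?_⟩, fun u => ?_⟩
  · refine tendsto_nhds_unique ((hp s).dist (hp t)) (tendsto_const_nhds.congr' ?_)
    filter_upwards [hev s, hev t] with j h1 h2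
    rw [hFu s j h1, hFu t j h2, hc j s ⟨s.2, h1⟩ t ⟨t.2, h2⟩, NNReal.dist_eq]
  · exact tendsto_nhds_unique (hp 0) (tendsto_const_nhds.congr fun i => (hF0 i).symm)
  · refine le_of_tendsto ((hp u).dist tendsto_const_nhds) ?_
    filter_upwards [hev u] with j hj
    rw [hFu u j hj]
    exact hclose j u hj

/-- The rays that are not based at the centre of the Busemann function `-h`. -/
theorem isBasedAt_mk_iff (hg : IsGeodesicSpace X) {β : X → ℝ} (hβ : ∀ x, β x = -h x) {C : ℝ}
    (hC : ∀ (r : ℝ≥0 → X), Isometry r → ∀ U : ℝ≥0,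
      h (r U) < h (r 0) + U - C → ∀ T : ℝ≥0, h (r T) ≤ h (r 0) + 2 * U + C - T)
    {o : X} (r : GeodesicRay o) :
    IsBasedAt β (⟦r⟧ : GeodesicBoundary o) ↔ ∀ U : ℝ≥0, h o + U - C ≤ h (r.1 U) := by
  constructor
  · rintro ⟨γ, hγ, he⟩
    rw [hs.isBusemannFunction_iff hg hβ] at hγ
    rw [endsAt_mk] at he
    obtain ⟨D, hD⟩ := he.symm.exists_dist_le
    -- A ray that violates the inequality descends and so has bounded height; it cannot stay close
    -- to a line that rises without bound.
    by_contra! hlt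
    obtain ⟨U, hU⟩ := hlt
    have h1 := hC r.1 r.2.1 U (by rwa [r.2.2])
    -- The parameter is chosen so that `γ` is more than `D` above the maximal height `h o + 2U + C`
    -- of the ray.
    obtain ⟨T, hT⟩ := hD (h o + 2 * U + C + D + 1).toNNReal
    have h2 := hs.lip (r.1 T) (γ (h o + 2 * U + C + D + 1).toNNReal)
    rw [hγ.2, dist_comm] at h2
    have h3 := h1 T
    rw [r.2.2] at h3
    have h4 := Real.le_coe_toNNReal (h o + 2 * U + C + D + 1)
    have h5 := T.coe_nonneg
    linarith
  · intro hup
    obtain ⟨γ, hγ, hγo⟩ := hs.line o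
    obtain ⟨D, hD⟩ := hs.exists_ascending_close C
    refine ⟨γ, (hs.isBusemannFunction_iff hg hβ).2 hγ, endsAt_mk.2 ?_⟩
    have h1 := hD r.1 γ r.2.1 hγ (by rw [r.2.2, hγo]) (by rw [r.2.2]; exact hup)
    refine asymptotic_of_forall_dist_le (D := D + |h o|) fun u => ?_
    have h2 := hγ.1.dist_eq (h o + u) u
    rw [Real.dist_eq, add_sub_cancel_right] at h2
    have h3 := h1 u
    rw [r.2.2] at h3
    linarith [dist_triangle (r.1 u) (γ (h o + u)) (γ u)]

/-- The vertical lines of a proper geodesic height space are in homeomorphic correspondence with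
the points of the parabolic boundary. -/
theorem exists_homeomorph_parabolicBoundary [ProperSpace X] (hg : IsGeodesicSpace X) {β : X → ℝ}
    (hβ : ∀ x, β x = -h x) (o : X) :
    ∃ e : VerticalLines h ≃ₜ ParabolicBoundary β o,
      ∀ γ, EndsAt (fun t : ℝ≥0 => γ.1 (-(t : ℝ))) (e γ).1 := by
  obtain ⟨C₀, hC₀, hdes⟩ := hs.exists_ray_descent
  have hbased := fun r : GeodesicRay o => hs.isBasedAt_mk_iff hg hβ hdes r
  have hray : ∀ γ : VerticalLines h, ∃ r : GeodesicRay o,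
      Asymptotic r.1 (fun t : ℝ≥0 => γ.1 (-(t : ℝ))) := fun γ => by
    obtain ⟨C', h1⟩ := hs.exists_ray_of_line hg o (dist o (γ.1 0))
    obtain ⟨r, hr⟩ := h1 γ le_rfl
    exact ⟨r, asymptotic_of_forall_dist_le hr⟩
  have hnot : ∀ (γ : VerticalLines h) (r : GeodesicRay o),
      Asymptotic r.1 (fun t : ℝ≥0 => γ.1 (-(t : ℝ))) →
      ¬ IsBasedAt β (⟦r⟧ : GeodesicBoundary o) := fun γ r hr hb => by
    rw [hbased] at hb
    obtain ⟨D, hD⟩ := hr.exists_dist_le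
    -- At this time a ray based at the centre is at height at least `D + 1`, whereas every point `γ
    -- (-v)` has height at most zero.
    obtain ⟨v, hv⟩ := hD (C₀ + D + 1 - h o).toNNReal
    have h1 := hs.lip (γ.1 (-v)) (r.1 (C₀ + D + 1 - h o).toNNReal)
    rw [γ.2.2, dist_comm] at h1
    have h2 := Real.le_coe_toNNReal (C₀ + D + 1 - h o)
    have h3 := hb (C₀ + D + 1 - h o).toNNReal
    have h4 := v.coe_nonneg
    linarith
  have hline : ∀ r : GeodesicRay o, ¬ IsBasedAt β (⟦r⟧ : GeodesicBoundary o) →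
      ∃ γ : VerticalLines h, Asymptotic r.1 (fun t : ℝ≥0 => γ.1 (-(t : ℝ))) := fun r hr => by
    rw [hbased] at hr
    push Not at hr
    obtain ⟨U, hU⟩ := hr
    obtain ⟨C, h1⟩ := hs.exists_line_of_descending o (h o + 2 * U + C₀)
    obtain ⟨γ, hγ⟩ := h1 r fun T => by
      have := hdes r.1 r.2.1 U (by rwa [r.2.2]) T
      rwa [r.2.2] at this
    exact ⟨γ, asymptotic_of_forall_dist_le hγ⟩
  have huniq : ∀ γ γ' : VerticalLines h, Asymptotic (fun t : ℝ≥0 => γ.1 (-(t : ℝ)))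
      (fun t : ℝ≥0 => γ'.1 (-(t : ℝ))) → γ = γ' := fun γ γ' H =>
    Subtype.ext (ContinuousMap.ext (congrFun (hs.vertical_eq_of_asymptotic hg γ.2 γ'.2 H)))
  choose ρ hρ using hray
  let f : VerticalLines h → ParabolicBoundary β o := fun γ => ⟨⟦ρ γ⟧, hnot γ _ (hρ γ)⟩
  have hf : ∀ (γ : VerticalLines h) (r : GeodesicRay o),
      Asymptotic r.1 (fun t : ℝ≥0 => γ.1 (-(t : ℝ))) → (f γ).1 = ⟦r⟧ := fun γ r hr =>
    Quotient.sound ((hρ γ).trans hr.symm)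
  have hfinj : Function.Injective f := fun γ γ' hE => by
    have : Asymptotic (ρ γ).1 (ρ γ').1 := Quotient.exact (congrArg Subtype.val hE)
    exact huniq _ _ ((hρ γ).symm.trans (this.trans (hρ γ')))
  have hfsurj : Function.Surjective f := by
    rintro ⟨ξ, hξ⟩
    induction ξ using Quotient.inductionOn with
    | h r =>
      obtain ⟨γ, hγ⟩ := hline r hξ
      exact ⟨γ, Subtype.ext (hf γ r hγ)⟩
  -- Lines near `γ` meet height zero at bounded distance from `o`, so they are followed by rays `q
  -- γ'` with one constant. The limit of these rays along an ultrafilter follows `γ`, hence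
  -- represents `f γ`, and the quotient map is continuous.
  have hfcont : Continuous f := by
    refine Continuous.subtype_mk ?_ _
    rw [continuous_iff_ultrafilter]
    intro γ u hu
    obtain ⟨C', h1⟩ := hs.exists_ray_of_line hg o (dist o (γ.1 0) + 1)
    have hev : ∀ᶠ γ' : VerticalLines h in (u : Filter (VerticalLines h)),
        dist o (γ'.1 0) ≤ dist o (γ.1 0) + 1 := by
      have : Continuous fun γ' : VerticalLines h => dist o (γ'.1 0) :=
        continuous_const.dist ((continuous_eval_const 0).comp continuous_subtype_val)
      exact hu (this.continuousAt.eventually (ge_mem_nhds (by simp)))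
    have : Nonempty (GeodesicRay o) := ⟨ρ γ⟩
    choose! q hq using h1
    obtain ⟨g, hgl⟩ := exists_tendsto_ultrafilter u (F := fun γ' => (q γ').1)
      (fun γ' => (q γ').2.1.lipschitz) 0 o 0
      (Eventually.of_forall fun γ' => by rw [(q γ').2.2, dist_self])
    have hp : ∀ t, Tendsto (fun γ' => (q γ').1 t) u (𝓝 (g t)) := fun t =>
      ((continuous_eval_const t).tendsto g).comp hgl
    let r : GeodesicRay o := ⟨g, Isometry.of_dist_eq fun s t =>
        tendsto_nhds_unique ((hp s).dist (hp t)) (tendsto_const_nhds.congr fun γ' =>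
          ((q γ').2.1.dist_eq s t).symm),
      tendsto_nhds_unique (hp 0) (tendsto_const_nhds.congr fun γ' => ((q γ').2.2).symm)⟩
    have hr : Asymptotic r.1 (fun t : ℝ≥0 => γ.1 (-(t : ℝ))) := by
      refine asymptotic_of_forall_dist_le (D := C') fun t => ?_
      have h2 : Tendsto (fun γ' : VerticalLines h => γ'.1 (-(t : ℝ))) u (𝓝 (γ.1 (-(t : ℝ)))) :=
        (((continuous_eval_const (-(t : ℝ))).comp
          continuous_subtype_val).tendsto γ).mono_left hu
      refine le_of_tendsto ((hp t).dist h2) ?_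
      filter_upwards [hev] with γ' hγ' using hq γ' hγ' t
    have h3 : Tendsto q u (𝓝 r) := tendsto_subtype_rng.2 hgl
    have h4 : Tendsto (fun γ' => (⟦q γ'⟧ : GeodesicBoundary o)) u (𝓝 ⟦r⟧) :=
      (continuous_quotient_mk'.tendsto r).comp h3
    rw [← hf γ r hr] at h4
    refine h4.congr' ?_
    filter_upwards [hev] with γ' hγ'
    exact (hf γ' (q γ') (asymptotic_of_forall_dist_le (hq γ' hγ'))).symm
  let E := Equiv.ofBijective f ⟨hfinj, hfsurj⟩
  -- By the height criterion the complement of the centre is a union of open conditions, one for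
  -- each time `U`. Openness makes the restricted projection from rays a quotient map, so that
  -- continuity of the inverse can be tested on rays.
  have hopen : IsOpen {ξ : GeodesicBoundary o | ¬ IsBasedAt β ξ} := by
    rw [← isQuotientMap_quotient_mk'.isOpen_preimage]
    have : (Quotient.mk' ⁻¹' {ξ : GeodesicBoundary o | ¬ IsBasedAt β ξ} : Set (GeodesicRay o)) =
        ⋃ U : ℝ≥0, {r | h (r.1 U) < h o + U - C₀} := by
      ext r
      simp only [mem_preimage, mem_ofPred_eq, mem_iUnion]
      change ¬ IsBasedAt β (⟦r⟧ : GeodesicBoundary o) ↔ _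
      rw [hbased]
      push Not
      rfl
    rw [this]
    refine isOpen_iUnion fun U => isOpen_lt ?_ continuous_const
    exact hs.continuous.comp ((continuous_eval_const U).comp continuous_subtype_val)
  have hEcont : Continuous E.symm := by
    have hqm := (isQuotientMap_quotient_mk' (s := raySetoid o)).restrictPreimage_isOpen hopen
    rw [hqm.continuous_iff, continuous_iff_ultrafilter]
    rintro ⟨r, hr⟩ u hu
    have hEs : ∀ (r : GeodesicRay o) (hr : ¬ IsBasedAt β (⟦r⟧ : GeodesicBoundary o))
        (γ : VerticalLines h), Asymptotic r.1 (fun t : ℝ≥0 => γ.1 (-(t : ℝ))) →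
        E.symm ⟨⟦r⟧, hr⟩ = γ := fun r hr γ hγ => by
      rw [Equiv.symm_apply_eq]
      exact Subtype.ext (hf γ r hγ).symm
    have hr' := hr
    change ¬ IsBasedAt β (⟦r⟧ : GeodesicBoundary o) at hr'
    rw [hbased] at hr'
    push Not at hr'
    obtain ⟨U, hU⟩ := hr'
    obtain ⟨C, h1⟩ := hs.exists_line_of_descending o (h o + 2 * U + C₀)
    have : Nonempty (VerticalLines h) := (hline r hr).nonempty
    choose! g hgc using h1
    have hcont : ∀ t : ℝ≥0, Continuous fun r' : (Quotient.mk' ⁻¹'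
        {ξ : GeodesicBoundary o | ¬ IsBasedAt β ξ} : Set (GeodesicRay o)) => r'.1.1 t := fun t =>
      (continuous_eval_const t).comp
        (continuous_subtype_val.comp continuous_subtype_val)
    -- Failure of the inequality at the fixed time `U` persists for nearby rays, which therefore
    -- descend with the same constants.
    have hev : ∀ᶠ r' in (u : Filter (Quotient.mk' ⁻¹'
        {ξ : GeodesicBoundary o | ¬ IsBasedAt β ξ} : Set (GeodesicRay o))),
        ∀ T : ℝ≥0, h (r'.1.1 T) ≤ h o + 2 * U + C₀ - T := by
      have h2 := hu ((hs.continuous.comp (hcont U)).continuousAt.eventually (gt_mem_nhds hU))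
      filter_upwards [h2] with r' hr' T
      have := hdes r'.1.1 r'.1.2.1 U (by rw [r'.1.2.2]; exact hr') T
      rwa [r'.1.2.2] at this
    obtain ⟨γ, hγl⟩ := exists_tendsto_ultrafilter u
      (F := fun r' : (Quotient.mk' ⁻¹' {ξ : GeodesicBoundary o | ¬ IsBasedAt β ξ} :
        Set (GeodesicRay o)) => (g r'.1).1) (fun r' => (g r'.1).2.1.lipschitz) 0 o C (by
        filter_upwards [hev] with r' hr'
        have := hgc r'.1 hr' 0
        rw [r'.1.2.2, dist_comm] at this
        simpa using this)
    let γ' : VerticalLines h := ⟨γ, hs.tendsto_isVertical (fun r' : (Quotient.mk' ⁻¹'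
      {ξ : GeodesicBoundary o | ¬ IsBasedAt β ξ} : Set (GeodesicRay o)) => (g r'.1).2) hγl⟩
    have h2 : Asymptotic r.1 (fun t : ℝ≥0 => γ'.1 (-(t : ℝ))) := by
      refine asymptotic_of_forall_dist_le (D := C) fun t => ?_
      have h3 : Tendsto (fun r' : (Quotient.mk' ⁻¹' {ξ : GeodesicBoundary o | ¬ IsBasedAt β ξ} :
          Set (GeodesicRay o)) => (g r'.1).1 (-(t : ℝ))) u (𝓝 (γ (-(t : ℝ)))) :=
        ((continuous_eval_const (-(t : ℝ))).tendsto γ).comp hγl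
      refine le_of_tendsto ((((hcont t).tendsto _).mono_left hu).dist h3) ?_
      filter_upwards [hev] with r' hr' using hgc r'.1 hr' t
    have h3 : Tendsto (fun r' : (Quotient.mk' ⁻¹' {ξ : GeodesicBoundary o | ¬ IsBasedAt β ξ} :
        Set (GeodesicRay o)) => g r'.1) u (𝓝 γ') := tendsto_subtype_rng.2 hγl
    have h4 : (E.symm ∘ (Set.restrictPreimage {ξ : GeodesicBoundary o | ¬ IsBasedAt β ξ}
        Quotient.mk')) ⟨r, hr⟩ = γ' := hEs r hr γ' h2
    rw [h4]
    refine h3.congr' ?_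
    filter_upwards [hev] with r' hr'
    exact (hEs r'.1 r'.2 _ (asymptotic_of_forall_dist_le (hgc r'.1 hr'))).symm
  refine ⟨⟨E, hfcont, hEcont⟩, fun γ => ?_⟩
  exact ⟨ρ γ, rfl, hρ γ⟩

end HeightSpace

/-! ### Induced length metrics and vertical geodesics of horocyclic products -/

namespace LengthSubspace

variable {A : Type*} [PseudoEMetricSpace A] {S : Set A}

theorem edist_point_le (x y : LengthSubspace S) : edist x.point y.point ≤ edist x y := by
  refine le_iInf fun γ => ?_
  have := eVariationOn.edist_le (fun t => (γ t : A)) (s := univ) (mem_univ 0) (mem_univ 1)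
  simpa [pathLength] using this

theorem edist_le_of_path {x y : LengthSubspace S} (c : unitInterval → A) (hc : Continuous c)
    (hS : ∀ t, c t ∈ S) (h0 : c 0 = x.point) (h1 : c 1 = y.point) :
    edist x y ≤ eVariationOn c univ := by
  let γ : Path (⟨x.point, x.mem⟩ : S) ⟨y.point, y.mem⟩ :=
    { toFun := fun t => ⟨c t, hS t⟩
      continuous_toFun := hc.subtype_mk _
      source' := Subtype.ext h0
      target' := Subtype.ext h1 }
  exact iInf_le _ γ

theorem edist_le_of_lipschitz {x y : LengthSubspace S} {L : ℝ} (hL : 0 ≤ L) (c : ℝ → A)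
    (hc : ∀ s ∈ Icc 0 L, ∀ t ∈ Icc 0 L, edist (c s) (c t) ≤ ENNReal.ofReal |s - t|)
    (hS : ∀ t ∈ Icc 0 L, c t ∈ S) (h0 : c 0 = x.point) (h1 : c L = y.point) :
    edist x y ≤ ENNReal.ofReal L := by
  let φ : unitInterval → ℝ := fun t => t * L
  have hφ : ∀ t, φ t ∈ Icc 0 L := fun t =>
    ⟨mul_nonneg t.2.1 hL, mul_le_of_le_one_left hL t.2.2⟩
  have hlip : LipschitzOnWith 1 c (Icc 0 L) := fun s hs t ht => by
    rw [ENNReal.coe_one, one_mul, edist_dist, Real.dist_eq]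
    exact hc s hs t ht
  have hcont : Continuous (c ∘ φ) :=
    hlip.continuousOn.comp_continuous (by fun_prop) hφ
  refine (edist_le_of_path (c ∘ φ) hcont (fun t => hS _ (hφ t)) (by simpa [φ] using h0)
    (by simpa [φ] using h1)).trans ?_
  refine (hlip.comp_eVariationOn_le (fun t _ => hφ t)).trans ?_
  rw [ENNReal.coe_one, one_mul]
  have hmono : MonotoneOn φ univ := fun a _ b _ hab => mul_le_mul_of_nonneg_right hab hL
  have := hmono.eVariationOn_eq (mem_univ 0) (mem_univ 1)
  rw [univ_inter, show Icc (0 : unitInterval) 1 = univ from Icc_bot_top] at this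
  simpa [φ] using this.le

end LengthSubspace

namespace AdmissibleNorm

variable (n : AdmissibleNorm)

theorem apply_diag {d : ℝ} (hd : 0 ≤ d) : n.N (d, d) = d := by
  have := map_smul_eq_mul n.N d (1, 1)
  rw [n.one_one, mul_one, Real.norm_of_nonneg hd] at this
  simpa using this

/-- Normalization and monotonicity bound the norm by the maximum on the positive quadrant. Together
with the lower bound by the average this fixes its value on the diagonal, which is all that vertical
geodesics see. -/
theorem le_of_le {a b d : ℝ} (ha : 0 ≤ a) (hb : 0 ≤ b) (had : a ≤ d) (hbd : b ≤ d) :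
    n.N (a, b) ≤ d :=
  (n.monotone a b d d ha had hb hbd).trans_eq (n.apply_diag (ha.trans had))

end AdmissibleNorm

section Product

variable {X Y : Type*} [MetricSpace X] [MetricSpace Y] {n : AdmissibleNorm}

theorem NormProd.edist_eq (p q : NormProd n X Y) :
    edist p q = ENNReal.ofReal (n.N (dist p.fst q.fst, dist p.snd q.snd)) := by
  change (if _ then _ else _) = _
  rw [if_neg (by simp [edist_ne_top])]
  simp only [edist_dist, ENNReal.toReal_ofReal dist_nonneg]

variable {hX : X → ℝ} {hY : Y → ℝ} (HX : HeightSpace X hX) (HY : HeightSpace Y hY)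
  (gX : IsGeodesicSpace X) (gY : IsGeodesicSpace Y) {βX : X → ℝ} {βY : Y → ℝ}
  (hβX : ∀ x, βX x = -hX x) (hβY : ∀ y, βY y = -hY y)

/-- The length metric dominates the norm of the two distances, and the norm dominates their average.
-/
theorem HorocyclicProduct.dist_add_dist_le {p q : HorocyclicProduct n βX βY} {L : ℝ}
    (hL : edist p q ≤ ENNReal.ofReal L) (h0 : 0 ≤ L) :
    dist p.point.fst q.point.fst + dist p.point.snd q.point.snd ≤ 2 * L := by
  have h1 := (LengthSubspace.edist_point_le p q).trans hL
  rw [NormProd.edist_eq, ENNReal.ofReal_le_ofReal_iff h0] at h1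
  linarith [n.average_le (dist p.point.fst q.point.fst) (dist p.point.snd q.point.snd)]

-- The first coordinate follows a geodesic of `X`, while the second moves on one vertical line of
-- `Y` at the height this dictates. The second coordinate is no faster than the first, and it
-- returns to its starting point.
include HX HY gX hβX hβY in
theorem HorocyclicProduct.edist_le_left {p q : HorocyclicProduct n βX βY}
    (h : p.point.snd = q.point.snd) : edist p q ≤ ENNReal.ofReal (dist p.point.fst q.point.fst) := by
  obtain ⟨c, h0, h1, hc⟩ := gX p.point.fst q.point.fst
  obtain ⟨γ, hγ, hγp⟩ := HY.line p.point.snd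
  have hp : βX p.point.fst = -βY p.point.snd := p.mem
  have hq : βX q.point.fst = -βY q.point.snd := q.mem
  rw [hβX, hβY, neg_neg] at hp hq
  refine LengthSubspace.edist_le_of_lipschitz dist_nonneg
    (fun u => ⟨c u, γ (-hX (c u))⟩) (fun s hs t ht => ?_) (fun t _ => ?_) ?_ ?_
  · rw [NormProd.edist_eq]
    refine ENNReal.ofReal_le_ofReal (n.le_of_le dist_nonneg dist_nonneg (hc s hs t ht).le ?_)
    rw [hγ.1.dist_eq, ← hc s hs t ht, Real.dist_eq, neg_sub_neg, abs_sub_comm]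
    exact HX.abs_lip _ _
  · change βX (c t) = -βY (γ _)
    rw [hβX, hβY, hγ.2, neg_neg]
  · ext1
    · exact h0
    · change γ _ = _
      rw [h0, hp, hγp]
  · ext1
    · exact h1
    · change γ _ = _
      rw [h1, hq, ← h, hγp]

include HX HY gY hβX hβY in
theorem HorocyclicProduct.edist_le_right {p q : HorocyclicProduct n βX βY}
    (h : p.point.fst = q.point.fst) : edist p q ≤ ENNReal.ofReal (dist p.point.snd q.point.snd) := by
  obtain ⟨c, h0, h1, hc⟩ := gY p.point.snd q.point.snd
  obtain ⟨γ, hγ, hγp⟩ := HX.line p.point.fst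
  have hp : βX p.point.fst = -βY p.point.snd := p.mem
  have hq : βX q.point.fst = -βY q.point.snd := q.mem
  rw [hβX, hβY, neg_neg] at hp hq
  refine LengthSubspace.edist_le_of_lipschitz dist_nonneg
    (fun u => ⟨γ (-hY (c u)), c u⟩) (fun s hs t ht => ?_) (fun t _ => ?_) ?_ ?_
  · rw [NormProd.edist_eq]
    refine ENNReal.ofReal_le_ofReal (n.le_of_le dist_nonneg dist_nonneg ?_ (hc s hs t ht).le)
    rw [hγ.1.dist_eq, ← hc s hs t ht, Real.dist_eq, neg_sub_neg, abs_sub_comm]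
    exact HY.abs_lip _ _
  · change βX (γ _) = -βY (c t)
    rw [hβX, hβY, hγ.2]
  · ext1
    · change γ _ = _
      rw [h0, ← hp, neg_neg, hγp]
    · exact h0
  · ext1
    · change γ _ = _
      rw [h1, ← hq, ← h, neg_neg, hγp]
    · exact h1

-- Since the heights agree, one coordinate can be changed at a time. This compares the length metric
-- with the product distance on a horosphere and gives the continuity of a pair of lines as a point
-- of the vertical boundary.
include HX HY gX gY hβX hβY in
theorem HorocyclicProduct.edist_le {p q : HorocyclicProduct n βX βY}
    (h : hX p.point.fst = hX q.point.fst) : edist p q ≤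
      ENNReal.ofReal (dist p.point.fst q.point.fst) +
        ENNReal.ofReal (dist p.point.snd q.point.snd) := by
  let m : HorocyclicProduct n βX βY := ⟨⟨q.point.fst, p.point.snd⟩, by
    change βX q.point.fst = -βY p.point.snd
    have hp : βX p.point.fst = -βY p.point.snd := p.mem
    rw [← hp, hβX, hβX, h]⟩
  refine (edist_triangle p m q).trans (add_le_add ?_ ?_)
  · exact HorocyclicProduct.edist_le_left HX HY gX hβX hβY (p := p) (q := m) rfl
  · exact HorocyclicProduct.edist_le_right HX HY gY hβX hβY (p := m) (q := q) rfl

-- The two distances have sum at most `2|s - t|`, and each is at least `|s - t|` because the heights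
-- change by that much. So both are equal to `|s - t|`.
include HX HY hβX hβY in
theorem VerticalBoundary.dist_fst_snd (γ : VerticalBoundary n βX βY) (s t : ℝ) :
    dist (γ.1 s).point.fst (γ.1 t).point.fst = |s - t| ∧
      dist (γ.1 s).point.snd (γ.1 t).point.snd = |s - t| := by
  have hh : ∀ t, hX (γ.1 t).point.fst = t := fun t => by
    have : -βX (γ.1 t).point.fst = t := γ.2.2 t
    rwa [hβX, neg_neg] at this
  have hh' : ∀ t, hY (γ.1 t).point.snd = -t := fun t => by
    have : βX (γ.1 t).point.fst = -βY (γ.1 t).point.snd := (γ.1 t).mem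
    rw [hβX, hβY, hh] at this
    linarith
  have h1 := HorocyclicProduct.dist_add_dist_le (p := γ.1 s) (q := γ.1 t) (L := |s - t|)
    (by rw [γ.2.1.edist_eq, edist_dist, Real.dist_eq]) (abs_nonneg _)
  have h2 := HX.abs_lip (γ.1 s).point.fst (γ.1 t).point.fst
  have h3 := HY.abs_lip (γ.1 s).point.snd (γ.1 t).point.snd
  rw [hh, hh] at h2
  rw [hh', hh', neg_sub_neg, abs_sub_comm] at h3
  constructor <;> linarith

theorem HorocyclicProduct.lipschitz_fst :
    LipschitzWith 2 (fun p : HorocyclicProduct n βX βY => p.point.fst) := by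
  intro p q
  by_cases h : edist p q = ⊤
  · simp [h]
  · have := HorocyclicProduct.dist_add_dist_le (p := p) (q := q) (L := (edist p q).toReal)
      (by rw [ENNReal.ofReal_toReal h]) ENNReal.toReal_nonneg
    rw [edist_dist, ← ENNReal.ofReal_toReal h]
    refine (ENNReal.ofReal_le_ofReal (q := 2 * (edist p q).toReal) ?_).trans_eq ?_
    · linarith [dist_nonneg (x := p.point.snd) (y := q.point.snd)]
    · rw [ENNReal.ofReal_mul zero_le_two]
      simp

theorem HorocyclicProduct.lipschitz_snd :
    LipschitzWith 2 (fun p : HorocyclicProduct n βX βY => p.point.snd) := by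
  intro p q
  by_cases h : edist p q = ⊤
  · simp [h]
  · have := HorocyclicProduct.dist_add_dist_le (p := p) (q := q) (L := (edist p q).toReal)
      (by rw [ENNReal.ofReal_toReal h]) ENNReal.toReal_nonneg
    rw [edist_dist, ← ENNReal.ofReal_toReal h]
    refine (ENNReal.ofReal_le_ofReal (q := 2 * (edist p q).toReal) ?_).trans_eq ?_
    · linarith [dist_nonneg (x := p.point.fst) (y := q.point.fst)]
    · rw [ENNReal.ofReal_mul zero_le_two]
      simp

include HX HY gX gY hβX hβY in
/-- A vertical geodesic of a horocyclic product is a pair of vertical lines. -/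
theorem exists_homeomorph_verticalLines :
    ∃ e : VerticalBoundary n βX βY ≃ₜ VerticalLines hX × VerticalLines hY,
      ∀ γ, (∀ t, (e γ).1.1 t = (γ.1 t).point.fst) ∧
        ∀ t, (e γ).2.1 t = (γ.1 (-t)).point.snd := by
  let cf : C(HorocyclicProduct n βX βY, X) := ⟨_, HorocyclicProduct.lipschitz_fst.continuous⟩
  let cs : C(HorocyclicProduct n βX βY, Y) := ⟨_, HorocyclicProduct.lipschitz_snd.continuous⟩
  -- Height in the product is minus the height in `Y`, so the second coordinate descends and has to
  -- be reversed to become a vertical line.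
  let cn : C(ℝ, ℝ) := ⟨fun t => -t, continuous_neg⟩
  have hd := VerticalBoundary.dist_fst_snd (n := n) HX HY hβX hβY
  have hmemf : ∀ γ : VerticalBoundary n βX βY, IsVertical hX (cf.comp γ.1) := fun γ =>
    ⟨Isometry.of_dist_eq fun s t => (hd γ s t).1, fun t => by
      have : -βX (γ.1 t).point.fst = t := γ.2.2 t
      rwa [hβX, neg_neg] at this⟩
  have hmems : ∀ γ : VerticalBoundary n βX βY, IsVertical hY ((cs.comp γ.1).comp cn) := fun γ =>
    ⟨Isometry.of_dist_eq fun s t => by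
      have := (hd γ (-s) (-t)).2
      rw [neg_sub_neg, abs_sub_comm] at this
      exact this, fun t => by
      have h1 : -βX (γ.1 (-t)).point.fst = -t := γ.2.2 (-t)
      have h2 : βX (γ.1 (-t)).point.fst = -βY (γ.1 (-t)).point.snd := (γ.1 (-t)).mem
      rw [hβY] at h2
      change hY (γ.1 (-t)).point.snd = t
      linarith⟩
  let F : VerticalBoundary n βX βY → VerticalLines hX × VerticalLines hY := fun γ =>
    (⟨_, hmemf γ⟩, ⟨_, hmems γ⟩)
  have hFcont : Continuous F := by
    refine Continuous.prodMk (Continuous.subtype_mk ?_ _) (Continuous.subtype_mk ?_ _)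
    · exact (ContinuousMap.continuous_postcomp cf).comp continuous_subtype_val
    · exact (ContinuousMap.continuous_precomp cn).comp
        ((ContinuousMap.continuous_postcomp cs).comp continuous_subtype_val)
  let g : VerticalLines hX × VerticalLines hY → ℝ → HorocyclicProduct n βX βY := fun p t =>
    ⟨⟨p.1.1 t, p.2.1 (-t)⟩, by
      change βX (p.1.1 t) = -βY (p.2.1 (-t))
      rw [hβX, hβY, p.1.2.2, p.2.2.2, neg_neg]⟩
  have hgle : ∀ p s t, s ≤ t → edist (g p s) (g p t) ≤ ENNReal.ofReal |s - t| := by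
    intro p s t hst
    rw [abs_sub_comm, abs_of_nonneg (sub_nonneg.2 hst)]
    refine LengthSubspace.edist_le_of_lipschitz (sub_nonneg.2 hst)
      (fun u => (g p (s + u)).point) (fun u _ v _ => ?_) (fun u _ => (g p (s + u)).mem)
      (by simp) (by simp)
    rw [NormProd.edist_eq]
    refine ENNReal.ofReal_le_ofReal (n.le_of_le dist_nonneg dist_nonneg ?_ ?_)
    · change dist (p.1.1 _) (p.1.1 _) ≤ _
      rw [p.1.2.1.dist_eq, Real.dist_eq, add_sub_add_left_eq_sub]
    · change dist (p.2.1 _) (p.2.1 _) ≤ _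
      rw [p.2.2.1.dist_eq, Real.dist_eq, neg_sub_neg, add_sub_add_left_eq_sub, abs_sub_comm]
  have hgiso : ∀ p, Isometry (g p) := by
    intro p s t
    refine le_antisymm ?_ ?_
    · rw [edist_dist s t, Real.dist_eq]
      rcases le_total s t with h | h
      · exact hgle p s t h
      · rw [edist_comm, abs_sub_comm]
        exact hgle p t s h
    · refine le_trans ?_ (LengthSubspace.edist_point_le _ _)
      rw [NormProd.edist_eq, edist_dist, Real.dist_eq]
      refine ENNReal.ofReal_le_ofReal (le_trans ?_ (n.average_le _ _))
      have h1 : dist (g p s).point.fst (g p t).point.fst = |s - t| := p.1.2.1.dist_eq s t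
      have h2 : dist (g p s).point.snd (g p t).point.snd = |s - t| := by
        have := p.2.2.1.dist_eq (-s) (-t)
        rw [Real.dist_eq, neg_sub_neg, abs_sub_comm] at this
        exact this
      linarith
  let G : VerticalLines hX × VerticalLines hY → VerticalBoundary n βX βY := fun p =>
    ⟨⟨g p, (hgiso p).continuous⟩, hgiso p, fun t => by
      change -βX (p.1.1 t) = t
      rw [hβX, neg_neg, p.1.2.2]⟩
  -- Isometric curves are equicontinuous, so it suffices to show convergence at each parameter,
  -- where the two points have equal height.
  have hGcont : Continuous G := by
    refine Continuous.subtype_mk ?_ _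
    rw [continuous_iff_continuousAt]
    intro p
    refine tendsto_continuousMap_of_pointwise (fun q => (hgiso q).lipschitz) fun t => ?_
    rw [tendsto_iff_edist_tendsto_0]
    have h1 : Tendsto (fun q : VerticalLines hX × VerticalLines hY =>
        ENNReal.ofReal (dist (q.1.1 t) (p.1.1 t)) +
          ENNReal.ofReal (dist (q.2.1 (-t)) (p.2.1 (-t)))) (𝓝 p) (𝓝 0) := by
      have h2 : Continuous fun q : VerticalLines hX × VerticalLines hY =>
          ENNReal.ofReal (dist (q.1.1 t) (p.1.1 t)) +
          ENNReal.ofReal (dist (q.2.1 (-t)) (p.2.1 (-t))) := by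
        refine (ENNReal.continuous_ofReal.comp ?_).add (ENNReal.continuous_ofReal.comp ?_)
        · exact ((continuous_eval_const t).comp
            (continuous_subtype_val.comp continuous_fst)).dist continuous_const
        · exact ((continuous_eval_const (-t)).comp
            (continuous_subtype_val.comp continuous_snd)).dist continuous_const
      simpa using h2.tendsto p
    refine tendsto_of_tendsto_of_tendsto_of_le_of_le tendsto_const_nhds h1 (fun _ => bot_le)
      fun q => ?_
    refine HorocyclicProduct.edist_le HX HY gX gY hβX hβY (p := g q t) (q := g p t) ?_
    exact (q.1.2.2 t).trans (p.1.2.2 t).symm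
  refine ⟨⟨⟨F, G, fun γ => ?_, fun p => ?_⟩, hFcont, hGcont⟩, fun γ => ⟨fun t => rfl, fun t => rfl⟩⟩
  · refine Subtype.ext (ContinuousMap.ext fun t => LengthSubspace.ext (NormProd.ext rfl ?_))
    change (γ.1 (- -t)).point.snd = _
    rw [neg_neg]
  · refine Prod.ext (Subtype.ext (ContinuousMap.ext fun t => rfl))
      (Subtype.ext (ContinuousMap.ext fun t => ?_))
    change p.2.1 (- -t) = _
    rw [neg_neg]

end Product

/-! ## Geodesics in proper spaces -/

section Geodesics

variable {X : Type*} [MetricSpace X] [ProperSpace X]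

/-- The approximate intermediate points stay in a compact ball, and any cluster point for `ε → 0` is
an exact intermediate point. -/
theorem exists_between_of_approx {x y : X} {a : ℝ}
    (H : ∀ ε > 0, ∃ z, dist x z = a ∧ dist z y ≤ dist x y + ε - a) :
    ∃ z, dist x z = a ∧ dist z y = dist x y - a := by
  have : Nonempty X := ⟨x⟩
  choose! z hz1 hz2 using H
  have hmem : ∀ᶠ ε in 𝓝[>] (0 : ℝ), z ε ∈ Metric.closedBall x a := by
    filter_upwards [self_mem_nhdsWithin] with ε hε
    rw [Metric.mem_closedBall, dist_comm, hz1 ε hε]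
  obtain ⟨w, -, hw⟩ := (isCompact_closedBall x a).exists_mapClusterPt_of_frequently hmem.frequently
  obtain ⟨u, hu, huw⟩ := mapClusterPt_iff_ultrafilter.1 hw
  have h1 : dist x w = a := by
    refine tendsto_nhds_unique (tendsto_const_nhds.dist huw) (tendsto_const_nhds.congr' ?_)
    filter_upwards [hu self_mem_nhdsWithin] with ε hε using (hz1 ε hε).symm
  refine ⟨w, h1, le_antisymm ?_ ?_⟩
  · have h2 : Tendsto (fun ε : ℝ => dist x y + ε - a) u (𝓝 (dist x y - a)) := by
      have : Tendsto (fun ε : ℝ => dist x y + ε - a) (𝓝 0) (𝓝 (dist x y + 0 - a)) :=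
        (tendsto_id.const_add _).sub_const _
      rw [add_zero] at this
      exact this.mono_left (hu.trans nhdsWithin_le_nhds)
    refine le_of_tendsto_of_tendsto (huw.dist tendsto_const_nhds) h2 ?_
    filter_upwards [hu self_mem_nhdsWithin] with ε hε using hz2 ε hε
  · linarith [dist_triangle x w y]

/-- Chains of `n + 1` equal steps from `x` to `y` define step functions that are 1-Lipschitz up to
an error `d / (n + 1)`. Their limit along an ultrafilter is 1-Lipschitz. -/
theorem isGeodesicSpace_of_between
    (H : ∀ (x y : X) (a : ℝ), a ∈ Icc 0 (dist x y) → ∃ z, dist x z = a ∧ dist z y = dist x y - a) :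
    IsGeodesicSpace X := by
  intro x y
  set d := dist x y with hd
  rcases (dist_nonneg (x := x) (y := y)).eq_or_lt with h0 | hpos
  · have hxy : x = y := dist_eq_zero.1 h0.symm
    refine ⟨fun _ => x, rfl, hxy, fun s hs t ht => ?_⟩
    rw [hd, ← h0] at hs ht
    simp [le_antisymm hs.2 hs.1, le_antisymm ht.2 ht.1]
  rw [← hd] at hpos
  have chain : ∀ n : ℕ, ∃ p : ℕ → X, p 0 = x ∧ p (n + 1) = y ∧
      ∀ i j, i ≤ j → j ≤ n + 1 → dist (p i) (p j) ≤ (j - i) * (d / (n + 1)) := by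
    intro n
    set δ := d / (n + 1) with hδ
    have hδ0 : 0 < δ := by positivity
    have hδn : (n + 1) * δ = d := by rw [hδ]; field_simp
    have step : ∀ w : X, ∃ z, δ ≤ dist w y → dist w z = δ ∧ dist z y = dist w y - δ := by
      intro w
      by_cases hw : δ ≤ dist w y
      · obtain ⟨z, hz⟩ := H w y δ ⟨hδ0.le, hw⟩
        exact ⟨z, fun _ => hz⟩
      · exact ⟨w, fun h => absurd h hw⟩
    choose f hf using step
    let p : ℕ → X := fun i => f^[i] x
    have hp : ∀ i, p (i + 1) = f (p i) := fun i => Function.iterate_succ_apply' f i x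
    have hpd : ∀ i : ℕ, i ≤ n + 1 → dist (p i) y = d - i * δ := by
      intro i
      induction i with
      | zero => intro _; simp [p, hd]
      | succ i ih =>
        intro hi
        have h1 := ih (by omega)
        have h2 : (i : ℝ) + 1 ≤ n + 1 := by exact_mod_cast hi
        rw [hp, (hf (p i) (by rw [h1]; nlinarith)).2, h1]
        push_cast
        ring
    have hstep : ∀ i : ℕ, i + 1 ≤ n + 1 → dist (p i) (p (i + 1)) = δ := by
      intro i hi
      have h2 : (i : ℝ) + 1 ≤ n + 1 := by exact_mod_cast hi
      rw [hp]
      exact (hf (p i) (by rw [hpd i (by omega)]; nlinarith)).1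
    refine ⟨p, rfl, ?_, fun i j hij => ?_⟩
    · have := hpd (n + 1) le_rfl
      push_cast at this
      rw [hδn, sub_self] at this
      exact dist_eq_zero.1 this
    · induction j, hij using Nat.le_induction with
      | base => intro _; simp
      | succ j hij ih =>
        intro hj
        have h1 := ih (by omega)
        have h2 := hstep j hj
        push_cast
        linarith [dist_triangle (p i) (p j) (p (j + 1))]
  choose p hp0 hp1 hp using chain
  let q : ℕ → ℝ → X := fun n u => p n ⌊u / (d / (n + 1))⌋₊
  have hq : ∀ n : ℕ, ∀ s t : ℝ, 0 ≤ s → s ≤ t → t ≤ d →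
      dist (q n s) (q n t) ≤ t - s + d / (n + 1) := by
    intro n s t hs hst ht
    have hδ0 : 0 < d / (n + 1) := by positivity
    have h1 : s / (d / (n + 1)) ≤ t / (d / (n + 1)) := by gcongr
    have h2 : t / (d / (n + 1)) ≤ n + 1 := by
      rw [div_le_iff₀ hδ0]
      refine ht.trans_eq ?_
      field_simp
    refine (hp n _ _ (Nat.floor_le_floor h1) (Nat.floor_le_of_le (by exact_mod_cast h2))).trans ?_
    have h3 := Nat.floor_le (div_nonneg (hs.trans hst) hδ0.le)
    have h4 := (Nat.lt_floor_add_one (s / (d / (n + 1)))).le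
    have h5 : ((⌊t / (d / (n + 1))⌋₊ : ℝ) - ⌊s / (d / (n + 1))⌋₊) ≤
        t / (d / (n + 1)) - s / (d / (n + 1)) + 1 := by linarith
    refine (mul_le_mul_of_nonneg_right h5 hδ0.le).trans_eq ?_
    field_simp
  have hq0 : ∀ n, q n 0 = x := fun n => by simp [q, hp0]
  have hqd : ∀ n, q n d = y := fun n => by
    have : d / (d / ((n : ℝ) + 1)) = ((n + 1 : ℕ) : ℝ) := by
      push_cast
      field_simp
    simp only [q]
    rw [this, Nat.floor_natCast, hp1]
  have hlim0 : Tendsto (fun n : ℕ => d / ((n : ℝ) + 1)) (hyperfilter ℕ) (𝓝 0) :=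
    (tendsto_const_div_atTop_nhds_zero_nat d |>.comp (tendsto_add_atTop_nat 1) |>.congr
      (fun n => by simp)).mono_left Nat.hyperfilter_le_atTop
  have key : ∀ u : ℝ, ∃ z, u ∈ Icc 0 d → Tendsto (fun n => q n u) (hyperfilter ℕ) (𝓝 z) := by
    intro u
    by_cases hu : u ∈ Icc 0 d
    · have hmem : ∀ n, q n u ∈ Metric.closedBall x (u + d) := fun n => by
        have h1 := hq n 0 u le_rfl hu.1 hu.2
        rw [hq0, sub_zero, dist_comm] at h1
        have h2 : d / ((n : ℝ) + 1) ≤ d := div_le_self hpos.le (by simp)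
        rw [Metric.mem_closedBall]
        linarith
      obtain ⟨z, -, hz⟩ := (isCompact_closedBall x (u + d)).ultrafilter_le_nhds
        ((hyperfilter ℕ).map fun n => q n u) (le_principal_iff.2
          (Filter.mem_map.2 (univ_mem' hmem)))
      exact ⟨z, fun _ => hz⟩
    · exact ⟨x, fun h => absurd h hu⟩
  choose c hc using key
  have h0 : c 0 = x := tendsto_nhds_unique (hc 0 ⟨le_rfl, hpos.le⟩) (by simp [hq0])
  have h1 : c d = y := tendsto_nhds_unique (hc d ⟨hpos.le, le_rfl⟩) (by simp [hqd])
  have hle : ∀ s t : ℝ, 0 ≤ s → s ≤ t → t ≤ d → dist (c s) (c t) ≤ t - s := by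
    intro s t hs hst ht
    have h2 := (hc s ⟨hs, hst.trans ht⟩).dist (hc t ⟨hs.trans hst, ht⟩)
    have h3 : Tendsto (fun n : ℕ => t - s + d / ((n : ℝ) + 1)) (hyperfilter ℕ) (𝓝 (t - s)) := by
      simpa using hlim0.const_add (t - s)
    exact le_of_tendsto_of_tendsto' h2 h3 fun n => hq n s t hs hst ht
  -- A 1-Lipschitz curve of duration `dist x y` between `x` and `y` can have no slack on any of the
  -- three pieces cut off by `s` and `t`.
  have heq : ∀ s t : ℝ, 0 ≤ s → s ≤ t → t ≤ d → dist (c s) (c t) = t - s := by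
    intro s t hs hst ht
    refine le_antisymm (hle s t hs hst ht) ?_
    have h2 := hle 0 s le_rfl hs (hst.trans ht)
    have h3 := hle t d (hs.trans hst) ht le_rfl
    have h4 := dist_triangle4 (c 0) (c s) (c t) (c d)
    rw [h0, h1, ← hd] at h4
    rw [h0] at h2
    rw [h1] at h3
    linarith
  refine ⟨c, h0, h1, fun s hs t ht => ?_⟩
  rcases le_total s t with h | h
  · rw [heq s t hs.1 h ht.2, abs_sub_comm, abs_of_nonneg (by linarith)]
  · rw [dist_comm, heq t s ht.1 h hs.2, abs_of_nonneg (by linarith)]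

end Geodesics

/-! ## Paths in induced length metrics -/

namespace LengthSubspace

variable {A : Type*} [PseudoEMetricSpace A] {S : Set A}

/-- Both parts of the path are reparametrized to the unit interval, and variation is additive over a
cut. This is what makes the points of an almost shortest path almost intermediate. -/
theorem edist_add_edist_le {x y : S} (γ : Path x y) (t : unitInterval) :
    edist (⟨x, x.2⟩ : LengthSubspace S) ⟨γ t, (γ t).2⟩ +
      edist (⟨γ t, (γ t).2⟩ : LengthSubspace S) ⟨y, y.2⟩ ≤ pathLength γ := by
  have hu : (univ : Set unitInterval) = Iic t ∪ Ici t := Iic_union_Ici.symm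
  unfold pathLength
  rw [hu, eVariationOn.union _ isGreatest_Iic isLeast_Ici]
  let f : unitInterval → A := fun t => (γ t : A)
  have hf : Continuous f := continuous_subtype_val.comp γ.continuous
  refine add_le_add ?_ ?_
  · let φ : unitInterval → unitInterval := fun u => u * t
    refine (edist_le_of_path (f ∘ φ) (hf.comp (by fun_prop)) (fun u => (γ (φ u)).2)
      (by simp [f, φ]) (by simp [f, φ])).trans ?_
    refine eVariationOn.comp_le_of_monotoneOn f φ (fun a _ b _ hab => ?_) (fun u _ => ?_)
    · exact mul_le_mul_of_nonneg_right (α := ℝ) hab t.2.1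
    · exact mul_le_of_le_one_left (α := ℝ) t.2.1 u.2.2
  · let σ := unitInterval.symm
    let φ : unitInterval → unitInterval := fun u => σ (σ u * σ t)
    have hσ : Continuous φ := unitInterval.continuous_symm.comp
      ((unitInterval.continuous_symm).mul continuous_const)
    refine (edist_le_of_path (f ∘ φ) (hf.comp hσ) (fun u => (γ (φ u)).2)
      (by simp [f, φ, σ]) (by simp [f, φ, σ])).trans ?_
    refine eVariationOn.comp_le_of_monotoneOn f φ (fun a _ b _ hab => ?_) (fun u _ => ?_)
    · refine unitInterval.symm_le_symm.2 ?_
      exact mul_le_mul_of_nonneg_right (α := ℝ) (unitInterval.symm_le_symm.2 hab) (σ t).2.1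
    · have : σ u * σ t ≤ σ t := mul_le_of_le_one_left (α := ℝ) (σ t).2.1 (σ u).2.2
      have := unitInterval.symm_le_symm.2 this
      rwa [unitInterval.symm_symm] at this

theorem exists_path_lt {x y : LengthSubspace S} {L : ℝ≥0∞} (hL : edist x y < L) :
    ∃ γ : Path (⟨x.point, x.mem⟩ : S) ⟨y.point, y.mem⟩, pathLength γ < L :=
  iInf_lt_iff.1 hL

end LengthSubspace

/-! ## Fibre products of height spaces -/

/-- A chain of vertical segments. -/
inductive VerticalChain {B : Type*} [MetricSpace B] (h : B → ℝ) : B → B → ℝ → Prop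
  | nil (x : B) : VerticalChain h x x 0
  | cons {x y z : B} {l : ℝ} (hxy : dist x y = |h x - h y|) (hyz : VerticalChain h y z l) :
      VerticalChain h x z (dist x y + l)

/-- The metric is the path metric of vertical segments. -/
def HasVerticalChains {B : Type*} [MetricSpace B] (h : B → ℝ) : Prop :=
  ∀ x y : B, ∀ ε > 0, ∃ l ≤ dist x y + ε, VerticalChain h x y l

/-- The metric is the path metric of its rectifiable paths. -/
def HasShortPaths (A : Type*) [MetricSpace A] : Prop :=
  ∀ (x y : A) (L : ℝ≥0∞), edist x y < L → ∃ c : unitInterval → A, Continuous c ∧ c 0 = x ∧ c 1 = y ∧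
    eVariationOn c univ ≤ L

theorem VerticalChain.nonneg {B : Type*} [MetricSpace B] {h : B → ℝ} {x y : B} {l : ℝ}
    (hl : VerticalChain h x y l) : 0 ≤ l := by
  induction hl with
  | nil => exact le_rfl
  | cons _ _ ih => exact add_nonneg dist_nonneg ih

namespace LineSpace

variable {B : Type*} [MetricSpace B] {h : B → ℝ} (hs : LineSpace B h)
include hs

/-- A line through the lower point has to pass through the upper one, by upward uniqueness. -/
theorem exists_common_line {x y : B} (hxy : dist x y = |h x - h y|) :
    ∃ γ : ℝ → B, IsVertical h γ ∧ γ (h x) = x ∧ γ (h y) = y := by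
  have key : ∀ x y : B, h x ≤ h y → dist x y = |h x - h y| →
      ∃ γ : ℝ → B, IsVertical h γ ∧ γ (h x) = x ∧ γ (h y) = y := by
    intro x y hle hxy
    obtain ⟨γ, hγ, hx⟩ := hs.line x
    refine ⟨γ, hγ, hx, ?_⟩
    rw [abs_sub_comm, abs_of_nonneg (sub_nonneg.2 hle)] at hxy
    rw [← hs.proj_vertical hγ hle, hx, hs.proj_eq hxy]
  rcases le_total (h x) (h y) with hle | hle
  · exact key x y hle hxy
  · obtain ⟨γ, h1, h2, h3⟩ := key y x hle (by rw [dist_comm, hxy, abs_sub_comm])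
    exact ⟨γ, h1, h3, h2⟩

theorem dist_eq_trans {x y z : B} (h1 : dist x y = h y - h x) (h2 : dist y z = h z - h y) :
    dist x z = h z - h x :=
  le_antisymm (by linarith [dist_triangle x y z]) (hs.lip x z)

/-- Points joined by a vertical chain have the same ancestors. -/
theorem eq_of_verticalChain {x y : B} {l : ℝ} (hl : VerticalChain h x y l) :
    ∀ {x' y' : B}, dist x x' = h x' - h x → dist y y' = h y' - h y → h x' = h y' →
      h x + l ≤ h x' → x' = y' := by
  induction hl with
  | nil x => exact fun h1 h2 h3 _ => hs.unique x _ _ h1 h2 h3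
  | @cons x y z l hxy hyz ih =>
    intro x' z' hx' hz' he hle
    have hl0 := hyz.nonneg
    -- If the segment ascends, the point above `y` at the height of `x'` is also above `x`, hence
    -- equal to `x'`. If it descends, `x'` is itself above `y`. Either way the rest of the chain is
    -- handled by induction.
    rcases le_total (h x) (h y) with hxy' | hxy'
    · rw [abs_sub_comm, abs_of_nonneg (sub_nonneg.2 hxy')] at hxy
      have hyM : h y ≤ h x' := by linarith
      have h1 : dist y (hs.proj (h x') y) = h (hs.proj (h x') y) - h y := by
        rw [hs.dist_proj_of_le hyM, hs.height_proj]
      have h2 := hs.unique x _ _ hx' (hs.dist_eq_trans hxy h1) (hs.height_proj _ _).symm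
      rw [h2]
      exact ih h1 hz' (by rw [hs.height_proj, he]) (by rw [hs.height_proj]; linarith)
    · rw [abs_of_nonneg (sub_nonneg.2 hxy')] at hxy
      refine ih ?_ hz' he (by linarith [dist_nonneg (x := x) (y := y)])
      rw [dist_comm] at hxy
      exact hs.dist_eq_trans hxy hx'

end LineSpace

section Fibre

variable {A B : Type*} [MetricSpace A] [MetricSpace B]

/-- The fibre product of two spaces over their Busemann functions, with its length metric. -/
abbrev Fibre (βA : A → ℝ) (βB : B → ℝ) : Type _ :=
  LengthSubspace {p : A × B | βA p.1 = βB p.2}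

variable {hA : A → ℝ} {hB : B → ℝ} (HA : HeightSpace A hA) (HB : LineSpace B hB)
  {βA : A → ℝ} {βB : B → ℝ} (hβA : ∀ x, βA x = -hA x) (hβB : ∀ y, βB y = -hB y)
  (PA : HasShortPaths A) (CB : HasVerticalChains hB)

namespace Fibre

omit [MetricSpace A] [MetricSpace B] in
include hβA hβB in
theorem height_eq (p : Fibre βA βB) : hA p.point.1 = hB p.point.2 := by
  have : βA p.point.1 = βB p.point.2 := p.mem
  rw [hβA, hβB] at this
  linarith

theorem dist_le {p q : Fibre βA βB} {L : ℝ} (hL : edist p q ≤ ENNReal.ofReal L) (h0 : 0 ≤ L) :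
    dist p.point.1 q.point.1 ≤ L ∧ dist p.point.2 q.point.2 ≤ L := by
  have h1 := (LengthSubspace.edist_point_le p q).trans hL
  rw [edist_dist, ENNReal.ofReal_le_ofReal_iff h0] at h1
  exact ⟨(le_max_left _ _).trans h1, (le_max_right _ _).trans h1⟩

-- Over a vertical line of `B`, paths of `A` lift by `a ↦ (a, γ (hA a))`, which is 1-Lipschitz for
-- the maximum metric as heights are 1-Lipschitz. So leaves carry the metric of `A`.
include HA PA hβA hβB in
theorem edist_le_of_line {p q : Fibre βA βB} {γ : ℝ → B} (hγ : IsVertical hB γ)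
    (hp : γ (hA p.point.1) = p.point.2) (hq : γ (hA q.point.1) = q.point.2) :
    edist p q ≤ edist p.point.1 q.point.1 := by
  refine le_of_forall_gt fun L hL => ?_
  obtain ⟨L', h1, h2⟩ := exists_between hL
  obtain ⟨c, hc, h0, h1', hv⟩ := PA _ _ L' h1
  let g : A → A × B := fun a => (a, γ (hA a))
  have hg : LipschitzWith 1 g := LipschitzWith.of_dist_le_mul fun a b => by
    rw [NNReal.coe_one, one_mul, Prod.dist_eq]
    refine max_le le_rfl ?_
    rw [hγ.1.dist_eq, Real.dist_eq]
    exact HA.abs_lip a b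
  refine lt_of_le_of_lt ?_ h2
  refine (LengthSubspace.edist_le_of_path (g ∘ c) (hg.continuous.comp hc) (fun t => ?_) ?_ ?_).trans
    ((hg.lipschitzOnWith.comp_eVariationOn_le (s := univ) (fun _ _ => mem_univ _)).trans ?_)
  · change βA (c t) = βB (γ (hA (c t)))
    rw [hβA, hβB, hγ.2]
  · simp only [Function.comp, h0, g, hp]
  · simp only [Function.comp, h1', g, hq]
  · rwa [ENNReal.coe_one, one_mul]

-- The second coordinate moves along the chain and the first follows the heights on one vertical
-- line. Each vertical segment of the chain lies in a single leaf.
include HA HB PA hβA hβB in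
theorem edist_le_of_verticalChain {v w : B} {l : ℝ} (hl : VerticalChain hB v w l) {γ : ℝ → A}
    (hγ : IsVertical hA γ) : ∀ {p q : Fibre βA βB}, p.point = (γ (hB v), v) →
      q.point = (γ (hB w), w) → edist p q ≤ ENNReal.ofReal l := by
  induction hl with
  | nil v =>
    intro p q hp hq
    rw [show p = q from LengthSubspace.ext (hp.trans hq.symm)]
    simp
  | @cons v w z l hvw hwz ih =>
    intro p q hp hq
    let m : Fibre βA βB := ⟨(γ (hB w), w), by
      change βA (γ (hB w)) = βB w
      rw [hβA, hβB, hγ.2]⟩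
    rw [ENNReal.ofReal_add dist_nonneg hwz.nonneg]
    refine (edist_triangle p m q).trans (add_le_add ?_ (ih rfl hq))
    obtain ⟨ℓ, hℓ, h1, h2⟩ := HB.exists_common_line hvw
    have h3 := edist_le_of_line HA hβA hβB PA (p := p) (q := m) hℓ
      (by rw [hp]; simp only [hγ.2, h1]) (by simp only [m, hγ.2, h2])
    refine h3.trans ?_
    rw [hp]
    simp only [m]
    rw [hγ.1.edist_eq, edist_dist, Real.dist_eq, hvw]

-- First the second coordinate is corrected along a chain of almost minimal length, then the first
-- coordinate inside a leaf. Thus the length metric is finite and comparable to the product metric.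
include HA HB PA CB hβA hβB in
theorem edist_le (p q : Fibre βA βB) :
    edist p q ≤ ENNReal.ofReal (dist p.point.1 q.point.1 + 2 * dist p.point.2 q.point.2) := by
  refine ENNReal.le_of_forall_pos_le_add fun ε hε _ => ?_
  obtain ⟨l, hl, hc⟩ := CB p.point.2 q.point.2 ε hε
  obtain ⟨γ, hγ, hγp⟩ := HA.line p.point.1
  have hp := height_eq hβA hβB p
  have hq := height_eq hβA hβB q
  let m : Fibre βA βB := ⟨(γ (hB q.point.2), q.point.2), by
    change βA (γ _) = βB q.point.2
    rw [hβA, hβB, hγ.2]⟩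
  have h1 := edist_le_of_verticalChain HA HB hβA hβB PA hc hγ (p := p) (q := m)
    (Prod.ext (by rw [← hp, hγp]) rfl) rfl
  obtain ⟨ℓ, hℓ, hℓq⟩ := HB.line q.point.2
  have h2 := edist_le_of_line HA hβA hβB PA (p := m) (q := q) hℓ
    (by simp only [m, hγ.2, hℓq]) (by rw [hq, hℓq])
  have h3 : dist m.point.1 q.point.1 ≤ dist p.point.1 q.point.1 + dist p.point.2 q.point.2 := by
    have h4 := dist_triangle m.point.1 p.point.1 q.point.1
    have h5 : dist m.point.1 p.point.1 = |hB q.point.2 - hB p.point.2| := by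
      change dist (γ (hB q.point.2)) p.point.1 = _
      conv_lhs => rw [← hγp]
      rw [hγ.1.dist_eq, Real.dist_eq, hp]
    have h6 := HB.abs_lip q.point.2 p.point.2
    rw [dist_comm] at h6
    linarith
  refine (edist_triangle p m q).trans ((add_le_add h1 h2).trans ?_)
  rw [edist_dist, ← ENNReal.ofReal_add hc.nonneg dist_nonneg]
  have e : (ε : ℝ≥0∞) = ENNReal.ofReal ε := by simp
  rw [e, ← ENNReal.ofReal_add (by positivity) ε.coe_nonneg]
  refine ENNReal.ofReal_le_ofReal ?_
  linarith

include HA HB PA CB hβA hβB in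
theorem edist_ne_top' (p q : Fibre βA βB) : edist p q ≠ ⊤ :=
  ne_top_of_le_ne_top ENNReal.ofReal_ne_top (edist_le HA HB hβA hβB PA CB p q)

theorem eq_of_edist_eq_zero' {p q : Fibre βA βB} (h : edist p q = 0) : p = q := by
  obtain ⟨h1, h2⟩ := dist_le (p := p) (q := q) (L := 0) (by rw [h]; simp) le_rfl
  exact LengthSubspace.ext (Prod.ext (dist_le_zero.1 h1) (dist_le_zero.1 h2))

/-- The fibre product as a metric space. -/
abbrev metricSpace : MetricSpace (Fibre βA βB) :=
  letI : PseudoMetricSpace (Fibre βA βB) :=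
    PseudoEMetricSpace.toPseudoMetricSpace (edist_ne_top' HA HB hβA hβB PA CB)
  { eq_of_dist_eq_zero := fun {x y} h => eq_of_edist_eq_zero' (by
      rw [edist_dist, h, ENNReal.ofReal_zero]) }


-- Points at distance at most one have second coordinates joined by a vertical chain of length at
-- most two. A little higher these have the same ancestor, both points are in one leaf, and the
-- contraction of `A` applies there.
include HA HB PA CB hβA hβB in
theorem heightSpace : letI := metricSpace HA HB hβA hβB PA CB
    HeightSpace (Fibre βA βB) (fun p => hA p.point.1) := by
  let _ := metricSpace HA HB hβA hβB PA CB
  have hd : ∀ p q : Fibre βA βB, dist p.point.1 q.point.1 ≤ dist p q ∧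
      dist p.point.2 q.point.2 ≤ dist p q := fun p q =>
    dist_le (by rw [edist_dist]) dist_nonneg
  have hht := height_eq hβA hβB
  -- The distance in the fibre product bounds both coordinate distances and each of these bounds the
  -- height difference. So a vertical displacement is vertical in both coordinates.
  have hup : ∀ p q : Fibre βA βB, dist p q = hA q.point.1 - hA p.point.1 →
      dist p.point.1 q.point.1 = hA q.point.1 - hA p.point.1 ∧
      dist p.point.2 q.point.2 = hB q.point.2 - hB p.point.2 := fun p q h => by
    have h1 := hd p q
    have h2 := HA.lip p.point.1 q.point.1
    have h3 := HB.lip p.point.2 q.point.2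
    have h4 := hht p
    have h5 := hht q
    constructor <;> linarith
  refine ⟨⟨fun p q => (HA.lip _ _).trans (hd p q).1, fun p => ?_, fun p q r h1 h2 h3 => ?_⟩, ?_⟩
  · obtain ⟨γ, hγ, hγp⟩ := HA.line p.point.1
    obtain ⟨ℓ, hℓ, hℓp⟩ := HB.line p.point.2
    let g : ℝ → Fibre βA βB := fun t => ⟨(γ t, ℓ t), by
      change βA (γ t) = βB (ℓ t)
      rw [hβA, hβB, hγ.2, hℓ.2]⟩
    refine ⟨g, ⟨fun s t => le_antisymm ?_ ?_, hγ.2⟩,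
      LengthSubspace.ext (Prod.ext hγp (by rw [hht]; exact hℓp))⟩
    · refine (edist_le_of_line HA hβA hβB PA (p := g s) (q := g t) hℓ ?_ ?_).trans
        (hγ.1.edist_eq s t).le
      · simp only [g, hγ.2]
      · simp only [g, hγ.2]
    · rw [← hγ.1.edist_eq s t]
      exact (le_max_left _ _).trans (LengthSubspace.edist_point_le (g s) (g t))
  · refine LengthSubspace.ext (Prod.ext ?_ ?_)
    · exact HA.unique _ _ _ (hup _ _ h1).1 (hup _ _ h2).1 h3
    · exact HB.unique _ _ _ (hup _ _ h1).2 (hup _ _ h2).2 (by rw [← hht, ← hht, h3])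
  · obtain ⟨C, r, hr, H⟩ := HA.contr
    refine ⟨|C| + 10 * Real.exp (r * 4), r, hr, fun p q p' q' hpq hp hq he => ?_⟩
    have hpq' := (hd p q)
    have h1 := HA.abs_lip p.point.1 q.point.1
    have h2 := abs_le.1 h1
    have hpos := Real.exp_pos (-r * (hA p'.point.1 - hA p.point.1))
    -- Below relative height 4 the crude bound `4 + 1 + 5` suffices, and the factor `e^{4r}`
    -- compensates for the exponential. Above it, the chain of length at most 2 forces equal second
    -- coordinates.
    rcases le_or_gt (hA p'.point.1 - hA p.point.1) 4 with h4 | h4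
    · have h5 : dist p' q' ≤ 10 := by
        have := dist_triangle4 p' p q q'
        rw [dist_comm p' p] at this
        linarith
      have h6 : 1 ≤ Real.exp (r * 4) * Real.exp (-r * (hA p'.point.1 - hA p.point.1)) := by
        rw [← Real.exp_add]
        exact Real.one_le_exp (by nlinarith)
      have h7 := mul_nonneg (abs_nonneg C) hpos.le
      rw [add_mul, mul_assoc]
      linarith
    · obtain ⟨l, hl, hc⟩ := CB p.point.2 q.point.2 1 one_pos
      have h5 : p'.point.2 = q'.point.2 :=
        HB.eq_of_verticalChain hc (hup _ _ hp).2 (hup _ _ hq).2 (by rw [← hht, ← hht, he])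
          (by rw [← hht, ← hht]; linarith)
      obtain ⟨ℓ, hℓ, hℓp⟩ := HB.line p'.point.2
      have h6 := edist_le_of_line HA hβA hβB PA (p := p') (q := q') hℓ
        (by rw [hht, hℓp]) (by rw [hht, ← h5, hℓp])
      have h7 : dist p' q' ≤ dist p'.point.1 q'.point.1 := by
        rw [edist_dist, edist_dist] at h6
        exact (ENNReal.ofReal_le_ofReal_iff dist_nonneg).1 h6
      have h8 := H _ _ _ _ (hpq'.1.trans hpq) (hup _ _ hp).1 (hup _ _ hq).1 he
      refine h7.trans (h8.trans ?_)
      gcongr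
      linarith [le_abs_self C, Real.exp_pos (r * 4)]

include HA HB PA CB hβA hβB in
theorem isClosedEmbedding_point :
    IsClosedEmbedding (LengthSubspace.point : Fibre βA βB → A × B) := by
  let _ := metricSpace HA HB hβA hβB PA CB
  have h1 : LipschitzWith 1 (LengthSubspace.point : Fibre βA βB → A × B) := fun p q => by
    rw [ENNReal.coe_one, one_mul]
    exact LengthSubspace.edist_point_le p q
  have h2 : AntilipschitzWith 3 (LengthSubspace.point : Fibre βA βB → A × B) := fun p q => by
    refine (edist_le HA HB hβA hβB PA CB p q).trans ?_
    rw [edist_dist, Prod.dist_eq, show ((3 : ℝ≥0) : ℝ≥0∞) = ENNReal.ofReal 3 by simp,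
      ← ENNReal.ofReal_mul (by norm_num)]
    refine ENNReal.ofReal_le_ofReal ?_
    linarith [le_max_left (dist p.point.1 q.point.1) (dist p.point.2 q.point.2),
      le_max_right (dist p.point.1 q.point.1) (dist p.point.2 q.point.2)]
  refine ⟨(h2.isUniformEmbedding h1.uniformContinuous).isEmbedding, ?_⟩
  have h3 : range (LengthSubspace.point : Fibre βA βB → A × B) =
      {p : A × B | hA p.1 = hB p.2} := by
    ext p
    constructor
    · rintro ⟨q, rfl⟩
      exact height_eq hβA hβB q
    · intro hp
      exact ⟨⟨p, by
        change βA p.1 = βB p.2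
        rw [hβA, hβB, show hA p.1 = hB p.2 from hp]⟩, rfl⟩
  rw [h3]
  exact isClosed_eq (HA.continuous.comp continuous_fst) (HB.continuous.comp continuous_snd)

include HA HB PA CB hβA hβB in
theorem properSpace [ProperSpace A] [ProperSpace B] : letI := metricSpace HA HB hβA hβB PA CB
    ProperSpace (Fibre βA βB) := by
  let _ := metricSpace HA HB hβA hβB PA CB
  refine ⟨fun p R => ?_⟩
  have h1 := (isClosedEmbedding_point HA HB hβA hβB PA CB).isCompact_preimage
    (isCompact_closedBall p.point R)
  refine h1.of_isClosed_subset Metric.isClosed_closedBall fun q hq => ?_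
  rw [Metric.mem_closedBall] at hq
  rw [mem_preimage, Metric.mem_closedBall, Prod.dist_eq]
  obtain ⟨h2, h3⟩ := dist_le (p := q) (q := p) (by rw [edist_dist]) dist_nonneg
  exact (max_le h2 h3).trans hq

-- On an almost shortest path, the intermediate value theorem gives a point at prescribed distance
-- from `p` whose distance to `q` is almost minimal. Properness makes this exact.
include HA HB PA CB hβA hβB in
theorem isGeodesicSpace [ProperSpace A] [ProperSpace B] :
    letI := metricSpace HA HB hβA hβB PA CB
    IsGeodesicSpace (Fibre βA βB) := by
  let _ := metricSpace HA HB hβA hβB PA CB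
  have _ := properSpace HA HB hβA hβB PA CB
  refine isGeodesicSpace_of_between fun p q a ha => exists_between_of_approx fun ε hε => ?_
  obtain ⟨γ, hγ⟩ := LengthSubspace.exists_path_lt (x := p) (y := q)
    (L := ENNReal.ofReal (dist p q + ε)) (by
      rw [edist_dist]
      exact (ENNReal.ofReal_lt_ofReal_iff (by positivity)).2 (by linarith))
  let g : unitInterval → Fibre βA βB := fun t => ⟨γ t, (γ t).2⟩
  have hg : Continuous g := by
    rw [(isClosedEmbedding_point HA HB hβA hβB PA CB).isInducing.continuous_iff]
    exact continuous_subtype_val.comp γ.continuous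
  have h0 : g 0 = p := LengthSubspace.ext (by simp [g])
  have h1 : g 1 = q := LengthSubspace.ext (by simp [g])
  obtain ⟨t, -, ht⟩ := isPreconnected_univ.intermediate_value (mem_univ (0 : unitInterval))
    (mem_univ 1) ((continuous_const (y := p)).dist hg).continuousOn
    (show a ∈ Icc (dist p (g 0)) (dist p (g 1)) by rwa [h0, h1, dist_self])
  refine ⟨g t, ht, ?_⟩
  have h2 := (LengthSubspace.edist_add_edist_le γ t).trans hγ.le
  have h3 : edist p (g t) + edist (g t) q ≤ ENNReal.ofReal (dist p q + ε) := h2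
  rw [edist_dist, edist_dist, ← ENNReal.ofReal_add dist_nonneg dist_nonneg,
    ENNReal.ofReal_le_ofReal_iff (by positivity)] at h3
  have ht' : dist p (g t) = a := ht
  linarith

end Fibre
end Fibre

/-! ## Distances in trees -/

section Trees

variable {V : Type*} {G : SimpleGraph V}

/-- Two neighbours closer to `c` would start two shortest paths from `v` to `c`, but paths in a tree
are unique. -/
theorem eq_of_adj_of_dist_add_one (hG : G.IsTree) {v w z c : V} (hw : G.Adj v w) (hz : G.Adj v z)
    (hwc : G.dist w c + 1 = G.dist v c) (hzc : G.dist z c + 1 = G.dist v c) : w = z := by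
  obtain ⟨p, hp⟩ := hG.connected.exists_walk_length_eq_dist w c
  obtain ⟨q, hq⟩ := hG.connected.exists_walk_length_eq_dist z c
  have h1 : (SimpleGraph.Walk.cons hw p).IsPath :=
    SimpleGraph.Walk.isPath_of_length_eq_dist _ (by rw [SimpleGraph.Walk.length_cons, hp, hwc])
  have h2 : (SimpleGraph.Walk.cons hz q).IsPath :=
    SimpleGraph.Walk.isPath_of_length_eq_dist _ (by rw [SimpleGraph.Walk.length_cons, hq, hzc])
  have h3 := congrArg Subtype.val ((hG.isAcyclic.subsingleton_path v c).elim ⟨_, h1⟩ ⟨_, h2⟩)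
  have h4 := congrArg SimpleGraph.Walk.snd h3
  simpa using h4

theorem exists_adj_dist_add_one (hG : G.IsTree) {v c : V} (hvc : v ≠ c) :
    ∃ w, G.Adj v w ∧ G.dist w c + 1 = G.dist v c := by
  obtain ⟨p, hp⟩ := hG.connected.exists_walk_length_eq_dist v c
  cases p with
  | nil => exact absurd rfl hvc
  | @cons _ w _ hw p =>
    refine ⟨w, hw, ?_⟩
    rw [SimpleGraph.Walk.length_cons] at hp
    have h1 := SimpleGraph.dist_le p
    rcases hG.dist_eq_dist_add_one_of_adj c hw with h | h <;>
      simp only [G.dist_comm (u := c)] at h <;> omega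

/-- Seen from a vertex that is not one of its ends, both ends of an edge lie in the same direction.
-/
theorem dist_sub_dist_eq_of_adj (hG : G.IsTree) {v w a c : V} (hvw : G.Adj v w) (hac : G.Adj a c)
    (hva : v ≠ a) (hvc : v ≠ c) :
    (G.dist w a : ℝ) - G.dist v a = G.dist w c - G.dist v c := by
  have key : ∀ a c : V, v ≠ a → G.dist v c = G.dist v a + 1 →
      G.dist w c + G.dist v a = G.dist w a + G.dist v c ∨ ¬ G.Adj a c := by
    intro a c hva h
    by_cases hac : G.Adj a c
    · left
      have h1 := hG.dist_eq_dist_add_one_of_adj w hac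
      have h2 := hG.dist_eq_dist_add_one_of_adj a hvw
      have h3 := hG.dist_eq_dist_add_one_of_adj c hvw
      simp only [G.dist_comm (u := a), G.dist_comm (u := c)] at h2 h3
      by_contra hne
      have h4 : G.dist w a = G.dist v a + 1 := by omega
      have h5 : G.dist w c + 1 = G.dist v c := by omega
      -- The first step `z` from `v` towards the near end `a` also leads towards the far end `c`. It
      -- coincides with `w`, which was supposed to lead away from `a`.
      obtain ⟨z, hz, hza⟩ := exists_adj_dist_add_one hG hva
      have h6 := hG.dist_eq_dist_add_one_of_adj z hac
      have h7 := hG.dist_eq_dist_add_one_of_adj c hz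
      simp only [G.dist_comm (u := c)] at h7
      have h8 := eq_of_adj_of_dist_add_one hG hvw hz h5 (by omega)
      rw [h8] at h4
      omega
    · exact Or.inr hac
  rcases hG.dist_eq_dist_add_one_of_adj v hac with h | h
  · have := (key c a hvc h).resolve_right (not_not.2 hac.symm)
    have : (G.dist w a : ℝ) + G.dist v c = G.dist w c + G.dist v a := by exact_mod_cast this
    linarith
  · have := (key a c hva h).resolve_right (not_not.2 hac)
    have : (G.dist w c : ℝ) + G.dist v a = G.dist w a + G.dist v c := by exact_mod_cast this
    linarith

theorem finite_dist_le (hG : G.IsTree) (hf : ∀ v, (G.neighborSet v).Finite) (v : V) (n : ℕ) :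
    {w | G.dist v w ≤ n}.Finite := by
  induction n with
  | zero =>
    refine (finite_singleton v).subset fun w hw => ?_
    have : G.dist v w = 0 := Nat.le_zero.1 hw
    exact (hG.connected.dist_eq_zero_iff.1 this).symm
  | succ n ih =>
    refine (ih.union (ih.biUnion fun w _ => hf w)).subset fun w hw => ?_
    rcases eq_or_ne w v with rfl | hne
    · exact Or.inl (by simp)
    · obtain ⟨z, hz, hzv⟩ := exists_adj_dist_add_one hG hne
      right
      have hw' : G.dist v w ≤ n + 1 := hw
      rw [mem_iUnion₂]
      refine ⟨z, ?_, hz.symm⟩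
      change G.dist v z ≤ n
      have e1 := G.dist_comm (u := z) (v := v)
      have e2 := G.dist_comm (u := w) (v := v)
      omega

end Trees

/-! ## The geometric realization of a graph -/

namespace Realization

variable {V : Type*} {G : SimpleGraph V}

theorem OnEdge.symm {x : Realization G} {u v : V} (h : x.OnEdge u v) : x.OnEdge v u :=
  ⟨h.1.symm, by rw [add_comm]; exact h.2.1, fun w h1 h2 => h.2.2 w h2 h1⟩

theorem exists_onEdge (x : Realization G) : ∃ u v, x.OnEdge u v := x.mem_edge

theorem OnEdge.ext {x y : Realization G} {u v : V} (hx : x.OnEdge u v) (hy : y.OnEdge u v)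
    (h : x.coord v = y.coord v) : x = y := by
  refine Realization.ext (funext fun w => ?_)
  rcases eq_or_ne w v with rfl | hv
  · exact h
  rcases eq_or_ne w u with rfl | hu
  · linarith [hx.2.1, hy.2.1]
  · rw [hx.2.2 w hu hv, hy.2.2 w hu hv]

open Classical in
/-- The point at distance `s` from `u` on the edge from `u` to `v`. -/
def edgePoint {u v : V} (h : G.Adj u v) (s : unitInterval) : Realization G where
  coord w := if w = u then 1 - s else if w = v then s else 0
  nonneg w := by
    split_ifs
    · linarith [s.2.2]
    · exact s.2.1
    · exact le_rfl
  mem_edge := ⟨u, v, h, by simp [h.ne'], fun w h1 h2 => by simp [h1, h2]⟩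

theorem onEdge_edgePoint {u v : V} (h : G.Adj u v) (s : unitInterval) :
    (edgePoint h s).OnEdge u v :=
  ⟨h, by simp [edgePoint, h.ne'], fun w h1 h2 => by simp [edgePoint, h1, h2]⟩

theorem coord_edgePoint {u v : V} (h : G.Adj u v) (s : unitInterval) :
    (edgePoint h s).coord v = s := by simp [edgePoint, h.ne']

theorem coord_edgePoint_left {u v : V} (h : G.Adj u v) (s : unitInterval) :
    (edgePoint h s).coord u = 1 - s := by simp [edgePoint]

theorem OnEdge.coord_mem {x : Realization G} {u v : V} (hx : x.OnEdge u v) :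
    x.coord v ∈ unitInterval :=
  ⟨x.nonneg v, by linarith [x.nonneg u, hx.2.1]⟩

theorem OnEdge.eq_edgePoint {x : Realization G} {u v : V} (hx : x.OnEdge u v) :
    x = edgePoint hx.1 ⟨x.coord v, hx.coord_mem⟩ :=
  hx.ext (onEdge_edgePoint _ _) (by rw [coord_edgePoint])

theorem edgePoint_zero {u v w : V} (h : G.Adj u v) (h' : G.Adj u w) :
    edgePoint h 0 = edgePoint h' 0 := by
  refine Realization.ext (funext fun z => ?_)
  simp [edgePoint]

theorem edgePoint_one {u v w : V} (h : G.Adj u v) (h' : G.Adj v w) :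
    edgePoint h 1 = edgePoint h' 0 := by
  classical
  refine Realization.ext (funext fun z => ?_)
  by_cases h1 : z = v
  · subst h1; simp [edgePoint, h.ne']
  · simp [edgePoint, h1]

theorem edist_le_of_onEdge {x y : Realization G} {u v : V} (hx : x.OnEdge u v)
    (hy : y.OnEdge u v) : edist x y ≤ ENNReal.ofReal |x.coord u - y.coord u| :=
  (iInf₂_le _ (.cons hx hy (.nil y))).trans_eq (add_zero _)

/-- The extension of a function on the vertices that is affine on every edge. -/
def extend (f : V → ℝ) (x : Realization G) : ℝ := ∑ᶠ v, x.coord v * f v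

theorem OnEdge.extend_eq {x : Realization G} {u v : V} (hx : x.OnEdge u v) (f : V → ℝ) :
    extend f x = x.coord u * f u + x.coord v * f v := by
  classical
  have h : Function.support (fun w => x.coord w * f w) ⊆ (({u, v} : Finset V) : Set V) := by
    intro w hw
    by_contra hn
    simp only [Finset.coe_insert, Finset.coe_singleton, mem_insert_iff, mem_singleton_iff,
      not_or] at hn
    exact hw (by simp [hx.2.2 w hn.1 hn.2])
  rw [extend, finsum_eq_sum_of_support_subset _ h, Finset.sum_pair hx.1.ne]

theorem extend_edgePoint {u v : V} (h : G.Adj u v) (s : unitInterval) (f : V → ℝ) :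
    extend f (edgePoint h s) = (1 - s) * f u + s * f v := by
  rw [(onEdge_edgePoint h s).extend_eq, coord_edgePoint, coord_edgePoint_left]

/-- On each edge the extension is affine with slope at most one, so it changes by at most the length
of a piecewise linear path. This is the source of lower bounds for the path metric. -/
theorem abs_extend_sub_le {f : V → ℝ} (hf : ∀ u v, G.Adj u v → |f u - f v| ≤ 1)
    (x y : Realization G) : ENNReal.ofReal |extend f x - extend f y| ≤ edist x y := by
  refine le_iInf₂ fun l hl => ?_
  induction hl with
  | nil => simp
  | @cons x y z u v l hx hy _ ih =>
    have h1 : |extend f x - extend f y| ≤ |x.coord u - y.coord u| := by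
      have : extend f x - extend f y = (x.coord u - y.coord u) * (f u - f v) := by
        rw [hx.extend_eq, hy.extend_eq]
        have h1 := hx.2.1
        have h2 := hy.2.1
        rw [← eq_sub_iff_add_eq'] at h1 h2
        rw [h1, h2]
        ring
      rw [this, abs_mul]
      exact mul_le_of_le_one_right (abs_nonneg _) (hf u v hx.1)
    have h2 : |extend f x - extend f z| ≤ |x.coord u - y.coord u| + |extend f y - extend f z| :=
      (abs_sub_le _ (extend f y) _).trans (by linarith)
    refine (ENNReal.ofReal_le_ofReal h2).trans ?_
    rw [ENNReal.ofReal_add (abs_nonneg _) (abs_nonneg _)]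
    exact add_le_add le_rfl ih

/-- The barycentric coordinate of `v` is the extension of the indicator of `v`, hence 1-Lipschitz,
and the coordinates determine the point. -/
theorem eq_of_edist_eq_zero' {x y : Realization G} (h : edist x y = 0) : x = y := by
  classical
  refine Realization.ext (funext fun v => ?_)
  have hc : ∀ z : Realization G, extend (Pi.single v 1) z = z.coord v := fun z => by
    rw [extend, finsum_eq_single _ v fun w hw => by rw [Pi.single_eq_of_ne hw, mul_zero]]
    simp
  have h1 := abs_extend_sub_le (G := G) (f := Pi.single v 1) (fun a b hab => by
    by_cases ha : a = v <;> by_cases hb : b = v <;> simp [ha, hb]) x y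
  rw [h, nonpos_iff_eq_zero, ENNReal.ofReal_eq_zero, hc, hc] at h1
  exact sub_eq_zero.1 (abs_eq_zero.1 (le_antisymm h1 (abs_nonneg _)))

end Realization

/-! ## Regular trees as metric spaces -/

namespace RegularTree

open Realization

variable {V : Type*} (T : RegularTree V)

/-- `ncard` vanishes on infinite sets, so the value `k + 1` forces finiteness. -/
theorem finite_neighborSet (v : V) : (T.G.neighborSet v).Finite :=
  finite_of_ncard_pos (by rw [T.regular]; omega)

theorem exists_adj (v : V) : ∃ w, T.G.Adj v w :=
  nonempty_of_ncard_ne_zero (s := T.G.neighborSet v) (by rw [T.regular]; omega)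

/-- A vertex as a point of the geometric realization. -/
def vertex (v : V) : Realization T.G := edgePoint (T.exists_adj v).choose_spec 0

theorem edgePoint_zero_eq {v w : V} (h : T.G.Adj v w) : edgePoint h 0 = T.vertex v :=
  edgePoint_zero _ _

theorem edgePoint_one_eq {v w : V} (h : T.G.Adj w v) : edgePoint h 1 = T.vertex v :=
  edgePoint_one _ _

theorem onEdge_vertex {v w : V} (h : T.G.Adj v w) : (T.vertex v).OnEdge v w := by
  rw [← T.edgePoint_zero_eq h]
  exact onEdge_edgePoint h 0

theorem coord_vertex (v : V) : (T.vertex v).coord v = 1 := by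
  rw [vertex, coord_edgePoint_left]
  simp

theorem extend_vertex (f : V → ℝ) (v : V) : extend f (T.vertex v) = f v := by
  rw [vertex, extend_edgePoint]
  simp

theorem edist_vertex_vertex_le (v w : V) : edist (T.vertex v) (T.vertex w) ≤ T.G.dist v w := by
  obtain ⟨p, hp⟩ := T.isTree.connected.exists_walk_length_eq_dist v w
  rw [← hp]
  clear hp
  induction p with
  | nil => simp
  | @cons u v w h p ih =>
    refine (edist_triangle _ (T.vertex v) _).trans ?_
    have h1 := edist_le_of_onEdge (T.onEdge_vertex h) (T.onEdge_vertex h.symm).symm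
    have h2 := (T.onEdge_vertex h.symm).2.1
    rw [coord_vertex] at h1 h2
    rw [show (T.vertex v).coord u = 0 by linarith, sub_zero, abs_one, ENNReal.ofReal_one] at h1
    rw [SimpleGraph.Walk.length_cons, Nat.cast_add, Nat.cast_one, add_comm (p.length : ℝ≥0∞)]
    exact add_le_add h1 ih

theorem edist_vertex_le {x : Realization T.G} {u w : V} (hx : x.OnEdge u w) :
    edist (T.vertex u) x ≤ ENNReal.ofReal (x.coord w) := by
  have h1 := edist_le_of_onEdge (T.onEdge_vertex hx.1) hx
  rwa [coord_vertex, ← hx.2.1, add_sub_cancel_left, abs_of_nonneg (x.nonneg w)] at h1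

theorem abs_dist_sub_dist_le (v : V) {u w : V} (h : T.G.Adj u w) :
    |(T.G.dist v u : ℝ) - T.G.dist v w| = 1 := by
  rcases T.isTree.dist_eq_dist_add_one_of_adj v h with h | h <;> rw [h] <;> push_cast <;> simp

/-- Graph distances from `v` to the two ends of an edge differ by exactly one, so going through the
nearer end attains the affine extension; the Lipschitz property of extensions shows that nothing
shorter exists. -/
theorem edist_vertex (v : V) (x : Realization T.G) :
    edist (T.vertex v) x = ENNReal.ofReal (extend (fun w => (T.G.dist v w : ℝ)) x) := by
  apply le_antisymm
  · have key : ∀ u w, x.OnEdge u w → T.G.dist v w = T.G.dist v u + 1 →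
        edist (T.vertex v) x ≤ ENNReal.ofReal (extend (fun w => (T.G.dist v w : ℝ)) x) := by
      intro u w hx h
      have h1 := add_le_add (T.edist_vertex_vertex_le v u) (T.edist_vertex_le hx)
      refine (edist_triangle _ _ _).trans (h1.trans ?_)
      rw [hx.extend_eq, h, ← ENNReal.ofReal_natCast, ← ENNReal.ofReal_add (by positivity)
        (x.nonneg w)]
      refine ENNReal.ofReal_le_ofReal ?_
      have := hx.2.1
      push_cast
      rw [show x.coord u = 1 - x.coord w by linarith]
      linarith
    obtain ⟨u, w, hx⟩ := x.exists_onEdge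
    rcases T.isTree.dist_eq_dist_add_one_of_adj v hx.1 with h | h
    · exact key w u hx.symm h
    · exact key u w hx h
  · have h1 := abs_extend_sub_le (f := fun w => (T.G.dist v w : ℝ))
      (fun u w h => (T.abs_dist_sub_dist_le v h).le) x (T.vertex v)
    rw [extend_vertex, SimpleGraph.dist_self, Nat.cast_zero, sub_zero, edist_comm] at h1
    exact (ENNReal.ofReal_le_ofReal (le_abs_self _)).trans h1

theorem edist_ne_top' (x y : Realization T.G) : edist x y ≠ ⊤ := by
  obtain ⟨v⟩ := T.isTree.connected.nonempty
  refine ne_top_of_le_ne_top (ENNReal.add_ne_top.2 ⟨?_, ?_⟩)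
    ((edist_triangle_left x y (T.vertex v)))
  all_goals rw [edist_vertex]; exact ENNReal.ofReal_ne_top

/-- The geometric realization of a regular tree as a metric space. -/
abbrev metricSpace : MetricSpace (Realization T.G) :=
  letI : PseudoMetricSpace (Realization T.G) :=
    PseudoEMetricSpace.toPseudoMetricSpace T.edist_ne_top'
  { eq_of_dist_eq_zero := fun {x y} h => Realization.eq_of_edist_eq_zero' (by
      rw [edist_dist, h, ENNReal.ofReal_zero]) }

attribute [local instance] metricSpace

theorem extend_dist_nonneg (v : V) (x : Realization T.G) :
    0 ≤ extend (fun w => (T.G.dist v w : ℝ)) x := by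
  obtain ⟨u, w, hx⟩ := x.exists_onEdge
  rw [hx.extend_eq]
  have := x.nonneg u
  have := x.nonneg w
  positivity

theorem dist_vertex (v : V) (x : Realization T.G) :
    dist (T.vertex v) x = extend (fun w => (T.G.dist v w : ℝ)) x := by
  have h := T.edist_vertex v x
  rw [edist_dist] at h
  exact (ENNReal.ofReal_eq_ofReal_iff dist_nonneg (T.extend_dist_nonneg v x)).1 h

theorem dist_le_of_onEdge {x y : Realization T.G} {u v : V} (hx : x.OnEdge u v)
    (hy : y.OnEdge u v) : dist x y ≤ |x.coord v - y.coord v| := by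
  have h := edist_le_of_onEdge hx.symm hy.symm
  rwa [edist_dist, ENNReal.ofReal_le_ofReal_iff (abs_nonneg _)] at h

theorem isCompact_edge {u v : V} (h : T.G.Adj u v) : IsCompact (range (edgePoint h)) := by
  refine isCompact_range (LipschitzWith.of_dist_le_mul (K := 1) fun s t => ?_).continuous
  have h1 := T.dist_le_of_onEdge (onEdge_edgePoint h s) (onEdge_edgePoint h t)
  rw [coord_edgePoint, coord_edgePoint] at h1
  rwa [NNReal.coe_one, one_mul]

theorem properSpace : ProperSpace (Realization T.G) := by
  classical
  refine ⟨fun x R => ?_⟩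
  obtain ⟨v⟩ := T.isTree.connected.nonempty
  obtain ⟨n, hn⟩ := exists_nat_ge (dist (T.vertex v) x + R + 1)
  have hf := finite_dist_le T.isTree T.finite_neighborSet v n
  have hc : IsCompact (⋃ u ∈ {w | T.G.dist v w ≤ n}, ⋃ w ∈ T.G.neighborSet u,
      if h : T.G.Adj u w then range (edgePoint h) else ∅) :=
    hf.isCompact_biUnion fun u _ => (T.finite_neighborSet u).isCompact_biUnion fun w _ => by
      split_ifs with h
      exacts [T.isCompact_edge h, isCompact_empty]
  refine hc.of_isClosed_subset Metric.isClosed_closedBall fun y hy => ?_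
  obtain ⟨u, w, hyw⟩ := y.exists_onEdge
  simp only [mem_iUnion]
  refine ⟨u, ?_, w, hyw.1, ?_⟩
  · have h1 := T.dist_vertex v (T.vertex u)
    rw [extend_vertex] at h1
    have h2 := T.dist_vertex u y
    rw [hyw.extend_eq, SimpleGraph.dist_self, SimpleGraph.dist_eq_one_iff_adj.2 hyw.1] at h2
    have h3 := hyw.coord_mem.2
    rw [Metric.mem_closedBall, dist_comm] at hy
    have h4 := dist_triangle4 (T.vertex v) x y (T.vertex u)
    rw [dist_comm y] at h4
    have : (T.G.dist v u : ℝ) ≤ n := by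
      push_cast at h2
      linarith
    exact_mod_cast this
  · rw [dif_pos hyw.1]
    exact ⟨_, hyw.eq_edgePoint.symm⟩

/-! ## Busemann functions of trees -/

theorem busemann_lip (x y : Realization T.G) : T.busemann y - T.busemann x ≤ dist x y := by
  obtain ⟨γ, -, hγ⟩ := T.isBusemann
  refine le_of_tendsto ((hγ y).sub (hγ x)) (Eventually.of_forall fun t => ?_)
  change dist (γ t) y - t - (dist (γ t) x - t) ≤ _
  linarith [dist_triangle (γ t) x y]

/-- The height of a vertex. -/
def height (v : V) : ℝ := -T.busemann (T.vertex v)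

/-- For large `t` exactly one neighbour of `v` is closer to `γ t`; that neighbour is one higher and
the others are one lower. The distance differences are `±1`, so they equal their limits, the height
differences, from some time on. -/
theorem exists_parent (v : V) : ∃ p, T.G.Adj v p ∧ T.height p = T.height v + 1 ∧
    ∀ w, T.G.Adj v w → w ≠ p → T.height w = T.height v - 1 := by
  obtain ⟨γ, hiso, hγ⟩ := T.isBusemann
  -- Once `γ t` is at distance more than one from `v`, the vertex `v` is not an end of the edge
  -- containing it. Both ends then give the same difference, so an interior point may be replaced by
  -- an end `a`.
  have h1 : ∀ᶠ t in atTop, ∃ a, a ≠ v ∧ ∀ w, T.G.Adj v w →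
      dist (γ t) (T.vertex w) - dist (γ t) (T.vertex v) = T.G.dist w a - T.G.dist v a := by
    filter_upwards [eventually_gt_atTop (1 + dist (γ 0) (T.vertex v))] with t ht
    obtain ⟨a, c, hac⟩ := (γ t).exists_onEdge
    have h2 : 1 < dist (T.vertex v) (γ t) := by
      have h3 := dist_triangle (γ 0) (T.vertex v) (γ t)
      rw [hiso.dist_eq, Real.dist_eq, zero_sub, abs_neg] at h3
      linarith [le_abs_self t]
    have key : ∀ a c, (γ t).OnEdge a c → v ≠ a := by
      rintro a c hac rfl
      rw [T.dist_vertex, hac.extend_eq, SimpleGraph.dist_self,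
        SimpleGraph.dist_eq_one_iff_adj.2 hac.1] at h2
      push_cast at h2
      linarith [hac.coord_mem.2]
    refine ⟨a, (key a c hac).symm, fun w hw => ?_⟩
    rw [dist_comm, T.dist_vertex, dist_comm, T.dist_vertex, hac.extend_eq, hac.extend_eq]
    have h3 := dist_sub_dist_eq_of_adj T.isTree hw hac.1 (key a c hac) (key c a hac.symm)
    have h4 := hac.2.1
    rw [← eq_sub_iff_add_eq'] at h4
    rw [h4]
    linear_combination (1 - (γ t).coord a) * (-h3)
  have hlim : ∀ w, Tendsto (fun t => dist (γ t) (T.vertex w) - dist (γ t) (T.vertex v)) atTop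
      (𝓝 (T.height v - T.height w)) := fun w => by
    refine (((hγ (T.vertex w)).sub (hγ (T.vertex v))).congr fun t => ?_).trans_eq ?_
    · change dist (γ t) (T.vertex w) - t - (dist (γ t) (T.vertex v) - t) = _
      ring
    · simp only [height]
      ring_nf
  have hpm : ∀ a w, T.G.Adj v w → (T.G.dist w a : ℝ) - T.G.dist v a ∈ ({1, -1} : Set ℝ) := by
    intro a w hw
    have h2 := T.abs_dist_sub_dist_le a hw.symm
    rw [T.G.dist_comm, T.G.dist_comm (u := a)] at h2
    exact (abs_eq zero_le_one).1 h2
  have h2 : ∀ w, T.G.Adj v w → T.height v - T.height w ∈ ({1, -1} : Set ℝ) := fun w hw => by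
    refine (Set.toFinite ({1, -1} : Set ℝ)).isClosed.mem_of_tendsto (hlim w) ?_
    filter_upwards [h1] with t ⟨a, _, ha⟩
    rw [ha w hw]
    exact hpm a w hw
  have h3 : ∀ᶠ t in atTop, ∀ w ∈ T.G.neighborSet v,
      dist (dist (γ t) (T.vertex w) - dist (γ t) (T.vertex v)) (T.height v - T.height w) < 1 :=
    (eventually_all_finite (T.finite_neighborSet v)).2 fun w _ =>
      (hlim w).eventually (Metric.ball_mem_nhds _ one_pos)
  obtain ⟨t, ⟨a, hav, ha⟩, ht⟩ := (h1.and h3).exists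
  -- Two numbers in `{1, -1}` at distance less than one are equal.
  have h4 : ∀ w, T.G.Adj v w → T.height v - T.height w = T.G.dist w a - T.G.dist v a := by
    intro w hw
    have h5 := ht w hw
    rw [ha w hw, Real.dist_eq, abs_lt] at h5
    rcases h2 w hw with h6 | h6 <;> rcases hpm a w hw with h7 | h7 <;>
      rw [h6, h7] at h5 ⊢ <;> norm_num at h5
  obtain ⟨p, hp, hpa⟩ := exists_adj_dist_add_one T.isTree hav.symm
  refine ⟨p, hp, ?_, fun w hw hwp => ?_⟩
  · have h5 := h4 p hp
    rw [← hpa] at h5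
    push_cast at h5
    linarith
  · have h5 := h4 w hw
    rcases hpm a w hw with h6 | h6
    · rw [h6] at h5
      linarith
    · refine absurd (eq_of_adj_of_dist_add_one T.isTree hw hp ?_ hpa) hwp
      have h7 : (T.G.dist w a : ℝ) + 1 = T.G.dist v a := by
        have h6 : (T.G.dist w a : ℝ) - T.G.dist v a = -1 := h6
        linarith
      exact_mod_cast h7

/-- The neighbour of a vertex that is closer to the point at which the Busemann function is
based. -/
def parent (v : V) : V := (T.exists_parent v).choose

theorem adj_parent (v : V) : T.G.Adj v (T.parent v) := (T.exists_parent v).choose_spec.1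

theorem height_parent (v : V) : T.height (T.parent v) = T.height v + 1 :=
  (T.exists_parent v).choose_spec.2.1

theorem height_of_ne_parent {v w : V} (h : T.G.Adj v w) (hw : w ≠ T.parent v) :
    T.height w = T.height v - 1 :=
  (T.exists_parent v).choose_spec.2.2 w h hw

theorem eq_parent_or {v w : V} (h : T.G.Adj v w) : w = T.parent v ∨ v = T.parent w := by
  by_contra! hn
  have h1 := T.height_of_ne_parent h hn.1
  have h2 := T.height_of_ne_parent h.symm hn.2
  linarith

/-- The parent of `v` has the two distinct neighbours `v` and the grandparent of `v`. By regularity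
`v` also has a second neighbour, and this one is not its parent. -/
theorem exists_child (v : V) : ∃ w, T.parent w = v := by
  have h1 : T.parent (T.parent v) ≠ v := fun h => by
    have h2 := T.height_parent (T.parent v)
    rw [h, T.height_parent] at h2
    linarith
  have h2 : 1 < (T.G.neighborSet (T.parent v)).ncard :=
    (one_lt_ncard_iff (T.finite_neighborSet _)).2
      ⟨v, T.parent (T.parent v), (T.adj_parent v).symm, T.adj_parent _, h1.symm⟩
  rw [T.regular, ← T.regular v] at h2
  obtain ⟨w, hw, hne⟩ := exists_ne_of_one_lt_ncard h2 (T.parent v)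
  exact ⟨w, ((T.eq_parent_or hw).resolve_left hne).symm⟩

theorem exists_onEdge_parent (x : Realization T.G) : ∃ v, x.OnEdge v (T.parent v) := by
  obtain ⟨u, w, h⟩ := x.exists_onEdge
  rcases T.eq_parent_or h.1 with rfl | rfl
  · exact ⟨u, h⟩
  · exact ⟨w, h.symm⟩

theorem exists_onEdge_parent_lt (x : Realization T.G) :
    ∃ v, x.OnEdge v (T.parent v) ∧ x.coord (T.parent v) < 1 := by
  obtain ⟨v, h⟩ := T.exists_onEdge_parent x
  rcases h.coord_mem.2.lt_or_eq with h1 | h1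
  · exact ⟨v, h, h1⟩
  · have h2 : x = T.vertex (T.parent v) := by
      rw [← T.edgePoint_one_eq (T.adj_parent v)]
      exact h.ext (onEdge_edgePoint _ _) (by rw [coord_edgePoint, h1]; rfl)
    rw [h2]
    have h3 := T.onEdge_vertex (T.adj_parent (T.parent v))
    refine ⟨_, h3, ?_⟩
    have h4 := h3.2.1
    rw [coord_vertex] at h4
    linarith

/-- The heights of the ends of an edge differ by its length, so the Lipschitz bounds from both ends
leave only the affine value. -/
theorem neg_busemann_eq {x : Realization T.G} {v : V} (h : x.OnEdge v (T.parent v)) :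
    -T.busemann x = T.height v + x.coord (T.parent v) := by
  have h1 := T.dist_vertex v x
  rw [h.extend_eq, SimpleGraph.dist_self, SimpleGraph.dist_eq_one_iff_adj.2 h.1] at h1
  have h2 := T.dist_vertex (T.parent v) x
  rw [h.extend_eq, SimpleGraph.dist_self, SimpleGraph.dist_eq_one_iff_adj.2 h.1.symm] at h2
  have h3 := T.busemann_lip x (T.vertex v)
  have h4 := T.busemann_lip (T.vertex (T.parent v)) x
  rw [dist_comm] at h3
  have h5 := T.height_parent v
  have h6 := h.2.1
  push_cast at h1 h2
  simp only [height] at h5 ⊢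
  linarith

theorem dist_eq_of_onEdge {x y : Realization T.G} {v : V} (hx : x.OnEdge v (T.parent v))
    (hy : y.OnEdge v (T.parent v)) : dist x y = |-T.busemann x - -T.busemann y| := by
  apply le_antisymm
  · rw [T.neg_busemann_eq hx, T.neg_busemann_eq hy, add_sub_add_left_eq_sub]
    exact T.dist_le_of_onEdge hx hy
  · have h1 := T.busemann_lip x y
    have h2 := T.busemann_lip y x
    rw [dist_comm] at h2
    rw [abs_le]
    constructor <;> linarith

/-- Every edge is vertical, so a piecewise linear path is a vertical chain of at most the same
length. -/
theorem hasVerticalChains : HasVerticalChains (fun x : Realization T.G => -T.busemann x) := by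
  intro x y ε hε
  have h1 : edist x y < ENNReal.ofReal (dist x y + ε) := by
    rw [edist_dist]
    exact (ENNReal.ofReal_lt_ofReal_iff (by positivity)).2 (by linarith)
  obtain ⟨l, hl⟩ := iInf_lt_iff.1 h1
  obtain ⟨hp, hl⟩ := iInf_lt_iff.1 hl
  have key : ∀ {x y : Realization T.G} {l : ℝ≥0∞}, PLPath x y l → l ≠ ⊤ →
      ∃ l' ≤ l.toReal, VerticalChain (fun x : Realization T.G => -T.busemann x) x y l' := by
    intro x y l h
    induction h with
    | nil x => exact fun _ => ⟨0, by simp, .nil x⟩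
    | @cons x y z u v l hx hy _ ih =>
      intro hl
      obtain ⟨l', h1, h2⟩ := ih (ENNReal.add_ne_top.1 hl).2
      have h3 : dist x y = |-T.busemann x - -T.busemann y| := by
        rcases T.eq_parent_or hx.1 with rfl | rfl
        · exact T.dist_eq_of_onEdge hx hy
        · exact T.dist_eq_of_onEdge hx.symm hy.symm
      refine ⟨_, ?_, .cons h3 h2⟩
      rw [ENNReal.toReal_add (ENNReal.add_ne_top.1 hl).1 (ENNReal.add_ne_top.1 hl).2,
        ENNReal.toReal_ofReal (abs_nonneg _)]
      exact add_le_add (T.dist_le_of_onEdge hx.symm hy.symm) h1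
  obtain ⟨l', h2, h3⟩ := key hp (ne_top_of_lt hl)
  refine ⟨l', h2.trans ?_, h3⟩
  rw [← ENNReal.toReal_ofReal (show 0 ≤ dist x y + ε by positivity)]
  exact ENNReal.toReal_mono ENNReal.ofReal_ne_top hl.le

/-! ## Vertical lines in trees -/

/-- The ascending sequence of vertices through a given vertex. -/
def lineVertex (v : V) (i : ℤ) : V :=
  if 0 ≤ i then T.parent^[i.toNat] v
  else (fun w => (T.exists_child w).choose)^[(-i).toNat] v

theorem lineVertex_natCast (v : V) (n : ℕ) : T.lineVertex v n = T.parent^[n] v := by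
  simp [lineVertex]

theorem parent_lineVertex (v : V) (i : ℤ) :
    T.parent (T.lineVertex v i) = T.lineVertex v (i + 1) := by
  rcases le_or_gt 0 i with hi | hi
  · lift i to ℕ using hi
    rw [lineVertex_natCast, ← Nat.cast_succ, lineVertex_natCast, Function.iterate_succ_apply']
  · obtain ⟨n, rfl⟩ : ∃ n : ℕ, i = -(n : ℤ) - 1 := ⟨(-i - 1).toNat, by omega⟩
    have h1 : (-(-(n : ℤ) - 1)).toNat = n + 1 := by omega
    rw [lineVertex, if_neg (by omega), h1, Function.iterate_succ_apply',
      (T.exists_child _).choose_spec, sub_add_cancel]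
    rcases n.eq_zero_or_pos with rfl | hn
    · simp [lineVertex]
    · rw [lineVertex, if_neg (by omega), neg_neg, Int.toNat_natCast]

theorem height_lineVertex (v : V) (i : ℤ) : T.height (T.lineVertex v i) = T.height v + i := by
  induction i using Int.induction_on with
  | zero => simp [lineVertex]
  | succ n ih =>
    rw [← parent_lineVertex, height_parent, ih]
    push_cast
    ring
  | pred n ih =>
    have h := T.height_parent (T.lineVertex v (-n - 1))
    rw [parent_lineVertex, sub_add_cancel, ih] at h
    push_cast at h ⊢
    linarith

/-- The vertical line through a vertex. -/
def line (v : V) (t : ℝ) : Realization T.G :=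
  edgePoint (T.adj_parent (T.lineVertex v ⌊t - T.height v⌋))
    ⟨Int.fract (t - T.height v), Int.fract_nonneg _, (Int.fract_lt_one _).le⟩

theorem height_line (v : V) (t : ℝ) : -T.busemann (T.line v t) = t := by
  rw [line, T.neg_busemann_eq (onEdge_edgePoint _ _), coord_edgePoint, height_lineVertex]
  change T.height v + ⌊t - T.height v⌋ + Int.fract (t - T.height v) = t
  rw [add_assoc, Int.floor_add_fract]
  ring

theorem onEdge_line {v : V} {t : ℝ} {i : ℤ} (h1 : T.height v + i ≤ t)
    (h2 : t ≤ T.height v + i + 1) :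
    (T.line v t).OnEdge (T.lineVertex v i) (T.parent (T.lineVertex v i)) := by
  rcases h2.lt_or_eq with h2 | h2
  · have h3 : ⌊t - T.height v⌋ = i := Int.floor_eq_iff.2 ⟨by linarith, by linarith⟩
    rw [← h3]
    exact onEdge_edgePoint _ _
  · have h3 : t - T.height v = ((i + 1 : ℤ) : ℝ) := by push_cast; linarith
    have h4 : T.line v t = T.vertex (T.lineVertex v (i + 1)) := by
      rw [← T.edgePoint_zero_eq (T.adj_parent _)]
      simp only [line, h3, Int.floor_intCast, Int.fract_intCast]
      rfl
    rw [h4, ← parent_lineVertex]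
    exact (T.onEdge_vertex (T.adj_parent _).symm).symm

theorem isVertical_line (v : V) : IsVertical (fun x => -T.busemann x) (T.line v) := by
  refine ⟨Isometry.of_dist_eq fun s t => ?_, T.height_line v⟩
  have hle : ∀ s t, s ≤ t → dist (T.line v s) (T.line v t) ≤ t - s := by
    intro s t hst
    -- Induction on the number of vertices passed between `s` and `t`: within one edge the distance
    -- is the height difference.
    have key : ∀ (n : ℕ) (s : ℝ), s ≤ t → t ≤ T.height v + ⌊s - T.height v⌋ + 1 + n →
        dist (T.line v s) (T.line v t) ≤ t - s := by
      have base : ∀ s t : ℝ, s ≤ t → t ≤ T.height v + ⌊s - T.height v⌋ + 1 →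
          dist (T.line v s) (T.line v t) ≤ t - s := by
        intro s t hst ht
        have hf := Int.floor_le (s - T.height v)
        rw [T.dist_eq_of_onEdge (T.onEdge_line (v := v) (t := s) (i := ⌊s - T.height v⌋)
          (by linarith) (hst.trans ht)) (T.onEdge_line (by linarith) ht), height_line, height_line,
          abs_sub_comm, abs_of_nonneg (by linarith)]
      intro n
      induction n with
      | zero => exact fun s hs ht => base s t hs (by simpa using ht)
      | succ n ih =>
        intro s hs ht
        set m : ℝ := T.height v + ⌊s - T.height v⌋ + 1 with hm
        rcases le_total t m with h | h
        · exact base s t hs h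
        · have h1 : s ≤ m := by linarith [(Int.lt_floor_add_one (s - T.height v)).le]
          have h2 : ⌊m - T.height v⌋ = ⌊s - T.height v⌋ + 1 := by
            rw [hm, show T.height v + ⌊s - T.height v⌋ + 1 - T.height v =
              ((⌊s - T.height v⌋ + 1 : ℤ) : ℝ) by push_cast; ring, Int.floor_intCast]
          have h3 := ih m h (by rw [h2]; push_cast at ht ⊢; linarith)
          linarith [base s m h1 le_rfl, dist_triangle (T.line v s) (T.line v m) (T.line v t)]
    obtain ⟨n, hn⟩ := exists_nat_ge (t - (T.height v + ⌊s - T.height v⌋ + 1))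
    exact key n s hst (by linarith)
  have hge := T.busemann_lip (T.line v s) (T.line v t)
  have hge' := T.busemann_lip (T.line v t) (T.line v s)
  have h1 := T.height_line v s
  have h2 := T.height_line v t
  rw [dist_comm] at hge'
  rw [Real.dist_eq]
  rcases le_total s t with h | h
  · rw [abs_sub_comm, abs_of_nonneg (by linarith)]
    linarith [hle s t h]
  · rw [abs_of_nonneg (by linarith)]
    have := hle t s h
    rw [dist_comm] at this
    linarith

theorem line_eq {x : Realization T.G} {v : V} (h : x.OnEdge v (T.parent v))
    (h1 : x.coord (T.parent v) < 1) {w : V} {i : ℤ} (hw : T.lineVertex w i = v) :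
    T.line w (-T.busemann x) = x := by
  have h2 : -T.busemann x = T.height w + i + x.coord (T.parent v) := by
    rw [T.neg_busemann_eq h, ← hw, height_lineVertex]
  have h3 := T.onEdge_line (v := w) (t := -T.busemann x) (i := i)
    (by linarith [x.nonneg (T.parent v)]) (by linarith)
  rw [hw] at h3
  refine h3.ext h ?_
  have h4 := (T.neg_busemann_eq h3).symm.trans
    ((T.height_line w _).trans (T.neg_busemann_eq h))
  linarith

theorem height_sub_height_le (v w : V) : T.height w - T.height v ≤ T.G.dist v w := by
  have h := T.busemann_lip (T.vertex w) (T.vertex v)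
  rw [dist_comm, dist_vertex, extend_vertex] at h
  simp only [height]
  linarith

/-- Each step of a path gains at most one in height, so a path gaining its full length passes to the
parent at every step. -/
theorem eq_iterate_parent {n : ℕ} : ∀ {v w : V}, T.G.dist v w = n →
    T.height w = T.height v + n → w = T.parent^[n] v := by
  induction n with
  | zero => exact fun h _ => (T.isTree.connected.dist_eq_zero_iff.1 h).symm
  | succ n ih =>
    intro v w h1 h2
    have hne : v ≠ w := by
      rintro rfl
      rw [SimpleGraph.dist_self] at h1
      omega
    obtain ⟨z, hz, hzw⟩ := exists_adj_dist_add_one T.isTree hne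
    have h3 : T.G.dist z w = n := by omega
    have h4 := T.height_sub_height_le z w
    rw [h3, h2] at h4
    push_cast at h4
    have h5 : z = T.parent v := by
      by_contra hn
      linarith [T.height_of_ne_parent hz hn]
    subst h5
    rw [Function.iterate_succ_apply]
    exact ih h3 (by rw [h2, height_parent]; push_cast; ring)

/-- On the edge of `y` the distance to `v` is an average of the values at the two ends, each of
which is at least the height difference. Equality of the averages forces equality at the lower end
`a`, whose weight is positive since `y` is not the upper end. -/
theorem eq_line_of_dist_eq {v : V} {y : Realization T.G}
    (h : dist (T.vertex v) y = -T.busemann y - T.height v) : y = T.line v (-T.busemann y) := by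
  obtain ⟨a, ha, ha1⟩ := T.exists_onEdge_parent_lt y
  rw [T.dist_vertex, ha.extend_eq, T.neg_busemann_eq ha] at h
  have h1 := T.height_sub_height_le v a
  have h2 := T.height_sub_height_le v (T.parent a)
  rw [height_parent] at h2
  have h3 := ha.2.1
  have h4 : T.height a = T.height v + T.G.dist v a := by
    have h5 : y.coord a * ((T.G.dist v a : ℝ) - (T.height a - T.height v)) +
        y.coord (T.parent a) * (T.G.dist v (T.parent a) - (T.height a + 1 - T.height v)) = 0 := by
      rw [← eq_sub_iff_add_eq'] at h3
      linear_combination h + (T.height v - T.height a) * ha.2.1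
    have h6 := mul_nonneg (y.nonneg a) (sub_nonneg.2 h1)
    have h7 := mul_nonneg (y.nonneg (T.parent a)) (sub_nonneg.2 h2)
    have h8 : y.coord a * ((T.G.dist v a : ℝ) - (T.height a - T.height v)) = 0 := by linarith
    rcases mul_eq_zero.1 h8 with h9 | h9
    · linarith
    · linarith
  have h5 := T.eq_iterate_parent rfl h4
  rw [← lineVertex_natCast] at h5
  exact (T.line_eq ha ha1 h5.symm).symm

theorem lineSpace : LineSpace (Realization T.G) (fun x => -T.busemann x) := by
  have hline : ∀ x, ∃ v, T.line v (-T.busemann x) = x ∧ T.height v ≤ -T.busemann x := fun x => by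
    obtain ⟨v, hv, h1⟩ := T.exists_onEdge_parent_lt x
    refine ⟨v, T.line_eq hv h1 (i := 0) (by simp [lineVertex]), ?_⟩
    rw [T.neg_busemann_eq hv]
    linarith [x.nonneg (T.parent v)]
  have hlip : ∀ x y : Realization T.G, -T.busemann y - -T.busemann x ≤ dist x y := fun x y => by
    have := T.busemann_lip y x
    rw [dist_comm] at this
    linarith
  refine ⟨hlip, fun x => ?_, fun x y z h1 h2 h3 => ?_⟩
  · obtain ⟨v, hv, -⟩ := hline x
    exact ⟨_, T.isVertical_line v, hv⟩
  -- For upward uniqueness, the segment is prolonged downwards to the vertex `v` just below `x`. Any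
  -- point vertically above `x` is vertically above `v` and so on the chosen line through `v`.
  · obtain ⟨v, hv, hle⟩ := hline x
    have h4 : dist (T.vertex v) x = -T.busemann x - T.height v := by
      have h5 := T.line_eq (T.onEdge_vertex (T.adj_parent v)) (by
        have h6 := (T.onEdge_vertex (T.adj_parent v)).2.1
        rw [coord_vertex] at h6
        linarith) (w := v) (i := 0) (by simp [lineVertex])
      change T.line v (T.height v) = _ at h5
      conv_lhs => rw [← h5, ← hv]
      rw [(T.isVertical_line v).1.dist_eq, Real.dist_eq, abs_sub_comm, abs_of_nonneg (by linarith)]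
    have h5 : ∀ y, dist x y = -T.busemann y - -T.busemann x → y = T.line v (-T.busemann y) := by
      intro y hy
      refine T.eq_line_of_dist_eq (le_antisymm ?_ (hlip (T.vertex v) y))
      linarith [dist_triangle (T.vertex v) x y]
    rw [h5 y h1, h5 z h2, h3]

end RegularTree

/-! ## Homogeneous length spaces are proper -/

/-- Compactness spreads from the radius `n r/4` to `(n + 1) r/4`: the smaller ball is covered by
finitely many balls of radius `r/2`, each point of the larger one is within `r/2` of the smaller,
and closed balls of radius `r` are compact. -/
theorem properSpace_of_uniform_of_length {X : Type*} [MetricSpace X] {r : ℝ} (hr : 0 < r)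
    (hc : ∀ x : X, IsCompact (Metric.closedBall x r))
    (hl : ∀ (x y : X) (a b : ℝ), 0 ≤ a → dist x y < a + b → 0 < b →
      ∃ z, dist x z ≤ a ∧ dist z y < b) : ProperSpace X := by
  refine ⟨fun x R => ?_⟩
  have key : ∀ n : ℕ, IsCompact (Metric.closedBall x (n * (r / 4))) := by
    intro n
    induction n with
    | zero => simp
    | succ n ih =>
      obtain ⟨t, -, hf, ht⟩ := ih.finite_cover_balls (half_pos hr)
      refine (hf.isCompact_biUnion fun z _ => hc z).of_isClosed_subset Metric.isClosed_closedBall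
        fun y hy => ?_
      rw [Metric.mem_closedBall, dist_comm] at hy
      push_cast at hy
      obtain ⟨z, hz, hzy⟩ := hl x y (n * (r / 4)) (r / 2) (by positivity) (by linarith)
        (half_pos hr)
      rw [dist_comm] at hz
      obtain ⟨w, hw, hzw⟩ := mem_iUnion₂.1 (ht (Metric.mem_closedBall.2 hz))
      refine mem_iUnion₂.2 ⟨w, hw, ?_⟩
      rw [Metric.mem_ball] at hzw
      rw [Metric.mem_closedBall, dist_comm, dist_comm y] at *
      linarith [dist_triangle w z y, dist_comm w z]
  obtain ⟨n, hn⟩ := exists_nat_ge (R / (r / 4))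
  rw [div_le_iff₀ (by positivity)] at hn
  exact (key n).of_isClosed_subset Metric.isClosed_closedBall (Metric.closedBall_subset_closedBall hn)

/-! ## Exponential decay of linear flows -/

section Decay

/-- Variation of constants: `e^{μt} y` has derivative `e^{μt} g`, of norm at most `C e^{(Re μ -
l)t}`. Integration and multiplication by `e^{-μt}` give the decay rate of `g` again, since `l < Re
μ`. -/
theorem norm_le_of_hasDerivAt_neg_smul {W : Type*} [NormedAddCommGroup W] [NormedSpace ℂ W]
    {μ : ℂ} {l C : ℝ} (hl : l < μ.re) {y g : ℝ → W}
    (hy : ∀ t, HasDerivAt y (-(μ • y t) + g t) t)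
    (hg : ∀ t, 0 ≤ t → ‖g t‖ ≤ C * Real.exp (-l * t)) :
    ∃ C' : ℝ, ∀ t, 0 ≤ t → ‖y t‖ ≤ C' * Real.exp (-l * t) := by
  have hC : 0 ≤ C := by
    have := (norm_nonneg _).trans (hg 0 le_rfl)
    simpa using this
  have hd : 0 < μ.re - l := sub_pos.2 hl
  let z : ℝ → W := fun t => Complex.exp (μ * t) • y t
  have he : ∀ t : ℝ, HasDerivAt (fun t : ℝ => Complex.exp (μ * t)) (Complex.exp (μ * t) * μ) t := by
    intro t
    have h1 : HasDerivAt (fun t : ℝ => μ * (t : ℂ)) μ t := by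
      simpa using (Complex.ofRealCLM.hasDerivAt (x := t)).const_mul μ
    exact h1.cexp
  have hz : ∀ t : ℝ, HasDerivAt z (Complex.exp (μ * t) • g t) t := by
    intro t
    refine ((he t).smul (hy t)).congr_deriv ?_
    module
  have hn : ∀ t : ℝ, ‖Complex.exp (μ * t)‖ = Real.exp (μ.re * t) := fun t => by
    rw [Complex.norm_exp]
    simp
  let B : ℝ → ℝ := fun t => ‖z 0‖ + C / (μ.re - l) * Real.exp ((μ.re - l) * t)
  have hB : ∀ t, HasDerivAt B (C * Real.exp ((μ.re - l) * t)) t := by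
    intro t
    have h1 : HasDerivAt (fun t : ℝ => (μ.re - l) * t) (μ.re - l) t := by
      simpa using (hasDerivAt_id t).const_mul (μ.re - l)
    refine ((h1.exp.const_mul (C / (μ.re - l))).const_add ‖z 0‖).congr_deriv ?_
    field_simp
  have hzB : ∀ t, 0 ≤ t → ‖z t‖ ≤ B t := by
    intro t ht
    refine image_norm_le_of_norm_deriv_right_le_deriv_boundary (a := 0) (b := t)
      (f := z) (f' := fun t : ℝ => Complex.exp (μ * t) • g t)
      (fun s _ => (hz s).continuousAt.continuousWithinAt) (fun s _ => (hz s).hasDerivWithinAt)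
      (B := B) (B' := fun t => C * Real.exp ((μ.re - l) * t)) ?_ hB ?_ ⟨ht, le_rfl⟩
    · simp only [B, mul_zero, Real.exp_zero, mul_one]
      exact le_add_of_nonneg_right (div_nonneg hC hd.le)
    · intro s hs
      rw [norm_smul, hn]
      refine (mul_le_mul_of_nonneg_left (hg s hs.1) (Real.exp_pos _).le).trans_eq ?_
      rw [mul_left_comm, ← Real.exp_add]
      ring_nf
  refine ⟨‖z 0‖ + C / (μ.re - l), fun t ht => ?_⟩
  have h1 : ‖y t‖ = Real.exp (-μ.re * t) * ‖z t‖ := by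
    simp only [z]
    rw [norm_smul, hn, ← mul_assoc, ← Real.exp_add]
    simp
  rw [h1]
  have h2 : 1 ≤ Real.exp ((μ.re - l) * t) := Real.one_le_exp (by positivity)
  calc Real.exp (-μ.re * t) * ‖z t‖
      ≤ Real.exp (-μ.re * t) * ((‖z 0‖ + C / (μ.re - l)) * Real.exp ((μ.re - l) * t)) := by
        gcongr
        refine (hzB t ht).trans ?_
        simp only [B]
        nlinarith [norm_nonneg (z 0)]
    _ = _ := by
      rw [mul_left_comm, ← Real.exp_add]
      ring_nf

/-- Induction on the linear factors instead of a Jordan form: `z = T y - μ y` solves the same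
equation and is killed by the remaining factors, while `y' = -μ y - z` is a scalar equation with
decaying source. -/
theorem norm_le_of_hasDerivAt_neg {W : Type*} [NormedAddCommGroup W] [NormedSpace ℂ W]
    (T : W →L[ℂ] W) {l : ℝ} (s : Multiset ℂ) (hs : ∀ μ ∈ s, l < μ.re) :
    ∀ {y : ℝ → W}, (∀ t, HasDerivAt y (-(T (y t))) t) →
      (∀ t, Polynomial.aeval (T : W →ₗ[ℂ] W) (s.map fun μ => Polynomial.X - Polynomial.C μ).prod
        (y t) = 0) → ∃ C' : ℝ, ∀ t, 0 ≤ t → ‖y t‖ ≤ C' * Real.exp (-l * t) := by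
  induction s using Multiset.induction_on with
  | empty =>
    intro y _ h0
    exact ⟨0, fun t _ => by
      have := h0 t
      simp only [Multiset.map_zero, Multiset.prod_zero, map_one, Module.End.one_apply] at this
      simp [this]⟩
  | cons μ s ih =>
    intro y hy h0
    let z : ℝ → W := fun t => T (y t) - μ • y t
    have hz : ∀ t, HasDerivAt z (-(T (z t))) t := fun t => by
      refine (((T.restrictScalars ℝ).hasFDerivAt.comp_hasDerivAt t (hy t)).sub
        ((hy t).const_smul μ)).congr_deriv ?_
      simp [z]
      abel
    obtain ⟨C, hC⟩ := ih (fun ν hν => hs ν (Multiset.mem_cons_of_mem hν)) hz (fun t => by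
      have := h0 t
      rw [Multiset.map_cons, Multiset.prod_cons, mul_comm, map_mul, Module.End.mul_apply] at this
      simpa [z] using this)
    refine norm_le_of_hasDerivAt_neg_smul (hs μ (Multiset.mem_cons_self _ _)) (g := fun t => -z t)
      (fun t => (hy t).congr_deriv ?_) (C := C) fun t ht => by rw [norm_neg]; exact hC t ht
    simp [z]
    abel

theorem hasDerivAt_exp_neg_smul {E : Type*} [NormedAddCommGroup E] [NormedSpace ℝ E]
    [CompleteSpace E] (D : E →L[ℝ] E) (x : E) (t : ℝ) :
    HasDerivAt (fun t : ℝ => NormedSpace.exp (-t • D) x) (-(D (NormedSpace.exp (-t • D) x))) t := by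
  have h1 := (hasDerivAt_exp_smul_const' (𝕂 := ℝ) D (-t)).scomp t (hasDerivAt_neg t)
  have h2 := (ContinuousLinearMap.apply ℝ E x).hasFDerivAt.comp_hasDerivAt t h1
  refine h2.congr_deriv ?_
  simp

/-- In complex coordinates the characteristic polynomial splits and annihilates `D` by
Cayley–Hamilton, so every orbit decays at a rate `l` below all real parts. The uniform boundedness
principle turns this into a bound on the operator norm. -/
theorem exists_norm_exp_neg_le {E : Type*} [NormedAddCommGroup E] [NormedSpace ℝ E]
    [FiniteDimensional ℝ E] (D : E →L[ℝ] E)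
    (hD : ∀ z : ℂ, ((D : E →ₗ[ℝ] E).charpoly.map (algebraMap ℝ ℂ)).IsRoot z → 0 < z.re) :
    ∃ K l : ℝ, 0 < l ∧ ∀ t : ℝ, 0 ≤ t → ‖NormedSpace.exp (-t • D)‖ ≤ K * Real.exp (-l * t) := by
  classical
  have : CompleteSpace E := FiniteDimensional.complete ℝ E
  let p := (D : E →ₗ[ℝ] E).charpoly.map (algebraMap ℝ ℂ)
  have hp : p.Monic := (LinearMap.charpoly_monic _).map _
  obtain ⟨l, hl, hlr⟩ : ∃ l : ℝ, 0 < l ∧ ∀ μ ∈ p.roots, l < μ.re := by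
    have h1 : ∀ᶠ l : ℝ in 𝓝[>] 0, ∀ μ ∈ p.roots.toFinset, l < μ.re := by
      refine (Finset.eventually_all _).2 fun μ hμ => ?_
      exact nhdsWithin_le_nhds (gt_mem_nhds (hD μ (Polynomial.isRoot_of_mem_roots
        (Multiset.mem_toFinset.1 hμ))))
    obtain ⟨l, h2, h3⟩ := (h1.and self_mem_nhdsWithin).exists
    exact ⟨l, h3, fun μ hμ => h2 μ (Multiset.mem_toFinset.2 hμ)⟩
  let b := Module.finBasis ℝ E
  let A := LinearMap.toMatrix b b (D : E →ₗ[ℝ] E)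
  let T : (Fin (Module.finrank ℝ E) → ℂ) →L[ℂ] (Fin (Module.finrank ℝ E) → ℂ) :=
    LinearMap.toContinuousLinearMap (Matrix.toLin' (A.map (algebraMap ℝ ℂ)))
  let ι : E →L[ℝ] (Fin (Module.finrank ℝ E) → ℂ) := LinearMap.toContinuousLinearMap
    { toFun := fun x i => (b.repr x i : ℂ)
      map_add' := fun x y => by ext i; simp
      map_smul' := fun c x => by ext i; simp }
  have hι : ∀ x, ι (D x) = T (ι x) := by
    intro x
    ext i
    have h1 : b.repr (D x) i = (A.mulVec (b.repr x)) i :=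
      congrFun (LinearMap.toMatrix_mulVec_repr b b (D : E →ₗ[ℝ] E) x).symm i
    change ((b.repr (D x) i : ℝ) : ℂ) = ((A.map (algebraMap ℝ ℂ)).mulVec (ι x)) i
    rw [h1]
    simp only [Matrix.mulVec, dotProduct, Complex.ofReal_sum, Complex.ofReal_mul]
    rfl
  have hT : Polynomial.aeval (T : (Fin (Module.finrank ℝ E) → ℂ) →ₗ[ℂ] (Fin (Module.finrank ℝ E) → ℂ))
      (p.roots.map fun μ => Polynomial.X - Polynomial.C μ).prod = 0 := by
    rw [← (IsAlgClosed.splits p).eq_prod_roots_of_monic hp]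
    have h1 : p = (T : (Fin (Module.finrank ℝ E) → ℂ) →ₗ[ℂ] (Fin (Module.finrank ℝ E) → ℂ)).charpoly := by
      change _ = (Matrix.toLin' (A.map (algebraMap ℝ ℂ))).charpoly
      rw [Matrix.charpoly_toLin', Matrix.charpoly_map, LinearMap.charpoly_toMatrix]
    rw [h1]
    exact LinearMap.aeval_self_charpoly _
  obtain ⟨K, -, hK⟩ := (ι : E →ₗ[ℝ] (Fin (Module.finrank ℝ E) → ℂ)).exists_antilipschitzWith
    (by
      rw [LinearMap.ker_eq_bot]
      intro x y hxy
      refine b.repr.injective (Finsupp.ext fun i => ?_)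
      have := congrFun hxy i
      exact Complex.ofReal_injective this)
  have hpt : ∀ x : E, ∃ C : ℝ, ∀ t : Ici (0 : ℝ),
      ‖(Real.exp (l * t) • NormedSpace.exp (-(t : ℝ) • D)) x‖ ≤ C := by
    intro x
    obtain ⟨C, hC⟩ := norm_le_of_hasDerivAt_neg T (l := l) p.roots hlr
      (y := fun t => ι (NormedSpace.exp (-t • D) x)) (fun t => by
        refine (ι.hasFDerivAt.comp_hasDerivAt t (hasDerivAt_exp_neg_smul D x t)).congr_deriv ?_
        rw [map_neg, hι]) (fun t => by rw [hT]; rfl)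
    refine ⟨K * C, fun t => ?_⟩
    have h1 := hK.le_mul_norm (ι.map_zero) (NormedSpace.exp (-(t : ℝ) • D) x)
    have h2 := hC t t.2
    rw [smul_apply, norm_smul, Real.norm_of_nonneg (Real.exp_pos _).le]
    calc Real.exp (l * t) * ‖NormedSpace.exp (-(t : ℝ) • D) x‖
        ≤ Real.exp (l * t) * (K * (C * Real.exp (-l * t))) := by
          refine mul_le_mul_of_nonneg_left (h1.trans ?_) (Real.exp_pos _).le
          exact mul_le_mul_of_nonneg_left h2 K.coe_nonneg
      _ = K * C * (Real.exp (l * t) * Real.exp (-l * t)) := by ring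
      _ = K * C := by
        rw [← Real.exp_add]
        simp
  obtain ⟨C, hC⟩ := banach_steinhaus hpt
  refine ⟨C, l, hl, fun t ht => ?_⟩
  have h1 := hC ⟨t, ht⟩
  rw [norm_smul, Real.norm_of_nonneg (Real.exp_pos _).le] at h1
  calc ‖NormedSpace.exp (-t • D)‖
      = Real.exp (l * t) * ‖NormedSpace.exp (-t • D)‖ * Real.exp (-l * t) := by
        rw [mul_right_comm, ← Real.exp_add]
        simp
    _ ≤ _ := by gcongr

end Decay

/-! ## Paths and integral curves in manifolds -/

section Manifolds

variable {E : Type*} [NormedAddCommGroup E] [NormedSpace ℝ E]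
  {B : Type*} [TopologicalSpace B] {I : ModelWithCorners ℝ E B}
  {M : Type*} [TopologicalSpace M] [ChartedSpace B M]
  {E' : Type*} [NormedAddCommGroup E'] [NormedSpace ℝ E']
  {B' : Type*} [TopologicalSpace B'] {I' : ModelWithCorners ℝ E' B'}
  {M' : Type*} [TopologicalSpace M'] [ChartedSpace B' M']

/-- Chain rule for lengths. All metric estimates on the group come from bounding the differential of
a map along a path. -/
theorem riemannianEDist_comp_le [∀ x : M', ENorm (TangentSpace I' x)]
    [∀ x : M', ENormSMulClass ℝ (TangentSpace I' x)] {φ : M → M'} (hφ : ContMDiff I I' 1 φ)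
    {γ : ℝ → M} {a b : ℝ} (hγ : ContMDiffOn 𝓘(ℝ, ℝ) I 1 γ (Icc a b)) (hab : a ≤ b) :
    Manifold.riemannianEDist I' (φ (γ a)) (φ (γ b)) ≤
      ∫⁻ t in Icc a b, ‖(mfderiv I I' φ (γ t) (mfderivWithin 𝓘(ℝ, ℝ) I γ (Icc a b) t 1) :
        TangentSpace I' (φ (γ t)))‖ₑ := by
  rcases hab.eq_or_lt with rfl | hlt
  · rw [Manifold.riemannianEDist_self]
    exact bot_le
  refine (Manifold.riemannianEDist_le_pathELength (γ := φ ∘ γ) (hφ.comp_contMDiffOn hγ) rfl rfl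
    hab).trans_eq ?_
  rw [Manifold.pathELength_eq_lintegral_mfderivWithin_Icc]
  refine MeasureTheory.setLIntegral_congr_fun measurableSet_Icc fun t ht => ?_
  have h1 : mfderivWithin 𝓘(ℝ, ℝ) I' (φ ∘ γ) (Icc a b) t =
      (mfderiv I I' φ (γ t)).comp (mfderivWithin 𝓘(ℝ, ℝ) I γ (Icc a b) t) :=
    mfderiv_comp_mfderivWithin t (hφ.mdifferentiableAt one_ne_zero)
      (hγ.mdifferentiableOn one_ne_zero t ht)
      (uniqueMDiffWithinAt_iff_uniqueDiffWithinAt.2 (uniqueDiffOn_Icc hlt _ ht))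
  simp only [h1]
  rfl

/-- In a chart the derivative of the curve is the coordinate expression of the field along the
curve, which is continuous. -/
theorem contMDiff_one_of_isMIntegralCurve [IsManifold I 1 M] [BoundarylessManifold I M]
    {v : (x : M) → TangentSpace I x}
    (hv : Continuous (fun x => (⟨x, v x⟩ : TangentBundle I M))) {γ : ℝ → M}
    (hγ : IsMIntegralCurve γ v) : ContMDiff 𝓘(ℝ, ℝ) I 1 γ := by
  intro t₀
  rw [contMDiffAt_iff_target]
  refine ⟨hγ.continuous.continuousAt, ?_⟩
  rw [contMDiffAt_iff_contDiffAt, contDiffAt_one_iff]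
  have h1 := (hγ.isMIntegralCurveAt t₀).eventually_hasDerivAt
  have h2 : ∀ᶠ t in 𝓝 t₀, γ t ∈ (chartAt B (γ t₀)).source :=
    hγ.continuous.continuousAt (chart_source_mem_nhds B (γ t₀))
  refine ⟨fun t => (1 : ℝ →L[ℝ] ℝ).smulRight (tangentCoordChange I (γ t) (γ t₀) (γ t) (v (γ t))),
    _, h1.and h2, ?_, fun t ht => ht.1.hasFDerivAt⟩
  intro t ht
  have h3 : ContinuousWithinAt (fun t => tangentCoordChange I (γ t) (γ t₀) (γ t) (v (γ t)))
      {t | γ t ∈ (chartAt B (γ t₀)).source} t := by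
    have h4 : ContinuousAt (fun t => (trivializationAt E (TangentSpace I) (γ t₀)
        (⟨γ t, v (γ t)⟩ : TangentBundle I M)).2) t := by
      refine continuous_snd.continuousAt.comp (ContinuousAt.comp ?_
        (hv.comp hγ.continuous).continuousAt)
      refine (trivializationAt E (TangentSpace I) (γ t₀)).continuousAt ?_
      rw [Bundle.Trivialization.mem_source]
      exact ht.2
    exact h4.continuousWithinAt
  have h5 := (ContinuousLinearMap.smulRightL ℝ ℝ E (1 : ℝ →L[ℝ] ℝ)).continuous.continuousAt.comp_continuousWithinAt h3
  exact h5.mono fun s hs => hs.2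

end Manifolds

/-! ## Left translations of Heintze groups -/

namespace HeintzeGroup

set_option linter.unusedSectionVars false

variable {E N : Type*} [NormedAddCommGroup E] [NormedSpace ℝ E] [FiniteDimensional ℝ E]
  [TopologicalSpace N] [ChartedSpace E N] [Group N] [LieGroup 𝓘(ℝ, E) ∞ N]
  (H : HeintzeGroup E N)

local notation "𝓜" => ModelWithCorners.prod 𝓘(ℝ, E) 𝓘(ℝ, ℝ)

/-- The action of `ℝ` on `N`. -/
def act (t : ℝ) : N ≃* N := H.α (Multiplicative.ofAdd t)

theorem act_zero (n : N) : H.act 0 n = n := by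
  rw [act, ofAdd_zero, map_one]
  rfl

theorem act_add (s t : ℝ) (n : N) : H.act (s + t) n = H.act s (H.act t n) := by
  rw [act, ofAdd_add, map_mul]
  rfl

theorem act_neg_act (s : ℝ) (n : N) : H.act (-s) (H.act s n) = n := by
  rw [← act_add, neg_add_cancel, act_zero]

theorem act_act_neg (s : ℝ) (n : N) : H.act s (H.act (-s) n) = n := by
  rw [← act_add, add_neg_cancel, act_zero]

theorem contMDiff_act (t : ℝ) : ContMDiff 𝓘(ℝ, E) 𝓘(ℝ, E) ∞ (H.act t) :=
  H.α_smooth (Multiplicative.ofAdd t)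

theorem continuous_act (t : ℝ) : Continuous (H.act t) := (H.contMDiff_act t).continuous

/-- Left translation by `p` in the group `N ⋊_α ℝ`. -/
def lmul (p q : N × ℝ) : N × ℝ := (p.1 * H.act p.2 q.1, p.2 + q.2)

theorem leftInv_apply (p q : N × ℝ) :
    H.leftInv p q = (H.act (-p.2) (p.1⁻¹ * q.1), q.2 - p.2) := by
  refine Prod.ext ?_ ?_
  · change (H.α (Multiplicative.ofAdd p.2)⁻¹) p.1⁻¹ *
      (H.α (Multiplicative.ofAdd p.2)⁻¹) q.1 = _
    rw [← map_mul]
    rfl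
  · change -p.2 + q.2 = _
    ring

theorem leftInv_lmul (p q : N × ℝ) : H.leftInv p (H.lmul p q) = q := by
  rw [leftInv_apply]
  refine Prod.ext ?_ ?_
  · simp [lmul, act_neg_act]
  · simp [lmul]

theorem lmul_leftInv (p q : N × ℝ) : H.lmul p (H.leftInv p q) = q := by
  rw [leftInv_apply]
  refine Prod.ext ?_ ?_
  · simp [lmul, act_act_neg, -map_mul]
  · simp [lmul]

theorem leftInv_self (p : N × ℝ) : H.leftInv p p = (1, 0) := by
  rw [leftInv_apply]
  simp

theorem lmul_one (p : N × ℝ) : H.lmul p (1, 0) = p := by simp [lmul]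

theorem lmul_lmul (p q r : N × ℝ) : H.lmul p (H.lmul q r) = H.lmul (H.lmul p q) r := by
  simp [lmul, act_add, mul_assoc, add_assoc]

theorem leftInv_lmul_lmul (g p q : N × ℝ) :
    H.leftInv (H.lmul g p) (H.lmul g q) = H.leftInv p q := by
  rw [← H.leftInv_lmul (H.lmul g p) (H.leftInv p q), ← lmul_lmul, lmul_leftInv]

theorem contMDiff_leftInv (p : N × ℝ) : ContMDiff 𝓜 𝓜 ∞ (H.leftInv p) := by
  have h : H.leftInv p = Prod.map (fun n => H.act (-p.2) (p.1⁻¹ * n)) (fun t => t - p.2) := by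
    ext q : 1
    exact H.leftInv_apply p q
  rw [h]
  refine ((H.contMDiff_act _).comp contMDiff_mul_left).prodMap ?_
  rw [contMDiff_iff_contDiff]
  fun_prop

theorem contMDiff_lmul (p : N × ℝ) : ContMDiff 𝓜 𝓜 ∞ (H.lmul p) := by
  have h : H.lmul p = Prod.map (fun n => p.1 * H.act p.2 n) (fun t => p.2 + t) := rfl
  rw [h]
  refine (contMDiff_mul_left.comp (H.contMDiff_act _)).prodMap ?_
  rw [contMDiff_iff_contDiff]
  fun_prop

/-- Translation of tangent vectors to the identity, as a continuous linear map. -/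
def toLie (p : N × ℝ) : E × ℝ →L[ℝ] E × ℝ := mfderiv 𝓜 𝓜 (H.leftInv p) p

theorem mdifferentiable_leftInv (p q : N × ℝ) : MDifferentiableAt 𝓜 𝓜 (H.leftInv p) q :=
  (H.contMDiff_leftInv p).mdifferentiableAt (by simp)

theorem mdifferentiable_lmul (p q : N × ℝ) : MDifferentiableAt 𝓜 𝓜 (H.lmul p) q :=
  (H.contMDiff_lmul p).mdifferentiableAt (by simp)

/-- The tangent vector at `p` corresponding to a vector at the identity. -/
def ofLie (p : N × ℝ) : E × ℝ →L[ℝ] E × ℝ := mfderiv 𝓜 𝓜 (H.lmul p) (1, 0)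

theorem toLie_ofLie (p : N × ℝ) (u : E × ℝ) : H.toLie p (H.ofLie p u) = u := by
  have h1 := mfderiv_comp (I := 𝓜) (I' := 𝓜) (I'' := 𝓜) (1, 0)
    (H.mdifferentiable_leftInv p (H.lmul p (1, 0))) (H.mdifferentiable_lmul p (1, 0))
  have h2 : H.leftInv p ∘ H.lmul p = id := funext (H.leftInv_lmul p)
  rw [h2, mfderiv_id] at h1
  have h3 := congrArg (fun L : E × ℝ →L[ℝ] E × ℝ => L u) h1
  -- The point `H.lmul p (1, 0)` is only propositionally equal to `p`, so the differential is
  -- transported along the equality; the same device recurs below.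
  have h4 : ∀ q, q = p → (mfderiv 𝓜 𝓜 (H.leftInv p) q : E × ℝ →L[ℝ] E × ℝ) = H.toLie p := by
    rintro q rfl
    rfl
  refine Eq.trans ?_ h3.symm
  rw [← h4 _ (H.lmul_one p)]
  rfl

theorem ofLie_toLie (p : N × ℝ) (u : E × ℝ) : H.ofLie p (H.toLie p u) = u := by
  have h1 := mfderiv_comp (I := 𝓜) (I' := 𝓜) (I'' := 𝓜) p
    (H.mdifferentiable_lmul p (H.leftInv p p)) (H.mdifferentiable_leftInv p p)
  have h2 : H.lmul p ∘ H.leftInv p = id := funext (H.lmul_leftInv p)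
  rw [h2, mfderiv_id] at h1
  have h3 := congrArg (fun L : E × ℝ →L[ℝ] E × ℝ => L u) h1
  have h4 : ∀ q, q = (1, 0) → (mfderiv 𝓜 𝓜 (H.lmul p) q : E × ℝ →L[ℝ] E × ℝ) = H.ofLie p := by
    rintro q rfl
    rfl
  refine Eq.trans ?_ h3.symm
  rw [← h4 _ (H.leftInv_self p)]
  rfl

/-- The differential of a map, read in the Lie algebra. -/
theorem toLie_mfderiv {φ j : N × ℝ → N × ℝ} {p : N × ℝ} (hφ : MDifferentiableAt 𝓜 𝓜 φ p)
    (hj : MDifferentiableAt 𝓜 𝓜 j (1, 0)) (h : ∀ q, H.leftInv (φ p) (φ q) = j (H.leftInv p q))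
    (u : E × ℝ) :
    H.toLie (φ p) (mfderiv 𝓜 𝓜 φ p u) = (mfderiv 𝓜 𝓜 j (1, 0) (H.toLie p u) : E × ℝ) := by
  have h1 := mfderiv_comp (I := 𝓜) (I' := 𝓜) (I'' := 𝓜) p
    (H.mdifferentiable_leftInv (φ p) (φ p)) hφ
  have hj' : MDifferentiableAt 𝓜 𝓜 j (H.leftInv p p) := by rwa [leftInv_self]
  have h2 := mfderiv_comp (I := 𝓜) (I' := 𝓜) (I'' := 𝓜) p hj' (H.mdifferentiable_leftInv p p)
  have h3 : H.leftInv (φ p) ∘ φ = j ∘ H.leftInv p := funext h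
  rw [h3, h2] at h1
  have h5 := congrArg (fun L : E × ℝ →L[ℝ] E × ℝ => L u) h1
  have h4 : ∀ q, q = (1, 0) → (mfderiv 𝓜 𝓜 j q : E × ℝ →L[ℝ] E × ℝ) =
      mfderiv 𝓜 𝓜 j (1, 0) := by
    rintro q rfl
    rfl
  refine h5.symm.trans ?_
  change (mfderiv 𝓜 𝓜 j (H.leftInv p p) : E × ℝ →L[ℝ] E × ℝ) (H.toLie p u) = _
  rw [h4 _ (H.leftInv_self p)]
  rfl

theorem toLie_mfderiv_lmul (g p : N × ℝ) (u : E × ℝ) :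
    H.toLie (H.lmul g p) (mfderiv 𝓜 𝓜 (H.lmul g) p u) = H.toLie p u := by
  rw [H.toLie_mfderiv (j := id) (H.mdifferentiable_lmul g p) mdifferentiableAt_id
    (fun q => H.leftInv_lmul_lmul g p q), mfderiv_id]
  rfl

/-- The differential of left translation by `n⁻¹` at `n`. -/
def leftTranslation (n : N) : E →L[ℝ] E := mfderiv 𝓘(ℝ, E) 𝓘(ℝ, E) (fun m => n⁻¹ * m) n

theorem mfderiv_act {t : ℝ} {n : N} (hn : n = 1) :
    (mfderiv 𝓘(ℝ, E) 𝓘(ℝ, E) (H.act t) n : E →L[ℝ] E) = NormedSpace.exp (t • H.D) := by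
  subst hn
  exact ContinuousLinearMap.ext (H.α_deriv t)

/-- Left translation by `p⁻¹` is left translation in `N` followed by `act (-p.2)`, whose
differential at `1` is `e^{-tD}` at height `t = p.2`. This factor is the source of the upward
contraction. -/
theorem toLie_apply (p : N × ℝ) (u : E × ℝ) :
    H.toLie p u = (NormedSpace.exp (-p.2 • H.D) (leftTranslation p.1 u.1), u.2) := by
  have h : H.leftInv p = Prod.map (H.act (-p.2) ∘ fun n => p.1⁻¹ * n) (fun t => t - p.2) := by
    ext q : 1
    exact H.leftInv_apply p q
  have h1 : MDifferentiableAt 𝓘(ℝ, E) 𝓘(ℝ, E) (fun n => p.1⁻¹ * n) p.1 :=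
    (contMDiff_mul_left (n := ∞)).mdifferentiableAt (by simp)
  have h2 : MDifferentiableAt 𝓘(ℝ, E) 𝓘(ℝ, E) (H.act (-p.2)) (p.1⁻¹ * p.1) :=
    (H.contMDiff_act _).mdifferentiableAt (by simp)
  have h3 : MDifferentiableAt 𝓘(ℝ, ℝ) 𝓘(ℝ, ℝ) (fun t : ℝ => t - p.2) p.2 := by
    rw [mdifferentiableAt_iff_differentiableAt]
    fun_prop
  have h4 : HasMFDerivAt 𝓘(ℝ, ℝ) 𝓘(ℝ, ℝ) (fun t : ℝ => t - p.2) p.2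
      (ContinuousLinearMap.id ℝ ℝ) :=
    ((hasFDerivAt_id p.2).sub_const p.2).hasMFDerivAt
  have h5 := ((h2.comp p.1 h1).hasMFDerivAt.prodMap h4).mfderiv
  rw [mfderiv_comp p.1 h2 h1] at h5
  have h6 := congrArg (fun L : E × ℝ →L[ℝ] E × ℝ => L u) h5
  refine Eq.trans ?_ (h6.trans ?_)
  · rw [toLie, h]
  · refine Prod.ext ?_ ?_
    swap
    · change (mfderiv 𝓘(ℝ, ℝ) 𝓘(ℝ, ℝ) (fun t : ℝ => t - p.2) p.2 : ℝ →L[ℝ] ℝ) u.2 = u.2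
      rw [h4.mfderiv]
      rfl
    exact congrArg (fun L : E →L[ℝ] E => L (leftTranslation p.1 u.1))
      (H.mfderiv_act (t := -p.2) (inv_mul_cancel p.1))

theorem toLie_snd (p : N × ℝ) (u : E × ℝ) : (H.toLie p u).2 = u.2 := by rw [toLie_apply]

/-! ## The norm on the Lie algebra -/

/-- The norm on the Lie algebra defined by the inner product. -/
def lieNorm (u : E × ℝ) : ℝ := Real.sqrt (H.Q u u)

theorem Q_self_nonneg (u : E × ℝ) : 0 ≤ H.Q u u := by
  rcases eq_or_ne u 0 with rfl | h
  · simp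
  · exact (H.pos u h).le

theorem lieNorm_nonneg (u : E × ℝ) : 0 ≤ H.lieNorm u := Real.sqrt_nonneg _

theorem lieNorm_sq (u : E × ℝ) : H.lieNorm u ^ 2 = H.Q u u := Real.sq_sqrt (H.Q_self_nonneg u)

/-- The inner product on the Lie algebra as a continuous bilinear map. -/
def continuousQ : E × ℝ →L[ℝ] E × ℝ →L[ℝ] ℝ :=
  LinearMap.toContinuousBilinearMap H.Q

theorem continuousQ_apply (u w : E × ℝ) : H.continuousQ u w = H.Q u w := rfl

theorem exists_lieNorm_bounds : ∃ C c : ℝ, 0 < C ∧ 0 < c ∧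
    ∀ u, H.lieNorm u ≤ C * ‖u‖ ∧ ‖u‖ ≤ c * H.lieNorm u := by
  have hcont : Continuous fun u => H.Q u u := by
    have h : (fun u => H.Q u u) = fun u => H.continuousQ u u := rfl
    rw [h]
    fun_prop
  have : ProperSpace (E × ℝ) := FiniteDimensional.proper_real (E × ℝ)
  have hne : (Metric.sphere (0 : E × ℝ) 1).Nonempty := ⟨(0, 1), by simp⟩
  obtain ⟨x, hx, hmin⟩ := (isCompact_sphere (0 : E × ℝ) 1).exists_isMinOn hne hcont.continuousOn
  have hx0 : x ≠ 0 := by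
    rintro rfl
    simp at hx
  have hm := H.pos x hx0
  refine ⟨Real.sqrt ‖H.continuousQ‖ + 1, (Real.sqrt (H.Q x x))⁻¹, by positivity,
    inv_pos.2 (Real.sqrt_pos.2 hm), fun u => ⟨?_, ?_⟩⟩
  · refine le_trans ?_ (mul_le_mul_of_nonneg_right (le_add_of_nonneg_right zero_le_one)
      (norm_nonneg u))
    refine Real.sqrt_le_iff.2 ⟨by positivity, ?_⟩
    rw [mul_pow, Real.sq_sqrt (norm_nonneg H.continuousQ), ← continuousQ_apply, sq, ← mul_assoc]
    exact (le_abs_self _).trans (H.continuousQ.le_opNorm₂ u u)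
  · rcases eq_or_ne u 0 with rfl | hu
    · simp [lieNorm]
    rw [le_inv_mul_iff₀ (Real.sqrt_pos.2 hm), lieNorm, ← Real.sqrt_sq (norm_nonneg u),
      ← Real.sqrt_mul hm.le]
    refine Real.sqrt_le_sqrt ?_
    have h1 : H.Q x x ≤ H.Q (‖u‖⁻¹ • u) (‖u‖⁻¹ • u) := hmin (by
      rw [mem_sphere_zero_iff_norm, norm_smul, norm_inv, norm_norm,
        inv_mul_cancel₀ (norm_ne_zero_iff.2 hu)])
    rw [map_smul, map_smul, LinearMap.smul_apply, smul_eq_mul, smul_eq_mul] at h1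
    have h2 := norm_pos_iff.2 hu
    rw [sq]
    calc H.Q x x * (‖u‖ * ‖u‖) ≤ ‖u‖⁻¹ * (‖u‖⁻¹ * H.Q u u) * (‖u‖ * ‖u‖) := by gcongr
      _ = H.Q u u := by field_simp

/-- The unit vector orthogonal to `Lie(N)` is `(vert, 1)`. -/
def vert : E := H.normalized.choose

/-- Pythagoras for the orthogonal decomposition into a vector of `Lie(N)` and a multiple of the unit
vector `(vert, 1)`. -/
theorem Q_self_eq (u : E × ℝ) :
    H.Q u u = H.Q (u.1 - u.2 • H.vert, 0) (u.1 - u.2 • H.vert, 0) + u.2 ^ 2 := by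
  obtain ⟨h1, h2⟩ := H.normalized.choose_spec
  have h3 : u = (u.1 - u.2 • H.vert, (0 : ℝ)) + u.2 • (H.vert, (1 : ℝ)) := by
    ext <;> simp
  have h4 := h1 (u.1 - u.2 • H.vert)
  change H.Q (H.vert, 1) (H.vert, 1) = 1 at h2
  change H.Q (H.vert, 1) (u.1 - u.2 • H.vert, 0) = 0 at h4
  have h5 := h4
  rw [H.symm] at h5
  conv_lhs => rw [h3]
  simp only [map_add, map_smul, LinearMap.add_apply, LinearMap.smul_apply, smul_eq_mul, h2, h4, h5]
  ring

theorem lieNorm_horizontal_sq (u : E × ℝ) :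
    H.lieNorm (u.1 - u.2 • H.vert, 0) ^ 2 + u.2 ^ 2 = H.lieNorm u ^ 2 := by
  rw [lieNorm_sq, lieNorm_sq, H.Q_self_eq u]

theorem abs_snd_le_lieNorm (u : E × ℝ) : |u.2| ≤ H.lieNorm u := by
  have := H.lieNorm_horizontal_sq u
  refine abs_le_of_sq_le_sq ?_ (H.lieNorm_nonneg u)
  nlinarith [sq_nonneg (H.lieNorm (u.1 - u.2 • H.vert, 0))]

theorem lieNorm_vert : H.lieNorm (H.vert, 1) = 1 := by
  rw [lieNorm]
  have h2 : H.Q (H.vert, 1) (H.vert, 1) = 1 := H.normalized.choose_spec.2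
  rw [h2, Real.sqrt_one]

end HeintzeGroup

/-! ## The Riemannian metric of a Heintze group -/

namespace HeintzeGroup

set_option linter.unusedSectionVars false

variable {E N : Type*} [NormedAddCommGroup E] [NormedSpace ℝ E] [FiniteDimensional ℝ E]
  [TopologicalSpace N] [ChartedSpace E N] [Group N] [LieGroup 𝓘(ℝ, E) ∞ N]
  (H : HeintzeGroup E N)

local notation "𝓜" => ModelWithCorners.prod 𝓘(ℝ, E) 𝓘(ℝ, ℝ)

theorem toLie_injective (p : N × ℝ) : Function.Injective (H.toLie p) :=
  Function.LeftInverse.injective (H.ofLie_toLie p)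

-- Only each single automorphism `α t` is assumed smooth, not the joint dependence on `t`. So
-- `toLie` is split into translation in the direct product `N × ℝ`, smooth in both variables, and
-- the factor `e^{-tD}`, continuous in `t`.
open ContinuousLinearMap in
theorem continuousAt_toLie (p : N × ℝ) :
    ContinuousAt (fun q : N × ℝ => (H.toLie q).comp
      ((tangentBundleCore 𝓜 (N × ℝ)).coordChange (achart (ModelProd E ℝ) p)
        (achart (ModelProd E ℝ) q) q)) p := by
  let f : N × ℝ → N × ℝ → N × ℝ := fun q r => (q.1⁻¹ * r.1, r.2 - q.2)
  have hf : ContMDiff (ModelWithCorners.prod 𝓜 𝓜) 𝓜 ∞ (Function.uncurry f) := by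
    refine ContMDiff.prodMk ?_ ?_
    · exact (contMDiff_fst.comp contMDiff_fst).inv.mul (contMDiff_fst.comp contMDiff_snd)
    · exact (contMDiff_snd.comp contMDiff_snd).sub (contMDiff_snd.comp contMDiff_fst)
  have h1 := (ContMDiffAt.mfderiv (m := 0) (n := 1) f id ((hf.of_le (by simp)).contMDiffAt)
    (contMDiffAt_id (x := p)) (by simp)).continuousAt
  have hff : ∀ q, f q (id q) = (1, 0) := fun q => by simp [f]
  have h2 : ∀ q : N × ℝ, H.toLie q = (ContinuousLinearMap.prodMap
      (NormedSpace.exp (-q.2 • H.D)) (ContinuousLinearMap.id ℝ ℝ)).comp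
        (mfderiv 𝓜 𝓜 (f q) q : E × ℝ →L[ℝ] E × ℝ) := by
    intro q
    have h1 : MDifferentiableAt 𝓘(ℝ, E) 𝓘(ℝ, E) (fun n => q.1⁻¹ * n) q.1 :=
      (contMDiff_mul_left (n := ∞)).mdifferentiableAt (by simp)
    have h4 : HasMFDerivAt 𝓘(ℝ, ℝ) 𝓘(ℝ, ℝ) (fun t : ℝ => t - q.2) q.2
        (ContinuousLinearMap.id ℝ ℝ) :=
      ((hasFDerivAt_id q.2).sub_const q.2).hasMFDerivAt
    have h5 : (mfderiv 𝓜 𝓜 (f q) q : E × ℝ →L[ℝ] E × ℝ) =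
        ContinuousLinearMap.prodMap (leftTranslation q.1) (ContinuousLinearMap.id ℝ ℝ) :=
      (h1.hasMFDerivAt.prodMap h4).mfderiv.trans
        (congrArg (fun L : ℝ →L[ℝ] ℝ => (leftTranslation (E := E) q.1).prodMap L) h4.mfderiv)
    rw [h5]
    exact ContinuousLinearMap.ext fun u => H.toLie_apply q u
  have h3 : Continuous fun q : N × ℝ => ContinuousLinearMap.prodMap
      (NormedSpace.exp (-q.2 • H.D)) (ContinuousLinearMap.id ℝ ℝ) := by
    have _ : CompleteSpace E := FiniteDimensional.complete ℝ E
    have h4 : Continuous fun t : ℝ => NormedSpace.exp (t • H.D) :=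
      continuous_iff_continuousAt.2 fun t =>
        (hasDerivAt_exp_smul_const (𝕂 := ℝ) H.D t).continuousAt
    have h1 : Continuous fun q : N × ℝ => (NormedSpace.exp (-q.2 • H.D), ContinuousLinearMap.id ℝ ℝ) :=
      (h4.comp continuous_snd.neg).prodMk continuous_const
    exact (ContinuousLinearMap.prodMapL ℝ E E ℝ ℝ).continuous.comp h1
  have h4 : ∀ᶠ q in 𝓝 p, (H.toLie q).comp
      ((tangentBundleCore 𝓜 (N × ℝ)).coordChange (achart (ModelProd E ℝ) p)
        (achart (ModelProd E ℝ) q) q) = (ContinuousLinearMap.prodMap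
      (NormedSpace.exp (-q.2 • H.D)) (ContinuousLinearMap.id ℝ ℝ)).comp
        (inTangentCoordinates 𝓜 𝓜 id (fun x => f x (id x))
          (fun x => (mfderiv 𝓜 𝓜 (f x) (id x) : E × ℝ →L[ℝ] E × ℝ)) p q) := by
    filter_upwards [chart_source_mem_nhds (ModelProd E ℝ) p] with q hq
    have e1 := inTangentCoordinates_eq (I := 𝓜) (I' := 𝓜) id (fun x => f x (id x))
      (fun x => (mfderiv 𝓜 𝓜 (f x) (id x) : E × ℝ →L[ℝ] E × ℝ)) (x₀ := p) (x := q) hq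
      (by simp only [hff]; exact mem_chart_source _ _)
    have e2 : ∀ z z' : N × ℝ, z = z' → ∀ u : E × ℝ, (tangentBundleCore 𝓜 (N × ℝ)).coordChange
        (achart (ModelProd E ℝ) z) (achart (ModelProd E ℝ) z') z u = u := by
      rintro z _ rfl u
      exact tangentCoordChange_self (I := 𝓜) (by simp)
    rw [h2]
    refine Eq.trans ?_ (congrArg (ContinuousLinearMap.comp (ContinuousLinearMap.prodMap
      (NormedSpace.exp (-q.2 • H.D)) (ContinuousLinearMap.id ℝ ℝ))) e1.symm)
    refine ContinuousLinearMap.ext fun u => congrArg (ContinuousLinearMap.prodMap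
      (NormedSpace.exp (-q.2 • H.D)) (ContinuousLinearMap.id ℝ ℝ)) ?_
    exact (e2 _ _ ((hff q).trans (hff p).symm) _).symm
  exact (ContinuousAt.clm_comp h3.continuousAt h1).congr (h4.mono fun _ h => h.symm)

/-- The left-invariant Riemannian metric. -/
def riemannianMetric :
    Bundle.ContinuousRiemannianMetric (E × ℝ) (fun p : N × ℝ => TangentSpace 𝓜 p) where
  inner p := (H.continuousQ.bilinearComp (H.toLie p) (H.toLie p) : E × ℝ →L[ℝ] E × ℝ →L[ℝ] ℝ)
  symm p v w := H.symm _ _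
  pos p v hv := H.pos _ fun h => hv (H.toLie_injective p (h.trans (map_zero _).symm))
  isVonNBounded p := by
    obtain ⟨C, c, -, hc, h⟩ := H.exists_lieNorm_bounds
    change Bornology.IsVonNBounded ℝ {v : E × ℝ | H.Q (H.toLie p v) (H.toLie p v) < 1}
    refine (NormedSpace.isVonNBounded_closedBall ℝ (E × ℝ) (‖H.ofLie p‖ * c)).subset fun v hv => ?_
    rw [mem_closedBall_zero_iff, ← H.ofLie_toLie p v]
    refine ((H.ofLie p).le_opNorm _).trans (mul_le_mul_of_nonneg_left ?_ (norm_nonneg _))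
    refine (h _).2.trans (mul_le_of_le_one_right hc.le ?_)
    exact Real.sqrt_le_one.2 (le_of_lt hv)
  continuous := by
    rw [continuous_iff_continuousAt]
    intro p
    rw [continuousAt_hom_bundle]
    refine ⟨continuousAt_id, ?_⟩
    have h1 := H.continuousAt_toLie p
    have h2 : ContinuousAt (fun q : N × ℝ => H.continuousQ.bilinearComp
        ((H.toLie q).comp ((tangentBundleCore 𝓜 (N × ℝ)).coordChange (achart (ModelProd E ℝ) p)
          (achart (ModelProd E ℝ) q) q))
        ((H.toLie q).comp ((tangentBundleCore 𝓜 (N × ℝ)).coordChange (achart (ModelProd E ℝ) p)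
          (achart (ModelProd E ℝ) q) q))) p :=
      (ContinuousLinearMap.flipₗᵢ ℝ (E × ℝ) (E × ℝ) ℝ).continuous.continuousAt.comp
        (((ContinuousLinearMap.flipₗᵢ ℝ (E × ℝ) (E × ℝ) ℝ).continuous.continuousAt.comp
          (continuousAt_const.clm_comp h1)).clm_comp h1)
    refine h2.congr ?_
    filter_upwards [chart_source_mem_nhds (ModelProd E ℝ) p] with q hq
    have hb : q ∈ (trivializationAt (E × ℝ) (fun p : N × ℝ => TangentSpace 𝓜 p) p).baseSet := by
      rw [TangentBundle.trivializationAt_baseSet]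
      exact hq
    have e1 : ∀ v : E × ℝ, (tangentBundleCore 𝓜 (N × ℝ)).coordChange (achart (ModelProd E ℝ) p)
        (achart (ModelProd E ℝ) q) q v =
          (trivializationAt (E × ℝ) (fun p : N × ℝ => TangentSpace 𝓜 p) p).symm q v := fun v =>
      (congrArg (fun L : E × ℝ →L[ℝ] E × ℝ => L v)
        (TangentBundle.symmL_trivializationAt_eq_core (I := 𝓜) hq).symm).trans
        (Bundle.Trivialization.symmL_apply _ hb v)
    refine ContinuousLinearMap.ext fun v => ContinuousLinearMap.ext fun w => ?_
    refine Eq.trans ?_ (inCoordinates_apply_eq₂ (𝕜 := ℝ) (F₁ := E × ℝ)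
      (F₂ := E × ℝ) (F₃ := ℝ) (E₁ := fun p : N × ℝ => TangentSpace 𝓜 p)
      (E₂ := fun p : N × ℝ => TangentSpace 𝓜 p) (E₃ := fun _ : N × ℝ => ℝ) hb hb
      (mem_univ q)).symm
    simp only [Bundle.Trivial.fiberBundle_trivializationAt',
      Bundle.Trivial.linearMapAt_trivialization]
    exact congrArg₂ (fun v w : E × ℝ => H.Q (H.toLie q v) (H.toLie q w)) (e1 v) (e1 w)

-- Identifies the norms used to define the distance with those of a continuous Riemannian metric, so
-- that general facts on Riemannian distances and the manifold topology apply.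
open Bundle in
theorem enorm_riemannianMetric :
    letI : RiemannianBundle (fun p : N × ℝ => TangentSpace 𝓜 p) :=
      ⟨H.riemannianMetric.toRiemannianMetric⟩
    (fun p : N × ℝ => (inferInstance : ENorm (TangentSpace 𝓜 p))) = H.tangentNorm := by
  let _ : RiemannianBundle (fun p : N × ℝ => TangentSpace 𝓜 p) :=
    ⟨H.riemannianMetric.toRiemannianMetric⟩
  funext p
  refine congrArg ENorm.mk (funext fun w => ?_)
  change ‖w‖ₑ = _
  rw [← ofReal_norm]
  rfl

open Bundle in
theorem eventually_edist_lt (p : N × ℝ) {c : ℝ≥0∞} (hc : 0 < c) :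
    ∀ᶠ q in 𝓝 p, edist (⟨p⟩ : H.Space) ⟨q⟩ < c := by
  let _ : RiemannianBundle (fun p : N × ℝ => TangentSpace 𝓜 p) :=
    ⟨H.riemannianMetric.toRiemannianMetric⟩
  -- The statement is abstracted over the family of norms so that it can be rewritten along the
  -- equality of the two families.
  let P (i : ∀ p : N × ℝ, ENorm (TangentSpace 𝓜 p)) : Prop :=
    ∀ᶠ q in 𝓝 p, Manifold.riemannianEDist 𝓜 p q < c
  have h : P (fun p => inferInstance) := eventually_riemannianEDist_lt 𝓜 p hc
  have h' : P H.tangentNorm := H.enorm_riemannianMetric ▸ h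
  exact h'

theorem regularSpace (_ : HeintzeGroup E N) : RegularSpace (N × ℝ) := by
  have := topologicalGroup_of_lieGroup 𝓘(ℝ, E) (G := N) ∞
  infer_instance

theorem t2Space (_ : HeintzeGroup E N) : T2Space (N × ℝ) := by
  have := topologicalGroup_of_lieGroup 𝓘(ℝ, E) (G := N) ∞
  have := ChartedSpace.t1Space E N
  infer_instance

open Bundle in
theorem exists_edist_lt_subset {p : N × ℝ} {s : Set (N × ℝ)} (hs : s ∈ 𝓝 p) :
    ∃ c > 0, {q | edist (⟨p⟩ : H.Space) ⟨q⟩ < c} ⊆ s := by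
  have := H.regularSpace
  let _ : RiemannianBundle (fun p : N × ℝ => TangentSpace 𝓜 p) :=
    ⟨H.riemannianMetric.toRiemannianMetric⟩
  let P (i : ∀ p : N × ℝ, ENorm (TangentSpace 𝓜 p)) : Prop :=
    ∃ c > 0, {q | Manifold.riemannianEDist 𝓜 p q < c} ⊆ s
  have h : P (fun p => inferInstance) := setOfPred_riemannianEDist_lt_subset_nhds' 𝓜 hs
  have h' : P H.tangentNorm := H.enorm_riemannianMetric ▸ h
  exact h'

theorem isInducing_point : IsInducing (Space.point : H.Space → N × ℝ) := by
  rw [isInducing_iff_nhds]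
  intro x
  refine le_antisymm ?_ ?_
  · intro s hs
    obtain ⟨t, ht, hts⟩ := hs
    obtain ⟨c, hc, h⟩ := H.exists_edist_lt_subset ht
    refine Filter.mem_of_superset (Metric.eball_mem_nhds x hc) fun y hy => hts (h ?_)
    rw [Metric.mem_eball'] at hy
    exact hy
  · intro s hs
    obtain ⟨c, hc, h⟩ := EMetric.mem_nhds_iff.1 hs
    refine ⟨_, H.eventually_edist_lt x.point hc, fun y hy => h ?_⟩
    rw [Metric.mem_eball']
    exact hy

/-- The Heintze group as a metric space is homeomorphic to the product manifold. -/
def homeomorph : H.Space ≃ₜ N × ℝ :=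
  Equiv.toHomeomorphOfIsInducing ⟨Space.point, Space.mk, fun _ => rfl, fun _ => rfl⟩
    H.isInducing_point

/-- The points at finite distance from `x` form an open and closed set, and the space is connected
because `N` is. -/
theorem edist_ne_top (x y : H.Space) : edist x y ≠ ⊤ := by
  have : SimplyConnectedSpace N := H.simplyConnected
  have h : PreconnectedSpace H.Space :=
    H.homeomorph.symm.surjective.denseRange.preconnectedSpace H.homeomorph.symm.continuous
  have h1 : IsClopen (Metric.eball x ⊤) := by
    refine ⟨⟨?_⟩, Metric.isOpen_eball⟩
    rw [EMetric.isOpen_iff]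
    intro z hz
    refine ⟨1, one_pos, fun w hw hwx => hz ?_⟩
    rw [Metric.mem_eball] at *
    refine (edist_triangle z w x).trans_lt (ENNReal.add_lt_top.2 ⟨?_, hwx⟩)
    rw [edist_comm]
    exact hw.trans ENNReal.one_lt_top
  have h2 := h1.eq_univ ⟨x, by simp⟩
  have h3 : y ∈ Metric.eball x ⊤ := h2 ▸ mem_univ y
  rw [edist_comm]
  exact (Metric.mem_eball.1 h3).ne

/-- The Riemannian metric space. -/
abbrev metricSpace : MetricSpace H.Space :=
  haveI : T2Space (N × ℝ) := H.t2Space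
  haveI : T0Space H.Space := H.homeomorph.symm.t0Space
  letI := PseudoEMetricSpace.toPseudoMetricSpace H.edist_ne_top
  MetricSpace.ofT0PseudoMetricSpace H.Space

end HeintzeGroup

/-! ## Isometries and properness of Heintze groups -/

theorem HasShortPaths.exists_between {A : Type*} [MetricSpace A] (P : HasShortPaths A) {x y : A}
    {a b : ℝ} (ha : 0 ≤ a) (h : dist x y < a + b) (hb : 0 < b) :
    ∃ z, dist x z ≤ a ∧ dist z y < b := by
  rcases le_or_gt (dist x y) a with hxa | hxa
  · exact ⟨y, hxa, by rwa [dist_self]⟩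
  obtain ⟨L, hL1, hL2⟩ := _root_.exists_between h
  obtain ⟨c, hc, h0, h1, hv⟩ := P x y (ENNReal.ofReal L) (by
    rw [edist_dist]
    exact (ENNReal.ofReal_lt_ofReal_iff (dist_nonneg.trans_lt hL1)).2 hL1)
  have hcont : Continuous fun t => dist x (c t) := by fun_prop
  obtain ⟨t, ht⟩ : ∃ t, dist x (c t) = a := mem_range_of_exists_le_of_exists_ge hcont
    ⟨0, by rw [h0, dist_self]; exact ha⟩ ⟨1, by rw [h1]; exact hxa.le⟩
  refine ⟨c t, ht.le, ?_⟩
  have h2 : edist x (c t) + edist (c t) y ≤ eVariationOn c univ := by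
    rw [← Set.Iic_union_Ici (a := t), eVariationOn.union c isGreatest_Iic isLeast_Ici]
    refine add_le_add ?_ ?_
    · rw [← h0]
      exact eVariationOn.edist_le c (mem_Iic.2 bot_le) (mem_Iic.2 le_rfl)
    · rw [← h1]
      exact eVariationOn.edist_le c (mem_Ici.2 le_rfl) (mem_Ici.2 le_top)
  have h3 := h2.trans hv
  rw [edist_dist, edist_dist, ← ENNReal.ofReal_add dist_nonneg dist_nonneg,
    ENNReal.ofReal_le_ofReal_iff (dist_nonneg.trans hL1.le)] at h3
  rw [ht] at h3
  linarith

namespace HeintzeGroup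

set_option linter.unusedSectionVars false

variable {E N : Type*} [NormedAddCommGroup E] [NormedSpace ℝ E] [FiniteDimensional ℝ E]
  [TopologicalSpace N] [ChartedSpace E N] [Group N] [LieGroup 𝓘(ℝ, E) ∞ N]
  (H : HeintzeGroup E N)

local notation "𝓜" => ModelWithCorners.prod 𝓘(ℝ, E) 𝓘(ℝ, ℝ)

/-- The velocity of a path, as a vector of the Lie algebra. -/
def velocity (γ : ℝ → N × ℝ) (a b t : ℝ) : E × ℝ :=
  H.toLie (γ t) (mfderivWithin 𝓘(ℝ, ℝ) 𝓜 γ (Icc a b) t (1 : ℝ))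

theorem edist_map_le {φ : N × ℝ → N × ℝ} (hφ : ContMDiff 𝓜 𝓜 1 φ) {γ : ℝ → N × ℝ} {a b : ℝ}
    (hγ : ContMDiffOn 𝓘(ℝ, ℝ) 𝓜 1 γ (Icc a b)) (hab : a ≤ b) {f : ℝ → E × ℝ → ℝ}
    (hf : ∀ t ∈ Icc a b, ∀ u : E × ℝ,
      H.lieNorm (H.toLie (φ (γ t)) (mfderiv 𝓜 𝓜 φ (γ t) u)) ≤ f t (H.toLie (γ t) u)) :
    edist (⟨φ (γ a)⟩ : H.Space) ⟨φ (γ b)⟩ ≤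
      ∫⁻ t in Icc a b, ENNReal.ofReal (f t (H.velocity γ a b t)) := by
  let _ := H.tangentNorm
  have _ := H.tangentNorm_smul
  refine (riemannianEDist_comp_le hφ hγ hab).trans
    (MeasureTheory.setLIntegral_mono' measurableSet_Icc fun t ht => ?_)
  exact ENNReal.ofReal_le_ofReal (hf t ht (mfderivWithin 𝓘(ℝ, ℝ) 𝓜 γ (Icc a b) t (1 : ℝ)))

theorem exists_path_lt {x y : H.Space} {L : ℝ≥0∞} (h : edist x y < L) :
    ∃ γ : ℝ → N × ℝ, γ 0 = x.point ∧ γ 1 = y.point ∧ ContMDiffOn 𝓘(ℝ, ℝ) 𝓜 1 γ (Icc 0 1) ∧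
      ∫⁻ t in Icc 0 1, ENNReal.ofReal (H.lieNorm (H.velocity γ 0 1 t)) < L ∧
      ∀ t ∈ Icc (0 : ℝ) 1, edist x ⟨γ t⟩ < L := by
  let _ := H.tangentNorm
  have _ := H.tangentNorm_smul
  obtain ⟨γ, h0, h1, h2, h3⟩ := Manifold.exists_lt_of_riemannianEDist_lt h
  refine ⟨γ, h0, h1, h2, ?_, fun t ht => lt_of_le_of_lt ?_ h3⟩
  · rw [Manifold.pathELength_eq_lintegral_mfderivWithin_Icc] at h3
    exact h3
  · exact (Manifold.riemannianEDist_le_pathELength (h2.mono (Icc_subset_Icc le_rfl ht.2)) h0 rfl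
      ht.1).trans (Manifold.pathELength_mono le_rfl ht.2)

theorem one_lmul (q : N × ℝ) : H.lmul (1, 0) q = q := by simp [lmul, act_zero]

theorem edist_lmul_le (g : N × ℝ) (x y : H.Space) :
    edist (⟨H.lmul g x.point⟩ : H.Space) ⟨H.lmul g y.point⟩ ≤ edist x y := by
  refine le_of_forall_gt fun L hL => ?_
  obtain ⟨γ, h0, h1, h2, h3, -⟩ := H.exists_path_lt hL
  rw [← h0, ← h1]
  refine lt_of_le_of_lt (H.edist_map_le (f := fun _ => H.lieNorm) ((H.contMDiff_lmul g).of_le (by simp)) h2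
    zero_le_one fun t _ u => ?_) h3
  exact (H.toLie_mfderiv_lmul g _ u ▸ le_rfl)

/-- Left translations are isometries. -/
def lmulIsometry (g : N × ℝ) : H.Space ≃ᵢ H.Space where
  toFun x := ⟨H.lmul g x.point⟩
  invFun x := ⟨H.leftInv g x.point⟩
  left_inv x := Space.ext (H.leftInv_lmul g x.point)
  right_inv x := Space.ext (H.lmul_leftInv g x.point)
  isometry_toFun x y := by
    refine le_antisymm (H.edist_lmul_le g x y) ?_
    -- The reverse inequality is the same bound for translation by the inverse of `g`, which is
    -- `H.leftInv g (1, 0)`.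
    have h := H.edist_lmul_le (H.leftInv g (1, 0)) ⟨H.lmul g x.point⟩ ⟨H.lmul g y.point⟩
    have h1 : ∀ q, H.lmul (H.leftInv g (1, 0)) (H.lmul g q) = q := fun q => by
      rw [lmul_lmul]
      have : H.lmul (H.leftInv g (1, 0)) g = (1, 0) := by
        rw [leftInv_apply]
        refine Prod.ext ?_ ?_
        · simp [lmul]
        · simp [lmul]
      rw [this, one_lmul]
    simp only [h1] at h
    exact h

/-- The variation of a `C¹` path in the Riemannian distance is at most its Riemannian length. -/
theorem hasShortPaths :
    letI := H.metricSpace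
    HasShortPaths H.Space := by
  let _ := H.metricSpace
  intro x y L hL
  let _ := H.tangentNorm
  have _ := H.tangentNorm_smul
  obtain ⟨γ, h0, h1, h2, h3⟩ := Manifold.exists_lt_of_riemannianEDist_lt hL
  refine ⟨fun t => ⟨γ t⟩, ?_, Space.ext h0, Space.ext h1, ?_⟩
  · exact H.homeomorph.symm.continuous.comp (h2.continuousOn.domRestrict)
  refine le_trans ?_ h3.le
  rw [eVariationOn]
  refine iSup_le fun p => ?_
  obtain ⟨n, u, hu, -⟩ := p
  have e : ∀ k, ∑ i ∈ Finset.range k, Manifold.pathELength 𝓜 γ (u i) (u (i + 1)) =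
      Manifold.pathELength 𝓜 γ (u 0) (u k) := by
    intro k
    induction k with
    | zero => simp
    | succ k ih =>
      rw [Finset.sum_range_succ, ih, Manifold.pathELength_add]
      · exact hu (Nat.zero_le k)
      · exact hu (Nat.le_succ k)
  calc ∑ i ∈ Finset.range n, edist (⟨γ (u (i + 1))⟩ : H.Space) ⟨γ (u i)⟩
      ≤ ∑ i ∈ Finset.range n, Manifold.pathELength 𝓜 γ (u i) (u (i + 1)) := by
        refine Finset.sum_le_sum fun i _ => ?_
        rw [edist_comm]
        refine Manifold.riemannianEDist_le_pathELength (h2.mono (Icc_subset_Icc (u i).2.1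
          (u (i + 1)).2.2)) rfl rfl (hu (Nat.le_succ i))
    _ = Manifold.pathELength 𝓜 γ (u 0) (u n) := e n
    _ ≤ Manifold.pathELength 𝓜 γ 0 1 := Manifold.pathELength_mono (u 0).2.1 (u n).2.2

/-- A compact ball at the identity is carried by left translations to compact balls of the same
radius everywhere. -/
theorem properSpace :
    letI := H.metricSpace
    ProperSpace H.Space := by
  let _ := H.metricSpace
  have : LocallyCompactSpace N := ChartedSpace.locallyCompactSpace E N
  have : LocallyCompactSpace H.Space := H.homeomorph.isClosedEmbedding.locallyCompactSpace
  obtain ⟨r, hr, hc⟩ := Metric.exists_isCompact_closedBall (⟨(1, 0)⟩ : H.Space)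
  refine properSpace_of_uniform_of_length hr (fun x => ?_) fun x y a b ha h hb =>
    H.hasShortPaths.exists_between ha h hb
  have h := (H.lmulIsometry x.point).image_closedBall ⟨(1, 0)⟩ r
  have e : H.lmulIsometry x.point ⟨(1, 0)⟩ = x := Space.ext (H.lmul_one x.point)
  rw [e] at h
  rw [← h]
  exact hc.image (H.lmulIsometry x.point).continuous

end HeintzeGroup

/-! ## The vertical flow of a Heintze group -/

namespace HeintzeGroup

set_option linter.unusedSectionVars false

variable {E N : Type*} [NormedAddCommGroup E] [NormedSpace ℝ E] [FiniteDimensional ℝ E]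
  [TopologicalSpace N] [ChartedSpace E N] [Group N] [LieGroup 𝓘(ℝ, E) ∞ N]
  (H : HeintzeGroup E N)

local notation "𝓜" => ModelWithCorners.prod 𝓘(ℝ, E) 𝓘(ℝ, ℝ)

theorem mfderiv_lmul_ofLie (g p : N × ℝ) (u : E × ℝ) :
    (mfderiv 𝓜 𝓜 (H.lmul g) p (H.ofLie p u) : E × ℝ) = H.ofLie (H.lmul g p) u := by
  refine H.toLie_injective (H.lmul g p) ?_
  rw [toLie_ofLie]
  exact (H.toLie_mfderiv_lmul g p _).trans (H.toLie_ofLie p u)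

theorem ofLie_snd (p : N × ℝ) (u : E × ℝ) : (H.ofLie p u).2 = u.2 := by
  rw [← H.toLie_snd p, toLie_ofLie]

theorem continuous_exp_smul : Continuous fun t : ℝ => NormedSpace.exp (t • H.D) :=
  have _ : CompleteSpace E := FiniteDimensional.complete ℝ E
  continuous_iff_continuousAt.2 fun t => (hasDerivAt_exp_smul_const (𝕂 := ℝ) H.D t).continuousAt

theorem contDiff_exp_smul : ContDiff ℝ 1 fun t : ℝ => NormedSpace.exp (t • H.D) := by
  have _ : CompleteSpace E := FiniteDimensional.complete ℝ E
  have h : ∀ t : ℝ, HasDerivAt (fun t : ℝ => NormedSpace.exp (t • H.D))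
    (NormedSpace.exp (t • H.D) * H.D) t := fun t => hasDerivAt_exp_smul_const (𝕂 := ℝ) H.D t
  rw [contDiff_one_iff_deriv]
  refine ⟨fun t => (h t).differentiableAt, ?_⟩
  rw [funext fun t => (h t).deriv]
  exact H.continuous_exp_smul.mul continuous_const

/-- Isolates the dependence on height as `e^{tD}` on a fixed tangent space, followed by a
translation of the direct product `N × ℝ`. The regularity of left-invariant fields rests on this
form. -/
theorem ofLie_eq (p : N × ℝ) (u : E × ℝ) :
    H.ofLie p u = (mfderiv 𝓜 𝓜 (fun q : N × ℝ => (p.1 * q.1, p.2 + q.2)) (1, 0)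
      ((NormedSpace.exp (p.2 • H.D) u.1, u.2) : E × ℝ) : E × ℝ) := by
  let ψ : N × ℝ → N × ℝ := Prod.map (H.act p.2) id
  let μ : N × ℝ → N × ℝ := fun q => (p.1 * q.1, p.2 + q.2)
  have hμ : ContMDiff 𝓜 𝓜 ∞ μ := by
    refine ContMDiff.prodMap (f := fun n => p.1 * n) (g := fun t => p.2 + t) contMDiff_mul_left ?_
    rw [contMDiff_iff_contDiff]
    fun_prop
  have h1 : MDifferentiableAt 𝓘(ℝ, E) 𝓘(ℝ, E) (H.act p.2) 1 :=
    (H.contMDiff_act _).mdifferentiableAt (by simp)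
  have h2 := HasMFDerivAt.prodMap (p := ((1 : N), (0 : ℝ))) h1.hasMFDerivAt
    (hasMFDerivAt_id (I := 𝓘(ℝ, ℝ)) (0 : ℝ))
  have h3 : MDifferentiableAt 𝓜 𝓜 ψ (1, 0) := h2.mdifferentiableAt
  have h4 := mfderiv_comp (I := 𝓜) (I' := 𝓜) (I'' := 𝓜) (1, 0)
    (hμ.mdifferentiableAt (x := ψ (1, 0)) (by simp)) h3
  have h5 : μ ∘ ψ = H.lmul p := rfl
  rw [h5] at h4
  have h6 : ∀ q, q = (1, 0) → (mfderiv 𝓜 𝓜 μ q : E × ℝ →L[ℝ] E × ℝ) =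
      mfderiv 𝓜 𝓜 μ (1, 0) := by
    rintro q rfl
    rfl
  refine (congrArg (fun L : E × ℝ →L[ℝ] E × ℝ => L u) h4).trans ?_
  change (mfderiv 𝓜 𝓜 μ (ψ (1, 0)) : E × ℝ →L[ℝ] E × ℝ)
    ((mfderiv 𝓜 𝓜 ψ (1, 0) : E × ℝ →L[ℝ] E × ℝ) u) = _
  rw [h6 (ψ (1, 0)) (by simp [ψ])]
  refine congrArg (mfderiv 𝓜 𝓜 μ (1, 0) : E × ℝ →L[ℝ] E × ℝ) ?_
  refine (congrArg (fun L : E × ℝ →L[ℝ] E × ℝ => L u) h2.mfderiv).trans ?_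
  exact Prod.ext (congrArg (fun L : E →L[ℝ] E => L u.1) (H.mfderiv_act (t := p.2) rfl))
    (congrArg (fun L : ℝ →L[ℝ] ℝ => L u.2) (mfderiv_id (I := 𝓘(ℝ, ℝ)) (x := (0 : ℝ))))

theorem contMDiff_fibre_inclusion {B : Type*} [TopologicalSpace B] {F : Type*}
    [NormedAddCommGroup F] [NormedSpace ℝ F] (I : ModelWithCorners ℝ F B) {M : Type*}
    [TopologicalSpace M] [ChartedSpace B M] [IsManifold I 2 M] (x : M) :
    ContMDiff 𝓘(ℝ, F) I.tangent 1 fun w : F => (⟨x, w⟩ : TangentBundle I M) := by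
  intro w
  rw [Bundle.contMDiffAt_totalSpace]
  refine ⟨contMDiffAt_const, ?_⟩
  have : (fun w : F => (trivializationAt F (TangentSpace I) x (⟨x, w⟩ : TangentBundle I M)).2) =
      id := by
    funext w
    exact tangentCoordChange_self (I := I) (by simp)
  rw [this]
  exact contMDiffAt_id

/-- The unit vector field orthogonal to the horospheres. -/
def vertField (p : N × ℝ) : TangentSpace 𝓜 p := H.ofLie p (H.vert, 1)

/-- The field is the tangent map of multiplication in `N × ℝ`, applied to a zero vector at `p` and
the vector `(e^{tD} vert, 1)` at the identity. Both depend on `p` in a `C¹` way. -/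
theorem contMDiff_vertField :
    ContMDiff 𝓜 (ModelWithCorners.tangent 𝓜) 1
      fun p : N × ℝ => (⟨p, H.vertField p⟩ : TangentBundle 𝓜 (N × ℝ)) := by
  have : IsManifold 𝓘(ℝ, E) 2 N := IsManifold.of_le (n := ∞) (by norm_cast)
  let μ : (N × ℝ) × (N × ℝ) → N × ℝ := fun z => (z.1.1 * z.2.1, z.1.2 + z.2.2)
  have hμ : ContMDiff (ModelWithCorners.prod 𝓜 𝓜) 𝓜 ∞ μ := by
    refine ContMDiff.prodMk ?_ ?_
    · exact (contMDiff_fst.comp contMDiff_fst).mul (contMDiff_fst.comp contMDiff_snd)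
    · exact (contMDiff_snd.comp contMDiff_fst).add (contMDiff_snd.comp contMDiff_snd)
  have h1 : ContMDiff 𝓜 (ModelWithCorners.tangent 𝓜) 1
      fun p : N × ℝ => (⟨p, 0⟩ : TangentBundle 𝓜 (N × ℝ)) :=
    Bundle.contMDiff_zeroSection ℝ (fun p : N × ℝ => TangentSpace 𝓜 p)
  have h2 : ContMDiff 𝓜 (ModelWithCorners.tangent 𝓜) 1
      fun p : N × ℝ => (⟨(1, 0), (NormedSpace.exp (p.2 • H.D) H.vert, (1 : ℝ))⟩ :
        TangentBundle 𝓜 (N × ℝ)) := by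
    have h3 : ContMDiff 𝓘(ℝ, ℝ) 𝓘(ℝ, E × ℝ) 1
        fun t : ℝ => (NormedSpace.exp (t • H.D) H.vert, (1 : ℝ)) := by
      rw [contMDiff_iff_contDiff]
      exact (H.contDiff_exp_smul.clm_apply contDiff_const).prodMk contDiff_const
    exact (contMDiff_fibre_inclusion 𝓜 ((1, 0) : N × ℝ)).comp (h3.comp contMDiff_snd)
  have h4 : ContMDiff (ModelWithCorners.tangent (ModelWithCorners.prod 𝓜 𝓜))
      (ModelWithCorners.tangent 𝓜) 1 (tangentMap (ModelWithCorners.prod 𝓜 𝓜) 𝓜 μ) :=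
    hμ.contMDiff_tangentMap (by norm_cast)
  have h5 := (h4.comp (contMDiff_equivTangentBundleProd_symm (n := 1))).comp (h1.prodMk h2)
  refine h5.congr fun p => ?_
  have e : ∀ q q' : N × ℝ, q = q' → ∀ v v' : E × ℝ, v = v' →
      (⟨q, v⟩ : TangentBundle 𝓜 (N × ℝ)) = ⟨q', v'⟩ := by
    rintro q _ rfl v _ rfl
    rfl
  refine e _ _ (by simp [μ]) _ _ ?_
  refine (H.ofLie_eq p _).trans ?_
  have h6 := mfderiv_prod_eq_add_apply (I := 𝓜) (I' := 𝓜) (I'' := 𝓜) (f := μ) (p := (p, (1, 0)))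
    (v := ((0 : E × ℝ), ((NormedSpace.exp (p.2 • H.D) H.vert, (1 : ℝ)) : E × ℝ)))
    (hμ.mdifferentiableAt (by simp))
  refine Eq.trans ?_ h6.symm
  refine Eq.trans (zero_add _).symm (congrArg₂ (fun a b : E × ℝ => a + b) ?_ rfl)
  exact (map_zero _).symm

end HeintzeGroup

/-! ### The vertical one-parameter subgroup -/

namespace HeintzeGroup

set_option linter.unusedSectionVars false

variable {E N : Type*} [NormedAddCommGroup E] [NormedSpace ℝ E] [FiniteDimensional ℝ E]
  [TopologicalSpace N] [ChartedSpace E N] [Group N] [LieGroup 𝓘(ℝ, E) ∞ N]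
  (H : HeintzeGroup E N)

local notation "𝓜" => ModelWithCorners.prod 𝓘(ℝ, E) 𝓘(ℝ, ℝ)

theorem isMIntegralCurveOn_lmul (g : N × ℝ) {γ : ℝ → N × ℝ} {s : Set ℝ}
    (hγ : IsMIntegralCurveOn (I := 𝓜) γ H.vertField s) :
    IsMIntegralCurveOn (I := 𝓜) (fun t => H.lmul g (γ t)) H.vertField s := by
  intro t ht
  have h1 := (H.mdifferentiable_lmul g (γ t)).hasMFDerivAt.comp_hasMFDerivWithinAt t (hγ t ht)
  have h2 : ((mfderiv 𝓜 𝓜 (H.lmul g) (γ t) : E × ℝ →L[ℝ] E × ℝ).comp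
      ((1 : ℝ →L[ℝ] ℝ).smulRight (H.vertField (γ t) : E × ℝ))) =
      (1 : ℝ →L[ℝ] ℝ).smulRight (H.vertField (H.lmul g (γ t)) : E × ℝ) := by
    refine ContinuousLinearMap.ext fun r => ?_
    refine (map_smul (mfderiv 𝓜 𝓜 (H.lmul g) (γ t) : E × ℝ →L[ℝ] E × ℝ) r _).trans ?_
    exact congrArg (fun w : E × ℝ => r • w) (H.mfderiv_lmul_ofLie g (γ t) _)
  exact h2 ▸ h1

theorem isMIntegralCurve_lmul (g : N × ℝ) {γ : ℝ → N × ℝ}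
    (hγ : IsMIntegralCurve (I := 𝓜) γ H.vertField) :
    IsMIntegralCurve (I := 𝓜) (fun t => H.lmul g (γ t)) H.vertField :=
  isMIntegralCurve_iff_isMIntegralCurveOn.2
    (H.isMIntegralCurveOn_lmul g (isMIntegralCurve_iff_isMIntegralCurveOn.1 hγ))

/-- A local integral curve at the identity is left-translated to every point with the same existence
time, so integral curves extend to the whole line. -/
theorem exists_flow : ∃ γ : ℝ → N × ℝ, γ 0 = (1, 0) ∧
    IsMIntegralCurve (I := 𝓜) γ H.vertField := by
  have _ : CompleteSpace E := FiniteDimensional.complete ℝ E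
  have := H.t2Space
  have hv := H.contMDiff_vertField
  obtain ⟨γ, h0, hγ⟩ := exists_isMIntegralCurveAt_of_contMDiffAt_boundaryless (I := 𝓜) (t₀ := 0)
    (hv.contMDiffAt (x := ((1 : N), (0 : ℝ))))
  obtain ⟨ε, hε, hγ⟩ := isMIntegralCurveAt_iff'.1 hγ
  rw [Real.ball_eq_Ioo, zero_sub, zero_add] at hγ
  refine exists_isMIntegralCurve_of_isMIntegralCurveOn hv hε (fun p => ?_) (1, 0)
  refine ⟨fun t => H.lmul p (γ t), ?_, H.isMIntegralCurveOn_lmul p hγ⟩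
  change H.lmul p (γ 0) = p
  rw [h0, lmul_one]

/-- The vertical one-parameter subgroup. -/
def flow : ℝ → N × ℝ := H.exists_flow.choose

theorem flow_zero : H.flow 0 = (1, 0) := H.exists_flow.choose_spec.1

theorem isMIntegralCurve_flow : IsMIntegralCurve (I := 𝓜) H.flow H.vertField :=
  H.exists_flow.choose_spec.2

theorem contMDiff_flow : ContMDiff 𝓘(ℝ, ℝ) 𝓜 1 H.flow :=
  contMDiff_one_of_isMIntegralCurve H.contMDiff_vertField.continuous H.isMIntegralCurve_flow

/-- Both sides are integral curves of the left-invariant field in `t` with the value `flow a` at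
zero. -/
theorem flow_add (a t : ℝ) : H.flow (t + a) = H.lmul (H.flow a) (H.flow t) := by
  have := H.t2Space
  have _ : CompleteSpace E := FiniteDimensional.complete ℝ E
  refine congrFun (isMIntegralCurve_Ioo_eq_of_contMDiff_boundaryless (I := 𝓜) (t₀ := 0)
    H.contMDiff_vertField (H.isMIntegralCurve_flow.comp_add a)
    (H.isMIntegralCurve_lmul (H.flow a) H.isMIntegralCurve_flow) ?_) t
  simp [flow_zero, lmul_one]

theorem flow_snd (t : ℝ) : (H.flow t).2 = t := by
  have h : ∀ t, HasDerivAt (fun t => (H.flow t).2 - t) 0 t := by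
    intro t
    have h1 := (hasMFDerivAt_snd (I := 𝓘(ℝ, E)) (I' := 𝓘(ℝ, ℝ)) (H.flow t)).comp t
      (H.isMIntegralCurve_flow t)
    have h2 : HasFDerivAt (fun t => (H.flow t).2)
        ((ContinuousLinearMap.snd ℝ E ℝ).comp
          ((1 : ℝ →L[ℝ] ℝ).smulRight (H.vertField (H.flow t) : E × ℝ))) t := h1.hasFDerivAt
    refine (h2.hasDerivAt.sub (hasDerivAt_id t)).congr_deriv (sub_eq_zero.2 ?_)
    exact (congrArg Prod.snd (one_smul ℝ (H.vertField (H.flow t) : E × ℝ))).trans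
      (H.ofLie_snd _ _)
  have h1 := is_const_of_deriv_eq_zero (fun t => (h t).differentiableAt) (fun t => (h t).deriv) t 0
  simp only [flow_zero] at h1
  linarith

theorem velocity_flow {a b t : ℝ} (hab : a < b) (ht : t ∈ Icc a b) :
    H.velocity H.flow a b t = (H.vert, 1) := by
  have h1 : mfderivWithin 𝓘(ℝ, ℝ) 𝓜 H.flow (Icc a b) t = _ :=
    (H.isMIntegralCurve_flow t).hasMFDerivWithinAt.mfderivWithin
      (uniqueMDiffWithinAt_iff_uniqueDiffWithinAt.2 (uniqueDiffOn_Icc hab _ ht))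
  have h2 : (mfderivWithin 𝓘(ℝ, ℝ) 𝓜 H.flow (Icc a b) t (1 : ℝ) : E × ℝ) =
      H.ofLie (H.flow t) (H.vert, 1) :=
    (congrArg (fun L : ℝ →L[ℝ] E × ℝ => L 1) h1).trans (one_smul ℝ _)
  rw [velocity]
  exact (congrArg (H.toLie (H.flow t)) h2).trans (H.toLie_ofLie _ _)

/-- The horizontal coordinate of the vertical one-parameter subgroup. -/
def coflow (t : ℝ) : N := (H.flow t).1

theorem flow_eq (t : ℝ) : H.flow t = (H.coflow t, t) := Prod.ext rfl (H.flow_snd t)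

theorem coflow_zero : H.coflow 0 = 1 := congrArg Prod.fst H.flow_zero

theorem coflow_add (a t : ℝ) : H.coflow (a + t) = H.coflow a * H.act a (H.coflow t) := by
  rw [coflow, add_comm, flow_add, flow_eq]
  rfl

theorem contMDiff_coflow : ContMDiff 𝓘(ℝ, ℝ) 𝓘(ℝ, E) 1 H.coflow :=
  contMDiff_fst.comp H.contMDiff_flow

end HeintzeGroup

/-! ### The lower end of the vertical subgroup -/

namespace HeintzeGroup

set_option linter.unusedSectionVars false

variable {E N : Type*} [NormedAddCommGroup E] [NormedSpace ℝ E] [FiniteDimensional ℝ E]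
  [TopologicalSpace N] [ChartedSpace E N] [Group N] [LieGroup 𝓘(ℝ, E) ∞ N]
  (H : HeintzeGroup E N)

local notation "𝓜" => ModelWithCorners.prod 𝓘(ℝ, E) 𝓘(ℝ, ℝ)

theorem exp_smul_comp (s t : ℝ) (v : E) :
    NormedSpace.exp (s • H.D) (NormedSpace.exp (t • H.D) v) = NormedSpace.exp ((s + t) • H.D) v := by
  have _ : CompleteSpace E := FiniteDimensional.complete ℝ E
  let _ : NormedAlgebra ℚ (E →L[ℝ] E) := NormedAlgebra.restrictScalars ℚ ℝ _
  rw [add_smul, NormedSpace.exp_add_of_commute]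
  · rfl
  · exact ((Commute.refl H.D).smul_left s).smul_right t

theorem leftTranslation_eq (p : N × ℝ) (u : E × ℝ) :
    leftTranslation p.1 u.1 = NormedSpace.exp (p.2 • H.D) (H.toLie p u).1 := by
  rw [toLie_apply, exp_smul_comp, add_neg_cancel, zero_smul, NormedSpace.exp_zero]
  rfl

theorem lintegral_exp_le {B l s t : ℝ} (hB : 0 ≤ B) (hl : 0 < l) (hst : s ≤ t) :
    ∫⁻ r in Icc s t, ENNReal.ofReal (B * Real.exp (l * r)) ≤
      ENNReal.ofReal (B / l * Real.exp (l * t)) := by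
  have hc : Continuous fun r => B * Real.exp (l * r) := by fun_prop
  rw [← MeasureTheory.ofReal_integral_eq_lintegral_ofReal
    (hc.integrableOn_Icc) (Eventually.of_forall fun r => by positivity),
    MeasureTheory.integral_Icc_eq_integral_Ioc, ← intervalIntegral.integral_of_le hst]
  refine ENNReal.ofReal_le_ofReal ?_
  have h : ∀ r ∈ uIcc s t, HasDerivAt (fun r => B / l * Real.exp (l * r)) (B * Real.exp (l * r)) r := by
    intro r _
    refine ((((hasDerivAt_id r).const_mul l).exp).const_mul (B / l)).congr_deriv ?_
    simp only [id]
    field_simp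
  rw [intervalIntegral.integral_eq_sub_of_hasDerivAt h (hc.intervalIntegrable s t)]
  have : 0 ≤ B / l * Real.exp (l * s) := by positivity
  linarith

/-- Moved to height zero, the velocity of the flow at time `r` becomes `e^{rD} vert`, which decays
exponentially as `r → -∞`. Integration bounds the distance. -/
theorem exists_edist_coflow_le : ∃ C l : ℝ, 0 < l ∧ ∀ s t, s ≤ t → t ≤ 0 →
    edist (⟨(H.coflow s, 0)⟩ : H.Space) ⟨(H.coflow t, 0)⟩ ≤ ENNReal.ofReal (C * Real.exp (l * t)) := by
  obtain ⟨K, l, hl, hK⟩ := exists_norm_exp_neg_le H.D H.eigenvalues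
  obtain ⟨C, c, hC, -, hn⟩ := H.exists_lieNorm_bounds
  have hK0 : 0 ≤ K := by
    have := (norm_nonneg _).trans (hK 0 le_rfl)
    simpa using this
  refine ⟨C * K * ‖H.vert‖ / l, l, hl, fun s t hst ht => ?_⟩
  rcases hst.eq_or_lt with rfl | hlt
  · rw [edist_self]
    exact bot_le
  have hφ : ContMDiff 𝓜 𝓜 1 fun p : N × ℝ => (p.1, (0 : ℝ)) := contMDiff_fst.prodMk contMDiff_const
  have h1 := H.edist_map_le hφ (H.contMDiff_flow.contMDiffOn (s := Icc s t)) hst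
    (f := fun r w => C * K * ‖w.1‖ * Real.exp (l * r)) ?_
  · refine h1.trans (le_trans (le_of_eq ?_)
      (lintegral_exp_le (B := C * K * ‖H.vert‖) (by positivity) hl hst))
    refine MeasureTheory.setLIntegral_congr_fun measurableSet_Icc fun r hr => ?_
    simp only [H.velocity_flow hlt hr]
  · intro r hr u
    have h2 : (mfderiv 𝓜 𝓜 (fun p : N × ℝ => (p.1, (0 : ℝ))) (H.flow r) u : E × ℝ) = (u.1, 0) :=
      congrArg (fun L : E × ℝ →L[ℝ] E × ℝ => L u)
        ((hasMFDerivAt_fst (I := 𝓘(ℝ, E)) (I' := 𝓘(ℝ, ℝ)) (H.flow r)).prodMk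
          (hasMFDerivAt_const (I := 𝓜) (I' := 𝓘(ℝ, ℝ)) (0 : ℝ) (H.flow r))).mfderiv
    have h3 : H.toLie ((H.flow r).1, 0) (mfderiv 𝓜 𝓜 (fun p : N × ℝ => (p.1, (0 : ℝ))) (H.flow r) u) =
        (NormedSpace.exp (r • H.D) (H.toLie (H.flow r) u).1, 0) := by
      refine (congrArg (H.toLie ((H.flow r).1, 0)) h2).trans ?_
      rw [H.toLie_apply ((H.flow r).1, 0), H.leftTranslation_eq (H.flow r) u, exp_smul_comp,
        flow_snd, neg_zero, zero_add]
    refine (congrArg H.lieNorm h3).le.trans ((hn _).1.trans ?_)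
    rw [mul_assoc C, mul_assoc C]
    refine mul_le_mul_of_nonneg_left ?_ hC.le
    have h4 : ‖NormedSpace.exp (r • H.D)‖ ≤ K * Real.exp (l * r) := by
      have := hK (-r) (by linarith [hr.2])
      simpa using this
    have h5 : ‖NormedSpace.exp (r • H.D) (H.toLie (H.flow r) u).1‖ ≤
        K * Real.exp (l * r) * ‖(H.toLie (H.flow r) u).1‖ :=
      (ContinuousLinearMap.le_opNorm _ _).trans (mul_le_mul_of_nonneg_right h4 (norm_nonneg _))
    rw [Prod.norm_def, norm_zero, max_eq_left (norm_nonneg _)]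
    linarith

theorem tendsto_mk_iff {ι : Type*} {F : Filter ι} {f : ι → N × ℝ} {p : N × ℝ} :
    Tendsto (fun i => (⟨f i⟩ : H.Space)) F (𝓝 ⟨p⟩) ↔ Tendsto f F (𝓝 p) :=
  H.isInducing_point.tendsto_nhds_iff

/-- By exponential decay `coflow t` converges to some `m` as `t → -∞`. The identity `coflow (a + t)
= coflow a * act a (coflow t)` passes to the limit and shows that `m` is fixed; equivalently `flow
a` times `(m, 0)` is `(m, a)`. -/
theorem exists_fixed : ∃ m : N, ∀ a, H.coflow a * H.act a m = m := by
  let _ := H.metricSpace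
  have := H.properSpace
  have : T2Space N := by
    have := topologicalGroup_of_lieGroup 𝓘(ℝ, E) (G := N) ∞
    have := ChartedSpace.t1Space E N
    infer_instance
  have := topologicalGroup_of_lieGroup 𝓘(ℝ, E) (G := N) ∞
  obtain ⟨C, l, hl, h⟩ := H.exists_edist_coflow_le
  have hlim : ∀ {u : ℕ → ℝ}, Tendsto u atTop atBot →
      Tendsto (fun k => C * Real.exp (l * u k)) atTop (𝓝 0) := fun hu => by
    have := (Real.tendsto_exp_atBot.comp (hu.const_mul_atBot hl)).const_mul C
    rwa [mul_zero] at this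
  have hdist : ∀ s t, s ≤ t → t ≤ 0 →
      dist (⟨(H.coflow s, 0)⟩ : H.Space) ⟨(H.coflow t, 0)⟩ ≤ |C * Real.exp (l * t)| := by
    intro s t hst ht
    have := h s t hst ht
    rw [edist_dist, ENNReal.ofReal_le_ofReal_iff'] at this
    rcases this with h1 | h1
    · exact h1.trans (le_abs_self _)
    · exact h1.trans (abs_nonneg _)
  have hcast : Tendsto (fun k : ℕ => -(k : ℝ)) atTop atBot :=
    tendsto_neg_atTop_atBot.comp tendsto_natCast_atTop_atTop
  obtain ⟨x, hx⟩ := cauchySeq_tendsto_of_complete (cauchySeq_of_le_tendsto_0'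
    (s := fun k : ℕ => (⟨(H.coflow (-(k : ℝ)), 0)⟩ : H.Space)) _
    (fun n m hnm => by
      rw [dist_comm]
      exact hdist (-(m : ℝ)) (-(n : ℝ)) (by simpa using hnm) (by simp))
    (by simpa using (hlim hcast).abs))
  have hfst : ∀ u : ℕ → ℝ, Tendsto (fun k => (⟨(H.coflow (u k), 0)⟩ : H.Space)) atTop (𝓝 x) →
      Tendsto (fun k => H.coflow (u k)) atTop (𝓝 x.point.1) := fun u hu =>
    ((H.tendsto_mk_iff (f := fun k => (H.coflow (u k), (0 : ℝ))) (p := x.point)).1 hu).fst_nhds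
  refine ⟨x.point.1, fun a => ?_⟩
  have hu : Tendsto (fun k : ℕ => a + -(k : ℝ)) atTop atBot := tendsto_atBot_add_const_left _ a hcast
  have h1 := hfst _ hx
  have h2 : Tendsto (fun k : ℕ => (⟨(H.coflow (a + -(k : ℝ)), 0)⟩ : H.Space)) atTop (𝓝 x) := by
    refine (tendsto_iff_dist_tendsto_zero).2 ?_
    have h3 : Tendsto (fun k : ℕ => |C * Real.exp (l * (a + -(k : ℝ)))| +
        |C * Real.exp (l * -(k : ℝ))| + dist (⟨(H.coflow (-(k : ℝ)), 0)⟩ : H.Space) x) atTop (𝓝 0) := by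
      simpa using ((hlim hu).abs.add (hlim hcast).abs).add (tendsto_iff_dist_tendsto_zero.1 hx)
    refine squeeze_zero' (Eventually.of_forall fun _ => dist_nonneg) ?_ h3
    filter_upwards [hu.eventually (eventually_le_atBot 0)] with k hk
    refine (dist_triangle _ (⟨(H.coflow (-(k : ℝ)), 0)⟩ : H.Space) _).trans ?_
    refine add_le_add_left ?_ _
    rcases le_total (a + -(k : ℝ)) (-(k : ℝ)) with hle | hle
    · exact (hdist _ _ hle (by simp)).trans (le_add_of_nonneg_left (abs_nonneg _))
    · rw [dist_comm]
      exact (hdist _ _ hle hk).trans (le_add_of_nonneg_right (abs_nonneg _))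
  have h4 := hfst _ h2
  have h5 := (((H.continuous_act a).tendsto _).comp h1).const_mul (H.coflow a)
  refine tendsto_nhds_unique h5 (h4.congr fun k => ?_)
  rw [coflow_add]
  rfl

/-- The point of `N` such that the right translate by it of the vertical subgroup is the curve
`t ↦ (1, t)` up to a left translation. -/
def center : N := H.exists_fixed.choose

theorem coflow_mul_act_center (a : ℝ) : H.coflow a * H.act a H.center = H.center :=
  H.exists_fixed.choose_spec a

end HeintzeGroup

/-! ## Vertical projections of a Heintze group -/

namespace HeintzeGroup

set_option linter.unusedSectionVars false

variable {E N : Type*} [NormedAddCommGroup E] [NormedSpace ℝ E] [FiniteDimensional ℝ E]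
  [TopologicalSpace N] [ChartedSpace E N] [Group N] [LieGroup 𝓘(ℝ, E) ∞ N]
  (H : HeintzeGroup E N)

local notation "𝓜" => ModelWithCorners.prod 𝓘(ℝ, E) 𝓘(ℝ, ℝ)

/-- The projection to the horosphere at height `M` along the vertical lines. -/
def proj (M : ℝ) (p : N × ℝ) : N × ℝ := (p.1 * (H.coflow p.2)⁻¹ * H.coflow M, M)

/-- The coordinate that is constant along vertical lines, up to conjugation. -/
def shift (q : N × ℝ) : N := H.center⁻¹ * (q.1 * (H.coflow q.2)⁻¹) * H.center

/-- The action of `ℝ` on `N`, conjugated by the center. -/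
def contract (a : ℝ) (n : N) : N := H.center * H.act (-a) n * H.center⁻¹

theorem act_center (a : ℝ) : H.act a H.center = (H.coflow a)⁻¹ * H.center := by
  rw [eq_inv_mul_iff_mul_eq, coflow_mul_act_center]

theorem act_coflow (a t : ℝ) : H.act a (H.coflow t) = (H.coflow a)⁻¹ * H.coflow (a + t) := by
  rw [coflow_add, inv_mul_cancel_left]

/-- Seen from `p`, projection to height `M` is the fixed map `shift` followed by a map depending
only on `M - p.2`. The fixed point `center` absorbs the cocycle `coflow`, so that what remains is a
conjugate of `act (-(M - p.2))`. -/
theorem leftInv_proj (M : ℝ) (p q : N × ℝ) :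
    H.leftInv (H.proj M p) (H.proj M q) =
      (H.contract (M - p.2) (H.shift (H.leftInv p q)), 0) := by
  have h1 : ∀ n, H.act (-(M - p.2)) n = H.act (-M) (H.act p.2 n) := fun n => by
    rw [← act_add]
    exact congrArg (fun t => H.act t n) (by ring)
  have h2 : p.2 + (q.2 - p.2) = q.2 := by ring
  rw [leftInv_apply, leftInv_apply]
  refine Prod.ext ?_ (by simp [proj])
  simp only [proj, contract, shift]
  rw [h1]
  simp only [map_mul, map_inv, act_act_neg, act_center, act_coflow, h2, neg_add_cancel,
    coflow_zero]
  group

theorem contMDiff_coflow_snd : ContMDiff 𝓜 𝓘(ℝ, E) 1 fun p : N × ℝ => H.coflow p.2 :=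
  H.contMDiff_coflow.comp contMDiff_snd

theorem contMDiff_proj (M : ℝ) : ContMDiff 𝓜 𝓜 1 (H.proj M) := by
  have : LieGroup 𝓘(ℝ, E) 1 N := LieGroup.of_le (n := ∞) (by norm_cast)
  exact ((contMDiff_fst.mul H.contMDiff_coflow_snd.inv).mul contMDiff_const).prodMk contMDiff_const

theorem contMDiff_shift : ContMDiff 𝓜 𝓘(ℝ, E) 1 H.shift := by
  have : LieGroup 𝓘(ℝ, E) 1 N := LieGroup.of_le (n := ∞) (by norm_cast)
  exact (contMDiff_const.mul (contMDiff_fst.mul H.contMDiff_coflow_snd.inv)).mul contMDiff_const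

theorem shift_flow (t : ℝ) : H.shift (H.flow t) = 1 := by
  rw [flow_eq]
  simp [shift]

theorem shift_one : H.shift (1, 0) = 1 := by
  rw [← H.flow_zero, H.shift_flow]

/-- The differential of `shift` at the identity. -/
def shiftDeriv : E × ℝ →L[ℝ] E := mfderiv 𝓜 𝓘(ℝ, E) H.shift (1, 0)

theorem vertField_one : (H.vertField (1, 0) : E × ℝ) = (H.vert, 1) := by
  have h : H.lmul (1, 0) = id := funext H.one_lmul
  have h1 : (mfderiv 𝓜 𝓜 (H.lmul (1, 0)) (1, 0) : E × ℝ →L[ℝ] E × ℝ) = ContinuousLinearMap.id ℝ _ := by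
    rw [h]
    exact mfderiv_id
  exact congrArg (fun L : E × ℝ →L[ℝ] E × ℝ => L (H.vert, 1)) h1

/-- `shift` is constant along the vertical flow. Hence vertical components of a velocity do not
contribute to the length of a projected path. -/
theorem shiftDeriv_vert : H.shiftDeriv (H.vert, 1) = 0 := by
  have h1 := (H.contMDiff_shift.mdifferentiableAt (x := H.flow 0) one_ne_zero).hasMFDerivAt.comp 0
    (H.isMIntegralCurve_flow 0)
  have h2 : H.shift ∘ H.flow = fun _ => 1 := funext H.shift_flow
  rw [h2] at h1
  have h3 := hasMFDerivAt_unique h1 (hasMFDerivAt_const (I := 𝓘(ℝ, ℝ)) (I' := 𝓘(ℝ, E)) (1 : N) (0 : ℝ))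
  have h4 := congrArg (fun L : ℝ →L[ℝ] E => L 1) h3
  have h5 : ∀ q, q = (1, 0) → (mfderiv 𝓜 𝓘(ℝ, E) H.shift q : E × ℝ →L[ℝ] E)
      (H.vertField q : E × ℝ) = H.shiftDeriv (H.vert, 1) := by
    rintro q rfl
    exact congrArg H.shiftDeriv H.vertField_one
  rw [← h5 _ H.flow_zero]
  refine Eq.trans ?_ h4
  exact congrArg (mfderiv 𝓜 𝓘(ℝ, E) H.shift (H.flow 0) : E × ℝ →L[ℝ] E)
    (one_smul ℝ (H.vertField (H.flow 0) : E × ℝ)).symm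

/-- The component of a vector orthogonal to the vertical direction. -/
def horizontal (u : E × ℝ) : E × ℝ := (u.1 - u.2 • H.vert, 0)

theorem shiftDeriv_horizontal (u : E × ℝ) : H.shiftDeriv (H.horizontal u) = H.shiftDeriv u := by
  have h : u = H.horizontal u + u.2 • (H.vert, (1 : ℝ)) := by
    ext <;> simp [horizontal]
  conv_rhs => rw [h, map_add, map_smul, shiftDeriv_vert, smul_zero, add_zero]

/-- The differential at the identity of the conjugation by the center. -/
def conjDeriv : E →L[ℝ] E :=
  mfderiv 𝓘(ℝ, E) 𝓘(ℝ, E) (fun n => H.center * n * H.center⁻¹) (1 : N)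

theorem contMDiff_conj : ContMDiff 𝓘(ℝ, E) 𝓘(ℝ, E) ∞ fun n => H.center * n * H.center⁻¹ :=
  (contMDiff_const.mul contMDiff_id).mul contMDiff_const

theorem hasMFDerivAt_contract (a : ℝ) :
    HasMFDerivAt 𝓘(ℝ, E) 𝓘(ℝ, E) (H.contract a) 1
      (H.conjDeriv.comp (NormedSpace.exp (-a • H.D)) : E →L[ℝ] E) := by
  have h1 : HasMFDerivAt 𝓘(ℝ, E) 𝓘(ℝ, E) (H.act (-a)) 1 (NormedSpace.exp (-a • H.D) : E →L[ℝ] E) :=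
    H.mfderiv_act (t := -a) rfl ▸
      ((H.contMDiff_act (-a)).mdifferentiableAt (x := 1) (by simp)).hasMFDerivAt
  have h2 : HasMFDerivAt 𝓘(ℝ, E) 𝓘(ℝ, E) (fun n => H.center * n * H.center⁻¹) (H.act (-a) 1)
      H.conjDeriv := by
    have h3 : HasMFDerivAt 𝓘(ℝ, E) 𝓘(ℝ, E) (fun n => H.center * n * H.center⁻¹) 1
      H.conjDeriv := (H.contMDiff_conj.mdifferentiableAt (x := 1) (by simp)).hasMFDerivAt
    have h4 : ∀ q : N, q = 1 → HasMFDerivAt 𝓘(ℝ, E) 𝓘(ℝ, E) (fun n => H.center * n * H.center⁻¹) q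
      H.conjDeriv := by
      rintro q rfl
      exact h3
    exact h4 _ (map_one _)
  exact h2.comp 1 h1

theorem hasMFDerivAt_contract_shift (a : ℝ) :
    HasMFDerivAt 𝓜 𝓜 (fun q => (H.contract a (H.shift q), (0 : ℝ))) (1, 0)
      (((H.conjDeriv.comp (NormedSpace.exp (-a • H.D))).comp H.shiftDeriv).prod
        (0 : E × ℝ →L[ℝ] ℝ) : E × ℝ →L[ℝ] E × ℝ) := by
  have h1 : HasMFDerivAt 𝓜 𝓘(ℝ, E) H.shift (1, 0) H.shiftDeriv :=
    (H.contMDiff_shift.mdifferentiableAt one_ne_zero).hasMFDerivAt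
  have h2 : ∀ q : N, q = 1 → HasMFDerivAt 𝓘(ℝ, E) 𝓘(ℝ, E) (H.contract a) q
      (H.conjDeriv.comp (NormedSpace.exp (-a • H.D)) : E →L[ℝ] E) := by
    rintro q rfl
    exact H.hasMFDerivAt_contract a
  exact ((h2 _ H.shift_one).comp (1, 0) h1).prodMk (hasMFDerivAt_const (0 : ℝ) (1, 0))

theorem toLie_mfderiv_proj (M : ℝ) (p : N × ℝ) (u : E × ℝ) :
    H.toLie (H.proj M p) (mfderiv 𝓜 𝓜 (H.proj M) p u) =
      (H.conjDeriv (NormedSpace.exp (-(M - p.2) • H.D)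
        (H.shiftDeriv (H.horizontal (H.toLie p u)))), 0) := by
  have h1 := H.hasMFDerivAt_contract_shift (M - p.2)
  rw [shiftDeriv_horizontal]
  refine (H.toLie_mfderiv ((H.contMDiff_proj M).mdifferentiableAt one_ne_zero)
    h1.mdifferentiableAt (H.leftInv_proj M p) u).trans ?_
  exact congrArg (fun L : E × ℝ →L[ℝ] E × ℝ => L (H.toLie p u)) h1.mfderiv

theorem exists_lieNorm_proj_le : ∃ K l : ℝ, 0 ≤ K ∧ 0 < l ∧ ∀ (M : ℝ) (p : N × ℝ) (u : E × ℝ),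
    -2 ≤ M - p.2 → H.lieNorm (H.toLie (H.proj M p) (mfderiv 𝓜 𝓜 (H.proj M) p u)) ≤
      K * Real.exp (-l * (M - p.2)) * H.lieNorm (H.horizontal (H.toLie p u)) := by
  obtain ⟨K, l, hl, hK⟩ := exists_norm_exp_neg_le H.D H.eigenvalues
  obtain ⟨C, c, hC, hc, hn⟩ := H.exists_lieNorm_bounds
  have hK0 : 0 ≤ K := by
    have := (norm_nonneg _).trans (hK 0 le_rfl)
    simpa using this
  -- The decay of `e^{-tD}` is known for `t ≥ 0` only. Shifting by 2 and multiplying by `e^{2D}`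
  -- covers points up to 2 above the target level.
  refine ⟨C * (‖H.conjDeriv‖ * (K * Real.exp (-l * 2) * ‖NormedSpace.exp ((2 : ℝ) • H.D)‖ *
    (‖H.shiftDeriv‖ * c))), l, by positivity, hl, fun M p u hM => ?_⟩
  rw [toLie_mfderiv_proj]
  refine (hn _).1.trans ?_
  set w := H.horizontal (H.toLie p u)
  rw [mul_assoc, mul_assoc C]
  refine mul_le_mul_of_nonneg_left ?_ hC.le
  rw [Prod.norm_def, norm_zero, max_eq_left (norm_nonneg _)]
  have h1 : NormedSpace.exp (-(M - p.2) • H.D) (H.shiftDeriv w) =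
      NormedSpace.exp (-(M - p.2 + 2) • H.D)
        (NormedSpace.exp ((2 : ℝ) • H.D) (H.shiftDeriv w)) := by
    rw [exp_smul_comp]
    congr 3
    ring
  rw [h1]
  calc _ ≤ ‖H.conjDeriv‖ * (K * Real.exp (-l * (M - p.2 + 2)) *
        (‖NormedSpace.exp ((2 : ℝ) • H.D)‖ * (‖H.shiftDeriv‖ * (c * H.lieNorm w)))) := by
        refine (ContinuousLinearMap.le_opNorm _ _).trans ?_
        gcongr
        refine (ContinuousLinearMap.le_opNorm _ _).trans ?_
        gcongr
        · exact hK _ (by linarith)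
        refine (ContinuousLinearMap.le_opNorm _ _).trans ?_
        gcongr
        refine (ContinuousLinearMap.le_opNorm _ _).trans ?_
        gcongr
        exact (hn w).2
    _ = _ := by
        rw [mul_add, Real.exp_add]
        ring

end HeintzeGroup

/-! ## Heintze groups as height spaces -/

namespace HeintzeGroup

set_option linter.unusedSectionVars false

variable {E N : Type*} [NormedAddCommGroup E] [NormedSpace ℝ E] [FiniteDimensional ℝ E]
  [TopologicalSpace N] [ChartedSpace E N] [Group N] [LieGroup 𝓘(ℝ, E) ∞ N]
  (H : HeintzeGroup E N)

local notation "𝓜" => ModelWithCorners.prod 𝓘(ℝ, E) 𝓘(ℝ, ℝ)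

theorem contDiffOn_snd {γ : ℝ → N × ℝ} {a b : ℝ}
    (hγ : ContMDiffOn 𝓘(ℝ, ℝ) 𝓜 1 γ (Icc a b)) :
    ContDiffOn ℝ 1 (fun t => (γ t).2) (Icc a b) := by
  rw [← contMDiffOn_iff_contDiffOn]
  exact contMDiff_snd.comp_contMDiffOn hγ

theorem velocity_snd {γ : ℝ → N × ℝ} {a b t : ℝ} (hab : a < b)
    (hγ : ContMDiffOn 𝓘(ℝ, ℝ) 𝓜 1 γ (Icc a b)) (ht : t ∈ Icc a b) :
    (H.velocity γ a b t).2 = derivWithin (fun t => (γ t).2) (Icc a b) t := by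
  have h1 := (hasMFDerivAt_snd (I := 𝓘(ℝ, E)) (I' := 𝓘(ℝ, ℝ)) (γ t)).comp_hasMFDerivWithinAt t
    (hγ.mdifferentiableOn one_ne_zero t ht).hasMFDerivWithinAt
  have h2 : HasFDerivWithinAt (fun t => (γ t).2)
      ((ContinuousLinearMap.snd ℝ E ℝ).comp
        (mfderivWithin 𝓘(ℝ, ℝ) 𝓜 γ (Icc a b) t : ℝ →L[ℝ] E × ℝ)) (Icc a b) t := h1.hasFDerivWithinAt
  rw [h2.hasDerivWithinAt.derivWithin (uniqueDiffOn_Icc hab t ht), velocity]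
  exact H.toLie_snd _ _

theorem ofReal_sub_le_edist (x y : H.Space) :
    ENNReal.ofReal |y.point.2 - x.point.2| ≤ edist x y := by
  refine le_of_forall_gt fun L hL => ?_
  obtain ⟨γ, h0, h1, h2, h3, -⟩ := H.exists_path_lt hL
  refine lt_of_le_of_lt ?_ h3
  have h4 := enorm_sub_le_lintegral_derivWithin_Icc_of_contDiffOn_Icc (contDiffOn_snd h2) zero_le_one
  rw [h0, h1, ← ofReal_norm, Real.norm_eq_abs] at h4
  refine h4.trans (MeasureTheory.setLIntegral_mono' measurableSet_Icc fun t ht => ?_)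
  rw [← H.velocity_snd zero_lt_one h2 ht, ← ofReal_norm]
  exact ENNReal.ofReal_le_ofReal (H.abs_snd_le_lieNorm _)

theorem abs_sub_le_dist (x y : H.Space) :
    letI := H.metricSpace
    |y.point.2 - x.point.2| ≤ dist x y := by
  let _ := H.metricSpace
  have h := H.ofReal_sub_le_edist x y
  rwa [edist_dist, ENNReal.ofReal_le_ofReal_iff dist_nonneg] at h

/-- Vertical lines are the left translates of the flow, so being isometric need only be checked for
the flow itself. -/
theorem proj_eq_lmul (M : ℝ) (p : N × ℝ) : H.proj M p = H.lmul p (H.flow (M - p.2)) := by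
  rw [flow_eq]
  refine Prod.ext ?_ (by simp [proj, lmul])
  simp only [proj, lmul, act_coflow, mul_assoc]
  rw [add_sub_cancel]

theorem proj_self (p : N × ℝ) : H.proj p.2 p = p := by
  rw [proj_eq_lmul, sub_self, flow_zero, lmul_one]

theorem edist_flow_le {s t : ℝ} (hst : s ≤ t) :
    edist (⟨H.flow s⟩ : H.Space) ⟨H.flow t⟩ ≤ ENNReal.ofReal (t - s) := by
  rcases hst.eq_or_lt with rfl | hlt
  · rw [edist_self]
    exact bot_le
  have h1 := H.edist_map_le contMDiff_id (H.contMDiff_flow.contMDiffOn (s := Icc s t)) hst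
    (f := fun _ => H.lieNorm) (fun r _ u => le_of_eq (congrArg (fun L : E × ℝ →L[ℝ] E × ℝ =>
      H.lieNorm (H.toLie (H.flow r) (L u))) (mfderiv_id (I := 𝓜) (x := H.flow r))))
  refine h1.trans (le_of_eq ?_)
  rw [MeasureTheory.setLIntegral_congr_fun (g := fun _ => 1) measurableSet_Icc fun r hr => ?_]
  · simp
  · simp only [H.velocity_flow hlt hr, lieNorm_vert, ENNReal.ofReal_one]

theorem isVertical_proj (p : N × ℝ) :
    letI := H.metricSpace
    IsVertical (fun x : H.Space => x.point.2) (fun t => (⟨H.proj t p⟩ : H.Space)) := by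
  let _ := H.metricSpace
  refine ⟨?_, fun t => rfl⟩
  have h1 : ∀ s t, s ≤ t → dist (⟨H.proj s p⟩ : H.Space) ⟨H.proj t p⟩ ≤ t - s := by
    intro s t hst
    have h := ((H.lmulIsometry p).isometry.edist_eq ⟨H.flow (s - p.2)⟩ ⟨H.flow (t - p.2)⟩).le.trans
      (H.edist_flow_le (sub_le_sub_right hst p.2))
    rw [sub_sub_sub_cancel_right, edist_dist,
      ENNReal.ofReal_le_ofReal_iff (sub_nonneg.2 hst)] at h
    rw [proj_eq_lmul, proj_eq_lmul]
    exact h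
  refine Isometry.of_dist_eq fun s t => le_antisymm ?_ ?_
  · rw [Real.dist_eq]
    rcases le_total s t with h | h
    · rw [abs_sub_comm, abs_of_nonneg (sub_nonneg.2 h)]
      exact h1 s t h
    · rw [dist_comm, abs_of_nonneg (sub_nonneg.2 h)]
      exact h1 t s h
  · rw [Real.dist_eq, abs_sub_comm]
    exact H.abs_sub_le_dist ⟨H.proj s p⟩ ⟨H.proj t p⟩

theorem lieNorm_horizontal_le (u : E × ℝ) : H.lieNorm (H.horizontal u) ≤ H.lieNorm u := by
  refine abs_le_of_sq_le_sq' ?_ (H.lieNorm_nonneg u) |>.2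
  have := H.lieNorm_horizontal_sq u
  change H.lieNorm (H.horizontal u) ^ 2 + u.2 ^ 2 = _ at this
  nlinarith [sq_nonneg u.2]

/-- With speed `L`, height component `τ` and horizontal norm `W` one has `W² = L² - τ² ≤ 2L(L - τ)`,
so weighted AM–GM gives `W ≤ (L - τ)/(2η) + ηL`. Being linear in `L` and `τ`, this can be
integrated. -/
theorem lieNorm_horizontal_add_le (u : E × ℝ) {η : ℝ} (hη : 0 < η) :
    H.lieNorm (H.horizontal u) + u.2 / (2 * η) ≤ (1 / (2 * η) + η) * H.lieNorm u := by
  have h1 := H.lieNorm_horizontal_sq u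
  change H.lieNorm (H.horizontal u) ^ 2 + u.2 ^ 2 = _ at h1
  have h2 := H.lieNorm_nonneg u
  have h3 := (le_abs_self _).trans (H.abs_snd_le_lieNorm u)
  have h4 := (neg_abs_le u.2).trans' (neg_le_neg (H.abs_snd_le_lieNorm u))
  set L := H.lieNorm u
  set W := H.lieNorm (H.horizontal u)
  have h5 : 0 ≤ (L - u.2) / (2 * η) + η * L := by
    have := sub_nonneg.2 h3
    positivity
  have h6 : W ≤ (L - u.2) / (2 * η) + η * L := by
    refine (abs_le_of_sq_le_sq' ?_ h5).2
    have h7 : ((L - u.2) / (2 * η) + η * L) ^ 2 =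
        ((L - u.2) / (2 * η) - η * L) ^ 2 + 2 * L * (L - u.2) := by
      field_simp
      ring
    rw [h7]
    nlinarith [sq_nonneg ((L - u.2) / (2 * η) - η * L)]
  have h8 : (1 / (2 * η) + η) * L - u.2 / (2 * η) = (L - u.2) / (2 * η) + η * L := by
    field_simp
    ring
  linarith

/-- The integral of `L - τ` is the excess of the length over the height gain, at most `ε`. A path
with small excess has small horizontal length. -/
theorem lintegral_horizontal_le {γ : ℝ → N × ℝ} (hγ : ContMDiffOn 𝓘(ℝ, ℝ) 𝓜 1 γ (Icc 0 1))
    {ε η : ℝ} (hη : 0 < η) (h0 : 0 ≤ (γ 1).2 - (γ 0).2 + ε)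
    (h : ∫⁻ t in Icc 0 1, ENNReal.ofReal (H.lieNorm (H.velocity γ 0 1 t)) ≤
      ENNReal.ofReal ((γ 1).2 - (γ 0).2 + ε)) :
    ∫⁻ t in Icc 0 1, ENNReal.ofReal (H.lieNorm (H.horizontal (H.velocity γ 0 1 t))) ≤
      ENNReal.ofReal (ε / (2 * η) + η * ((γ 1).2 - (γ 0).2 + ε)) := by
  set a := (γ 1).2 - (γ 0).2 with ha
  have hg := contDiffOn_snd hγ
  set τ := derivWithin (fun t => (γ t).2) (Icc 0 1) with hτ
  have hc : ContinuousOn τ (Icc 0 1) := hg.continuousOn_derivWithin (uniqueDiffOn_Icc_zero_one) le_rfl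
  -- Adding the bound `B` to `τ` makes it nonnegative, so that it can enter lower integrals and be
  -- subtracted at the end.
  obtain ⟨B, hB⟩ := isCompact_Icc.exists_bound_of_continuousOn hc
  have hB0 : 0 ≤ B := (norm_nonneg _).trans (hB 0 ⟨le_rfl, zero_le_one⟩)
  have hpos : ∀ t ∈ Icc (0 : ℝ) 1, 0 ≤ (τ t + B) / (2 * η) := fun t ht => by
    have := (abs_le.1 ((Real.norm_eq_abs _).symm.trans_le (hB t ht))).1
    exact div_nonneg (by linarith) (by positivity)
  have hc' : ContinuousOn (fun t => (τ t + B) / (2 * η)) (Icc 0 1) :=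
    (hc.add continuousOn_const).div_const _
  have hint : ∫ t in (0 : ℝ)..1, τ t = a :=
    intervalIntegral.integral_derivWithin_Icc_of_contDiffOn_Icc hg zero_le_one
  have h1 : ∫⁻ t in Icc 0 1, ENNReal.ofReal ((τ t + B) / (2 * η)) =
      ENNReal.ofReal ((a + B) / (2 * η)) := by
    rw [← MeasureTheory.ofReal_integral_eq_lintegral_ofReal hc'.integrableOn_Icc
      ((MeasureTheory.ae_restrict_iff' measurableSet_Icc).2 (Eventually.of_forall hpos)),
      MeasureTheory.integral_Icc_eq_integral_Ioc, ← intervalIntegral.integral_of_le zero_le_one,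
      intervalIntegral.integral_div, intervalIntegral.integral_add
        (hc.intervalIntegrable_of_Icc zero_le_one) (intervalIntegrable_const), hint]
    simp
  have h2 : (∫⁻ t in Icc 0 1, ENNReal.ofReal (H.lieNorm (H.horizontal (H.velocity γ 0 1 t)))) +
      ENNReal.ofReal ((a + B) / (2 * η)) ≤
      ENNReal.ofReal ((1 / (2 * η) + η) * (a + ε) + B / (2 * η)) := by
    have hm : AEMeasurable (fun t => ENNReal.ofReal ((τ t + B) / (2 * η)))
        (MeasureTheory.volume.restrict (Icc 0 1)) :=
      ENNReal.measurable_ofReal.comp_aemeasurable (hc'.aemeasurable measurableSet_Icc)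
    rw [← h1, ← MeasureTheory.lintegral_add_right' _ hm]
    calc _ ≤ ∫⁻ t in Icc 0 1, (ENNReal.ofReal (1 / (2 * η) + η) *
          ENNReal.ofReal (H.lieNorm (H.velocity γ 0 1 t)) + ENNReal.ofReal (B / (2 * η))) := by
          refine MeasureTheory.setLIntegral_mono' measurableSet_Icc fun t ht => ?_
          rw [← ENNReal.ofReal_add (H.lieNorm_nonneg _) (hpos t ht),
            ← ENNReal.ofReal_mul (by positivity),
            ← ENNReal.ofReal_add (mul_nonneg (by positivity) (H.lieNorm_nonneg _)) (by positivity)]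
          refine ENNReal.ofReal_le_ofReal ?_
          have := H.lieNorm_horizontal_add_le (H.velocity γ 0 1 t) hη
          rw [H.velocity_snd zero_lt_one hγ ht] at this
          rw [add_div]
          linarith
      _ = ENNReal.ofReal (1 / (2 * η) + η) *
          (∫⁻ t in Icc 0 1, ENNReal.ofReal (H.lieNorm (H.velocity γ 0 1 t))) +
            ENNReal.ofReal (B / (2 * η)) := by
          rw [MeasureTheory.lintegral_add_right' _ aemeasurable_const,
            MeasureTheory.lintegral_const_mul' _ _ ENNReal.ofReal_ne_top]
          simp
      _ ≤ ENNReal.ofReal (1 / (2 * η) + η) * ENNReal.ofReal (a + ε) +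
            ENNReal.ofReal (B / (2 * η)) := by gcongr
      _ = _ := by
          rw [← ENNReal.ofReal_mul (by positivity), ← ENNReal.ofReal_add
            (mul_nonneg (by positivity) h0) (by positivity)]
  have hab : 0 ≤ (a + B) / (2 * η) := by
    have h3 : -B ≤ a := by
      have := intervalIntegral.norm_integral_le_of_norm_le_const (a := (0 : ℝ)) (b := 1) (f := τ)
        (C := B) fun t ht => hB t (by
          rw [uIoc_of_le zero_le_one] at ht
          exact ⟨ht.1.le, ht.2⟩)
      rw [hint, Real.norm_eq_abs] at this
      have := (abs_le.1 this).1
      simpa using this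
    exact div_nonneg (by linarith) (by positivity)
  refine (ENNReal.le_sub_of_add_le_right ENNReal.ofReal_ne_top h2).trans (le_of_eq ?_)
  rw [← ENNReal.ofReal_sub _ hab]
  congr 1
  field_simp
  ring

end HeintzeGroup

/-! ### Exponential contraction and upward uniqueness in the group -/

namespace HeintzeGroup

set_option linter.unusedSectionVars false

variable {E N : Type*} [NormedAddCommGroup E] [NormedSpace ℝ E] [FiniteDimensional ℝ E]
  [TopologicalSpace N] [ChartedSpace E N] [Group N] [LieGroup 𝓘(ℝ, E) ∞ N]
  (H : HeintzeGroup E N)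

local notation "𝓜" => ModelWithCorners.prod 𝓘(ℝ, E) 𝓘(ℝ, ℝ)

theorem exists_edist_proj_le : ∃ K l : ℝ, 0 ≤ K ∧ 0 < l ∧ ∀ (M m : ℝ) (γ : ℝ → N × ℝ),
    ContMDiffOn 𝓘(ℝ, ℝ) 𝓜 1 γ (Icc 0 1) → m ≤ M → (∀ t ∈ Icc (0 : ℝ) 1, (γ t).2 ≤ m + 2) →
    edist (⟨H.proj M (γ 0)⟩ : H.Space) ⟨H.proj M (γ 1)⟩ ≤
      ENNReal.ofReal (K * Real.exp (-l * (M - m))) *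
        ∫⁻ t in Icc 0 1, ENNReal.ofReal (H.lieNorm (H.horizontal (H.velocity γ 0 1 t))) := by
  obtain ⟨K, l, hK, hl, h⟩ := H.exists_lieNorm_proj_le
  refine ⟨K * Real.exp (l * 2), l, by positivity, hl, fun M m γ hγ hm hγm => ?_⟩
  refine (H.edist_map_le (H.contMDiff_proj M) hγ zero_le_one (f := fun t w =>
    K * Real.exp (l * 2) * Real.exp (-l * (M - m)) * H.lieNorm (H.horizontal w))
    fun t ht u => ?_).trans (le_of_eq ?_)
  · refine (h M (γ t) u (by linarith [hγm t ht])).trans ?_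
    refine mul_le_mul_of_nonneg_right ?_ (H.lieNorm_nonneg _)
    rw [mul_assoc, ← Real.exp_add]
    refine mul_le_mul_of_nonneg_left (Real.exp_le_exp.2 ?_) hK
    nlinarith [hγm t ht]
  · rw [← MeasureTheory.lintegral_const_mul' _ _ ENNReal.ofReal_ne_top]
    refine MeasureTheory.lintegral_congr fun t => ?_
    rw [ENNReal.ofReal_mul (by positivity)]

/-- A path from `x` to `y` with excess length less than `η²` has horizontal length at most `η/2 +
η(a + η²)`. Its projection to the height of `y` is at most a constant times as long, so `y`
coincides with the projection of `x`. -/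
theorem eq_proj_of_dist_eq (x y : H.Space) :
    letI := H.metricSpace
    dist x y = y.point.2 - x.point.2 → y = ⟨H.proj y.point.2 x.point⟩ := by
  let _ := H.metricSpace
  intro hxy
  obtain ⟨K, l, hK, hl, h⟩ := H.exists_edist_proj_le
  set a := y.point.2 - x.point.2 with ha
  have ha0 : 0 ≤ a := hxy ▸ dist_nonneg
  have key : ∀ η : ℝ, 0 < η → η ≤ 1 →
      dist (⟨H.proj y.point.2 x.point⟩ : H.Space) y ≤ K * (η / 2 + η * (a + η * η)) := by
    intro η hη hη1
    have hη2 : 0 < η * η := by positivity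
    obtain ⟨γ, h0, h1, h2, h3, h4⟩ := H.exists_path_lt (x := x) (y := y)
      (L := ENNReal.ofReal (a + η * η)) (by
        rw [edist_dist, hxy]
        exact (ENNReal.ofReal_lt_ofReal_iff (by positivity)).2 (by linarith))
    have h5 := h y.point.2 y.point.2 γ h2 le_rfl fun t ht => by
      have h6 := h4 t ht
      rw [edist_dist, ENNReal.ofReal_lt_ofReal_iff (by positivity)] at h6
      have h7 := (le_abs_self _).trans (H.abs_sub_le_dist x ⟨γ t⟩)
      change (γ t).2 - x.point.2 ≤ _ at h7
      nlinarith
    have h6 : (γ 1).2 - (γ 0).2 = a := by rw [h0, h1]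
    have h8 := H.lintegral_horizontal_le h2 (ε := η * η) hη (by rw [h6]; positivity)
      (by rw [h6]; exact h3.le)
    rw [h0, h1, H.proj_self, sub_self, mul_zero, Real.exp_zero, mul_one] at h5
    rw [h6] at h8
    have h9 := h5.trans (mul_le_mul_right h8 _)
    rw [← ENNReal.ofReal_mul hK, edist_dist, ENNReal.ofReal_le_ofReal_iff (by positivity)] at h9
    refine h9.trans (le_of_eq ?_)
    field_simp
  have hlim : Tendsto (fun η : ℝ => K * (η / 2 + η * (a + η * η))) (𝓝[>] 0) (𝓝 0) := by
    have h1 : Continuous fun η : ℝ => K * (η / 2 + η * (a + η * η)) := by fun_prop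
    have h2 := h1.tendsto 0
    simp only [zero_div, zero_mul, add_zero, mul_zero] at h2
    exact h2.mono_left nhdsWithin_le_nhds
  have h0 : dist (⟨H.proj y.point.2 x.point⟩ : H.Space) y ≤ 0 := by
    refine ge_of_tendsto hlim ?_
    filter_upwards [Ioc_mem_nhdsGT one_pos] with η hη
    exact key η hη.1 hη.2
  exact (dist_le_zero.1 h0).symm

theorem heightSpace :
    letI := H.metricSpace
    HeightSpace H.Space (fun x => x.point.2) := by
  let _ := H.metricSpace
  refine { lip := fun x y => (le_abs_self _).trans (H.abs_sub_le_dist x y), line := fun x =>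
    ⟨_, H.isVertical_proj x.point, Space.ext (H.proj_self x.point)⟩, unique := ?_, contr := ?_ }
  · intro x y z hy hz hyz
    have h1 := H.eq_proj_of_dist_eq x y hy
    have h2 := H.eq_proj_of_dist_eq x z hz
    change y.point.2 = z.point.2 at hyz
    rw [h1, h2, hyz]
  · obtain ⟨K, l, hK, hl, h⟩ := H.exists_edist_proj_le
    refine ⟨K * 2, l, hl, fun x y x' y' hxy hx hy hh => ?_⟩
    change x'.point.2 = y'.point.2 at hh
    -- A path of length less than 2 joins the points and stays less than 2 above `x`, within the
    -- range of the projection estimate.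
    obtain ⟨γ, h0, h1, h2, h3, h4⟩ := H.exists_path_lt (x := x) (y := y)
      (L := ENNReal.ofReal 2) (by
        rw [edist_dist]
        exact (ENNReal.ofReal_lt_ofReal_iff (by positivity)).2 (by linarith))
    have h5 := h x'.point.2 x.point.2 γ h2 (sub_nonneg.1 (hx ▸ dist_nonneg)) fun t ht => by
      have h6 := h4 t ht
      rw [edist_dist, ENNReal.ofReal_lt_ofReal_iff (by positivity)] at h6
      have h7 := (le_abs_self _).trans (H.abs_sub_le_dist x ⟨γ t⟩)
      change (γ t).2 - x.point.2 ≤ _ at h7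
      linarith
    have h6 : ∫⁻ t in Icc 0 1, ENNReal.ofReal (H.lieNorm (H.horizontal (H.velocity γ 0 1 t))) ≤
        ENNReal.ofReal 2 :=
      (MeasureTheory.lintegral_mono fun t =>
        ENNReal.ofReal_le_ofReal (H.lieNorm_horizontal_le _)).trans h3.le
    have h7 := h5.trans (mul_le_mul_right h6 _)
    rw [h0, h1, ← ENNReal.ofReal_mul (by positivity), edist_dist,
      ENNReal.ofReal_le_ofReal_iff (by positivity), ← H.eq_proj_of_dist_eq x x' hx, hh,
      ← H.eq_proj_of_dist_eq y y' hy, ← hh] at h7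
    linarith

end HeintzeGroup

/-! ## Millefeuille spaces as height spaces -/

namespace Millefeuille

variable {E N V : Type*} [NormedAddCommGroup E] [NormedSpace ℝ E] [FiniteDimensional ℝ E]
  [TopologicalSpace N] [ChartedSpace E N] [Group N] [LieGroup 𝓘(ℝ, E) ∞ N]
  (H : HeintzeGroup E N) (T : RegularTree V)

/-- A millefeuille space is a metric space. -/
abbrev metricSpace : MetricSpace (Millefeuille H T) :=
  letI := H.metricSpace
  letI := T.metricSpace
  Fibre.metricSpace H.heightSpace T.lineSpace (βA := H.busemann) (βB := T.busemann)
    (fun _ => rfl) (fun _ => (neg_neg _).symm) H.hasShortPaths T.hasVerticalChains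

theorem heightSpace :
    letI := metricSpace H T
    HeightSpace (Millefeuille H T) (fun p => p.point.1.point.2) :=
  letI := H.metricSpace
  letI := T.metricSpace
  Fibre.heightSpace H.heightSpace T.lineSpace (βA := H.busemann) (βB := T.busemann)
    (fun _ => rfl) (fun _ => (neg_neg _).symm) H.hasShortPaths T.hasVerticalChains

theorem properSpace :
    letI := metricSpace H T
    ProperSpace (Millefeuille H T) :=
  letI := H.metricSpace
  letI := T.metricSpace
  haveI := H.properSpace
  haveI := T.properSpace
  Fibre.properSpace H.heightSpace T.lineSpace (βA := H.busemann) (βB := T.busemann)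
    (fun _ => rfl) (fun _ => (neg_neg _).symm) H.hasShortPaths T.hasVerticalChains

theorem isGeodesicSpace :
    letI := metricSpace H T
    IsGeodesicSpace (Millefeuille H T) :=
  letI := H.metricSpace
  letI := T.metricSpace
  haveI := H.properSpace
  haveI := T.properSpace
  Fibre.isGeodesicSpace H.heightSpace T.lineSpace (βA := H.busemann) (βB := T.busemann)
    (fun _ => rfl) (fun _ => (neg_neg _).symm) H.hasShortPaths T.hasVerticalChains

end Millefeuille

end Horo

end

/-! ### The homeomorphism for millefeuille spaces -/

theorem mainTheorem5
    {E₁ N₁ V₁ E₂ N₂ V₂ : Type*}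
    [NormedAddCommGroup E₁] [NormedSpace ℝ E₁] [FiniteDimensional ℝ E₁]
    [TopologicalSpace N₁] [ChartedSpace E₁ N₁] [Group N₁] [LieGroup 𝓘(ℝ, E₁) ∞ N₁]
    [NormedAddCommGroup E₂] [NormedSpace ℝ E₂] [FiniteDimensional ℝ E₂]
    [TopologicalSpace N₂] [ChartedSpace E₂ N₂] [Group N₂] [LieGroup 𝓘(ℝ, E₂) ∞ N₂]
    (H₁ : Horo.HeintzeGroup E₁ N₁) (T₁ : Horo.RegularTree V₁)
    (H₂ : Horo.HeintzeGroup E₂ N₂) (T₂ : Horo.RegularTree V₂)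
    (n : Horo.AdmissibleNorm)
    (o₁ : Horo.Millefeuille H₁ T₁) (o₂ : Horo.Millefeuille H₂ T₂) :
    ∃ Φ : Horo.VerticalBoundary n
          (Horo.Millefeuille.busemann (H := H₁) (T := T₁))
          (Horo.Millefeuille.busemann (H := H₂) (T := T₂)) ≃ₜ
        Horo.ParabolicBoundary Horo.Millefeuille.busemann o₁ ×
          Horo.ParabolicBoundary Horo.Millefeuille.busemann o₂,
      ∀ γ, Horo.EndsAt (fun t : ℝ≥0 => (γ.1 (-(t : ℝ))).point.fst) (Φ γ).1.1 ∧
        Horo.EndsAt (fun t : ℝ≥0 => (γ.1 (t : ℝ)).point.snd) (Φ γ).2.1 := by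
  let _ := Horo.Millefeuille.metricSpace H₁ T₁
  let _ := Horo.Millefeuille.metricSpace H₂ T₂
  have _ := Horo.Millefeuille.properSpace H₁ T₁
  have _ := Horo.Millefeuille.properSpace H₂ T₂
  have s₁ := Horo.Millefeuille.heightSpace H₁ T₁
  have s₂ := Horo.Millefeuille.heightSpace H₂ T₂
  have g₁ := Horo.Millefeuille.isGeodesicSpace H₁ T₁
  have g₂ := Horo.Millefeuille.isGeodesicSpace H₂ T₂
  obtain ⟨e, he⟩ := Horo.exists_homeomorph_verticalLines (n := n)
    (βX := Horo.Millefeuille.busemann (H := H₁) (T := T₁))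
    (βY := Horo.Millefeuille.busemann (H := H₂) (T := T₂)) s₁ s₂ g₁ g₂ (fun _ => rfl) (fun _ => rfl)
  obtain ⟨e₁, he₁⟩ := s₁.exists_homeomorph_parabolicBoundary g₁
    (β := Horo.Millefeuille.busemann (H := H₁) (T := T₁)) (fun _ => rfl) o₁
  obtain ⟨e₂, he₂⟩ := s₂.exists_homeomorph_parabolicBoundary g₂
    (β := Horo.Millefeuille.busemann (H := H₂) (T := T₂)) (fun _ => rfl) o₂
  refine ⟨e.trans (e₁.prodCongr e₂), fun γ => ⟨?_, ?_⟩⟩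
  · have h := he₁ (e γ).1
    simp only [(he γ).1] at h
    exact h
  -- The second vertical line is the reversed second coordinate, so its lower end is the end of that
  -- coordinate at `+∞`.
  · have h := he₂ (e γ).2
    simp only [(he γ).2, neg_neg] at h
    exact h
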